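/- **Setting.** All functions and distributions are real valued on $\mathbb R^3$; $\mathcal S$, $\mathcal S'$ denote Schwartz functions and tempered distributions, and $S(t)$ is the heat semigroup (convolution with $(4\pi t)^{-3/2}e^{-|x|^2/(4t)}$). For a Banach space $E$ and $f\in E^3$ (or $E^{3\times 3}$), $\|f\|_E$ is the maximum of the norms of the components. $\mathbb P$ is the Leray projection onto divergence-free fields, and $(\nabla\cdot h)_i=\sum_k\partial_kh_{ki}$. For $f\in\mathcal S'$ and $\lambda>0$, $f_\lambda=f(\lambda\,\cdot)$. A mollifier is a nonnegative $\omega\in C_c^\infty(\mathbb R^3)$ with $\int\omega=1$. The product $fg$ of $f,g\in\mathcal S'$ is well defined if $(\rho_\epsilon*f)(\rho_\epsilon*g)$ with $\rho_\epsilon=\epsilon^{-3}\rho(\cdot/\epsilon)$ converges in $\mathcal S'$ as $\epsilon\to0^+$, for every mollifier $\rho$, to one and the same limit, and $fg$ is then this limit. A Banach space $E$ is *functional and translation invariant* if $\mathcal S\subset E\subset\mathcal S'$ with continuous inclusions; either both inclusions are dense, or $E=F^*$ for a Banach space $F$ with $\mathcal S\subset F\subset\mathcal S'$ continuously and densely;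 and $f(\cdot-y)\in E$ with $\|f(\cdot-y)\|_E=\|f\|_E$ for all $f\in E$, $y\in\mathbb R^3$. It is *adequate* if moreover, for all $f,g\in E^3$, the product $f\otimes g$ is well defined in $\mathcal S'$ and $\|\mathbb P\nabla S(\tau)\cdot(f\otimes g)\|_E\le w(\tau)\|f\|_E\|g\|_E$ for $0<\tau<T_0$, with some $T_0>0$ and some positive $w\in L^1(0,T_0)$ that do not depend on $f,g$. Its norm has *scaling degree* $k$ if $\|f_\lambda\|_E=\lambda^k\|f\|_E$ whenever $\lambda>0$ and $f,f_\lambda\in E$. For $\alpha\ge0$, $BE^\alpha$ is the space of $f\in\mathcal S'$ with $\|f\|_{BE^\alpha}=\sup_{t>0}t^{\alpha/2}\|S(t)f\|_E<\infty$. **Theorem.** Let $p>3$, let $E_p$ be an adequate Banach space whose norm has scaling degree $-3/p$, and assume that $\mathcal S$ is dense in $E_p$. There are constants $C\ge1$ and $\varepsilon_0>0$, depending only on $E_p$ and $p$, such that the following holds for every $0<\varepsilon\le\varepsilon_0$ and every mollifier $\omega$. Let $u_0\in BE_p^{1-3/p}$ and $V(t)\in E_p^{3\times3}$ $(t>0)$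 satisfy $$\|u_0\|_{BE_p^{1-3/p}}+\sup_{t>0}t^{1-3/(2p)}\|V(t)\|_{E_p}<\varepsilon ,$$ let $u_0$ be homogeneous of degree $-1$, and let $F=\nabla\cdot V$ satisfy $F(x,t)=\lambda^3F(\lambda x,\lambda^2t)$ for all $\lambda,t>0$. Then each of the integral equations (with Bochner integrals in $E_p$) $$u(t)=S(t)u_0-\int_0^tS(t-\tau)\mathbb P\nabla\cdot(u\otimes u)(\tau)\,d\tau+\int_0^tS(t-\tau)\mathbb PF(\tau)\,d\tau ,$$ $$v(t)=S(t)u_0-\int_0^tS(t-\tau)\mathbb P\nabla\cdot\big((\omega*v)\otimes v\big)(\tau)\,d\tau+\int_0^tS(t-\tau)\mathbb PF(\tau)\,d\tau$$ (the Navier–Stokes system and the mollified Navier–Stokes system) has exactly one solution $z$ ($z=u$, respectively $z=v$) among the functions $z:(0,\infty)\to E_p^3$ that are bounded and norm continuous as functions into $BE_p^{1-3/p}$, converge to $u_0$ in $\mathcal S'$ as $t\to0^+$, and satisfy $\sup_{t>0}t^{(1-3/p)/2}\|z(t)\|_{E_p}\le 2C\varepsilon$. Moreover $u$ is self-similar,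 $u(x,t)=t^{-1/2}U(x/\sqrt t)$ with $U\in E_p^3$, and $$\lim_{t\to\infty}t^{(1-3/p)/2}\,\|u(t)-v(t)\|_{E_p}=0 .$$ -/

import Mathlib

open MeasureTheory Filter Set
open scoped SchwartzMap ENNReal Topology

namespace AbstractNS

/-! ## Test functions and tempered distributions on `ℝ³` (real valued) -/

abbrev R3 : Type := EuclideanSpace ℝ (Fin 3)

/-- The Schwartz class `𝓢(ℝ³)` of real-valued functions. -/
abbrev Test : Type := 𝓢(R3, ℝ)

/-- Real tempered distributions on `ℝ³`, with the topology of pointwise convergence. -/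
abbrev Distr : Type := 𝓢(R3, ℝ) →Lₚₜ[ℝ] ℝ

/-- `φ ↦ φ(l ·)` on test functions (meaningful for `l ≠ 0`). -/
noncomputable def dilateTest (l : ℝ) : Test →L[ℝ] Test :=
  if h : l ≠ 0 then
    SchwartzMap.compCLMOfContinuousLinearEquiv ℝ
      (ContinuousLinearEquiv.smulLeft (R₁ := ℝ) (M₁ := R3) (Units.mk0 l h))
  else 0

theorem dilateTest_apply {l : ℝ} (hl : 0 < l) (φ : Test) (x : R3) :
    dilateTest l φ x = φ (l • x) := by
  simp [dilateTest, hl.ne', Units.smul_def]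

/-- `φ ↦ φ(- ·)` on test functions. -/
noncomputable def reflectTest : Test →L[ℝ] Test :=
  SchwartzMap.compCLMOfContinuousLinearEquiv ℝ (ContinuousLinearEquiv.neg ℝ)

theorem reflectTest_apply (φ : Test) (x : R3) : reflectTest φ x = φ (-x) := by
  simp [reflectTest]

/-- Convolution `φ ↦ κ * φ` on test functions. -/
noncomputable def convTest (κ : Test) : Test →L[ℝ] Test :=
  (SchwartzMap.postcompCLM (𝕜 := ℝ) Complex.reCLM) ∘L
    ((SchwartzMap.convolution (ContinuousLinearMap.mul ℂ ℂ)
      (κ.postcompCLM (𝕜 := ℝ) Complex.ofRealCLM)).restrictScalars ℝ) ∘L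
    (SchwartzMap.postcompCLM (𝕜 := ℝ) Complex.ofRealCLM)

theorem convTest_apply (κ φ : Test) (x : R3) :
    convTest κ φ x = ∫ y, κ y * φ (x - y) := by
  simp only [convTest, ContinuousLinearMap.comp_apply, SchwartzMap.postcompCLM_apply,
    ContinuousLinearMap.coe_restrictScalars', SchwartzMap.convolution_apply,
    MeasureTheory.convolution_def, ContinuousLinearMap.mul_apply', Complex.ofRealCLM_apply,
    Complex.reCLM_apply]
  rw [← Complex.ofReal_re (∫ y, κ y * φ (x - y)), ← integral_complex_ofReal]
  simp

/-- Partial derivative `∂ᵢ` of a tempered distribution. -/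
noncomputable def partialD (i : Fin 3) : Distr →L[ℝ] Distr :=
  PointwiseConvergenceCLM.precomp ℝ
    (-LineDeriv.lineDerivOpCLM ℝ 𝓢(R3, ℝ) (EuclideanSpace.single i (1 : ℝ)))

/-- Translation `τ_y f = f(· - y)` of a tempered distribution. -/
noncomputable def translate (y : R3) : Distr →L[ℝ] Distr :=
  PointwiseConvergenceCLM.precomp ℝ (SchwartzMap.compSubConstCLM ℝ (-y))

/-- The rescaled distribution `f_l = f(l ·)`, `l > 0`:
`⟨f_l, φ⟩ = l⁻³ ⟨f, φ(l⁻¹ ·)⟩`. -/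
noncomputable def dilate (l : ℝ) : Distr →L[ℝ] Distr :=
  PointwiseConvergenceCLM.precomp ℝ ((l ^ 3)⁻¹ • dilateTest l⁻¹)

/-- Convolution `κ * f` of a tempered distribution with a Schwartz function:
`⟨κ * f, φ⟩ = ⟨f, κ(- ·) * φ⟩`. -/
noncomputable def conv (κ : Test) : Distr →L[ℝ] Distr :=
  PointwiseConvergenceCLM.precomp ℝ (convTest (reflectTest κ))

/-- The smooth function `x ↦ (κ * f)(x) = ⟨f, κ(x - ·)⟩`. -/
noncomputable def convFun (κ : Test) (f : Distr) (x : R3) : ℝ :=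
  f (SchwartzMap.compSubConstCLM ℝ x (reflectTest κ))

/-! ## The heat semigroup -/

theorem temperate_fderiv {F : Type} [NormedAddCommGroup F] [NormedSpace ℝ F] {g : R3 → F}
    (hg : g.HasTemperateGrowth) : (fderiv ℝ g).HasTemperateGrowth := by
  refine ⟨hg.1.fderiv_right (by simp), fun n => ?_⟩
  obtain ⟨k, C, h⟩ := hg.2 (n + 1)
  exact ⟨k, C, fun x => by rw [norm_iteratedFDeriv_fderiv]; exact h x⟩

theorem gaussian_bound (c : ℝ) (n : ℕ) : ∀ (F : Type) [NormedAddCommGroup F] [NormedSpace ℝ F]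
    (g : R3 → F), g.HasTemperateGrowth → ∃ (k : ℕ) (C : ℝ), 0 ≤ C ∧ ∀ x,
      ‖iteratedFDeriv ℝ n (fun x => Real.exp (-c * ‖x‖ ^ 2) • g x) x‖ ≤
        C * (1 + ‖x‖) ^ k * Real.exp (-c * ‖x‖ ^ 2) := by
  induction n with
  | zero =>
    intro F _ _ g hg
    obtain ⟨k, C, h⟩ := hg.2 0
    refine ⟨k, |C|, abs_nonneg _, fun x => ?_⟩
    have h1 := h x
    simp only [norm_iteratedFDeriv_zero, norm_smul, Real.norm_eq_abs, Real.abs_exp] at h1 ⊢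
    rw [mul_comm]
    gcongr
    exact h1.trans (by gcongr; exact le_abs_self C)
  | succ n ih =>
    intro F _ _ g hg
    have hg' : (fderiv ℝ g).HasTemperateGrowth := temperate_fderiv hg
    have hB : (fun x : R3 => (-(2 * c)) •
        (ContinuousLinearMap.smulRightL ℝ R3 F) (innerSL ℝ x) (g x)).HasTemperateGrowth := by
      have h1 : (fun x : R3 => innerSL ℝ x).HasTemperateGrowth :=
        (innerSL ℝ : R3 →L[ℝ] _).hasTemperateGrowth
      have h2 := (ContinuousLinearMap.smulRightL ℝ R3 F).bilinear_hasTemperateGrowth h1 hg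
      exact (Function.HasTemperateGrowth.const (-(2 * c))).smul h2
    obtain ⟨k, C, hC, h⟩ := ih (R3 →L[ℝ] F) _ (hg'.add hB)
    refine ⟨k, C, hC, fun x => ?_⟩
    rw [← norm_iteratedFDeriv_fderiv]
    convert h x using 3
    ext1 y
    have hgd : DifferentiableAt ℝ g y := (hg.1.differentiable (by simp)) y
    have h0 : HasFDerivAt (fun x : R3 => ‖x‖ ^ 2) (2 • innerSL ℝ y) y :=
      (hasStrictFDerivAt_norm_sq y).hasFDerivAt
    have he := ((h0.const_mul (-c)).exp).smul hgd.hasFDerivAt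
    refine he.fderiv.trans ?_
    ext v
    simp [smul_smul]
    module

theorem poly_mul_gaussian_bound {c : ℝ} (hc : 0 < c) (N : ℕ) :
    ∃ M : ℝ, ∀ r : ℝ, 0 ≤ r → (1 + r) ^ N * Real.exp (-c * r ^ 2) ≤ M := by
  refine ⟨N.factorial * Real.exp (1 + 1 / (4 * c)), fun r hr => ?_⟩
  have h1 : (1 + r) ^ N ≤ N.factorial * Real.exp (1 + r) := by
    have := Real.pow_div_factorial_le_exp (1 + r) (by positivity) N
    rw [div_le_iff₀ (by positivity)] at this
    linarith
  calc (1 + r) ^ N * Real.exp (-c * r ^ 2)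
      ≤ (N.factorial * Real.exp (1 + r)) * Real.exp (-c * r ^ 2) := by gcongr
    _ = N.factorial * Real.exp (1 + r + -c * r ^ 2) := by rw [mul_assoc, ← Real.exp_add]
    _ ≤ _ := by
        refine mul_le_mul_of_nonneg_left (Real.exp_le_exp.2 ?_) (by positivity)
        have : 0 ≤ (r * (2 * c) - 1) ^ 2 / (4 * c) := by positivity
        have h2 : (r * (2 * c) - 1) ^ 2 / (4 * c) = c * r ^ 2 - r + 1 / (4 * c) := by
          field_simp
          ring
        linarith

theorem gaussian_decay (a : ℝ) {c : ℝ} (hc : 0 < c) (k n : ℕ) :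
    ∃ M : ℝ, ∀ x : R3,
      ‖x‖ ^ k * ‖iteratedFDeriv ℝ n (fun x : R3 => Real.exp (-c * ‖x‖ ^ 2) • a) x‖ ≤ M := by
  obtain ⟨m, C, hC, h⟩ := gaussian_bound c n ℝ (fun _ => a) (.const _)
  obtain ⟨M, hM⟩ := poly_mul_gaussian_bound hc (k + m)
  refine ⟨C * M, fun x => ?_⟩
  calc _ ≤ (1 + ‖x‖) ^ k * (C * (1 + ‖x‖) ^ m * Real.exp (-c * ‖x‖ ^ 2)) := by
        gcongr
        · linarith
        · exact h x
    _ = C * ((1 + ‖x‖) ^ (k + m) * Real.exp (-c * ‖x‖ ^ 2)) := by rw [pow_add]; ring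
    _ ≤ _ := by gcongr; exact hM _ (norm_nonneg _)

/-- The Gaussian kernel `(4πt)^{-3/2} exp(-|x|²/(4t))` as a Schwartz function
(set to `0` for `t ≤ 0`, which is never used). -/
noncomputable def heatKernel (t : ℝ) : Test :=
  if ht : 0 < t then
    { toFun := fun x => Real.exp (-(1 / (4 * t)) * ‖x‖ ^ 2) • (4 * Real.pi * t) ^ (-(3 / 2) : ℝ)
      smooth' := ((contDiff_const.mul (contDiff_norm_sq ℝ)).exp).smul contDiff_const
      decay' := gaussian_decay _ (by positivity) }
  else 0

theorem heatKernel_apply {t : ℝ} (ht : 0 < t) (x : R3) :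
    heatKernel t x = (4 * Real.pi * t) ^ (-(3 / 2) : ℝ) * Real.exp (-‖x‖ ^ 2 / (4 * t)) := by
  have h : heatKernel t x =
      Real.exp (-(1 / (4 * t)) * ‖x‖ ^ 2) • (4 * Real.pi * t) ^ (-(3 / 2) : ℝ) := by
    simp only [heatKernel, ht, dite_true]
    rfl
  rw [h, smul_eq_mul, mul_comm]
  congr 2
  ring

/-- The heat semigroup `S(t)`, `t > 0`, on tempered distributions. -/
noncomputable def heat (t : ℝ) : Distr →L[ℝ] Distr := conv (heatKernel t)

/-! ## Mollifiers and products of distributions -/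

/-- A smooth, compactly supported, nonnegative function of integral one. -/
structure IsMollifier (ω : Test) : Prop where
  compact : HasCompactSupport ω
  nonneg : ∀ x, 0 ≤ ω x
  integral_eq_one : ∫ x, ω x = 1

/-- `ω_ε(x) = ε⁻³ ω(x/ε)`. -/
noncomputable def rescaled (ω : Test) (ε : ℝ) : Test := (ε ^ 3)⁻¹ • dilateTest ε⁻¹ ω

/-- The product of the tempered distributions `f` and `g` is well defined as a tempered
distribution and equals `h`: for every mollifier `ρ`, the products of the smooth functions
`ρ_ε * f` and `ρ_ε * g` converge to `h` in `𝓢'` as `ε → 0+`. -/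
def IsProduct (f g h : Distr) : Prop :=
  ∀ ρ : Test, IsMollifier ρ → ∀ φ : Test,
    Tendsto (fun ε : ℝ => ∫ x, convFun (rescaled ρ ε) f x * convFun (rescaled ρ ε) g x * φ x)
      (𝓝[>] 0) (𝓝 (h φ))

/-! ## The Leray projection -/

/-- The divergence `(∇ · h)ᵢ = ∑ₖ ∂ₖ hₖᵢ` of a matrix of distributions. -/
noncomputable def divMat (h : Fin 3 → Fin 3 → Distr) (i : Fin 3) : Distr :=
  ∑ k, partialD k (h k i)

/-- `w = ℙ f` is the solenoidal part in the Helmholtz decomposition of `f`: `∇ · w = 0` and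
`f - w` is a gradient (on `ℝ³`: is curl free). This determines `w` up to harmonic polynomials. It
is only applied to `w` in a translation-invariant space whose norm has negative scaling degree;
such a space contains no nonzero polynomial, so there is at most one such `w` in it. -/
def IsLeray (f w : Fin 3 → Distr) : Prop :=
  ∑ i, partialD i (w i) = 0 ∧
    ∀ i j, partialD i (f j - w j) = partialD j (f i - w i)

/-! ## Banach spaces of distributions -/

section Spaces

universe u

variable {E : Type u} [NormedAddCommGroup E] [NormedSpace ℝ E]

/-- `𝓢 ⊂ E ⊂ 𝓢'` through the continuous inclusions `j` and `ι`. -/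
structure IsFunctional (ι : E →L[ℝ] Distr) (j : Test →L[ℝ] E) : Prop where
  injective : Function.Injective ι
  inclusion : ∀ φ ψ : Test, ι (j φ) ψ = ∫ x, φ x * ψ x

/-- A functional translation-invariant Banach space. -/
structure IsFunctionalTranslationInvariant (ι : E →L[ℝ] Distr) (j : Test →L[ℝ] E) : Prop where
  functional : IsFunctional ι j
  /-- Either both inclusions have dense range or `E = F*` for a functional Banach space `F` whose
  inclusions both have dense range. -/
  dense_or_dual : (DenseRange j ∧ DenseRange ι) ∨
    ∃ (F : Type u) (_ : NormedAddCommGroup F) (_ : NormedSpace ℝ F) (_ : CompleteSpace F)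
      (ιF : F →L[ℝ] Distr) (jF : Test →L[ℝ] F),
      IsFunctional ιF jF ∧ DenseRange jF ∧ DenseRange ιF ∧
      ∃ e : E ≃ₗᵢ[ℝ] (F →L[ℝ] ℝ), ∀ (f : E) (φ : Test), e f (jF φ) = ι f φ
  translation_invariant : ∀ (f : E) (y : R3), ∃ g : E, ι g = translate y (ι f) ∧ ‖g‖ = ‖f‖

/-- `w = ℙ S(τ) ∇ · h` (the operator `ℙ∇S(τ)·` applied to `h`), with `w ∈ E³`. -/
def IsOseen (ι : E →L[ℝ] Distr) (τ : ℝ) (h : Fin 3 → Fin 3 → Distr) (w : Fin 3 → E) : Prop :=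
  IsLeray (fun i => heat τ (divMat h i)) (fun i => ι (w i))

/-- The space is adequate to the Navier-Stokes problem: it is a functional translation-invariant
Banach space, and for `f, g ∈ E³` the product `f ⊗ g` is well defined as a (matrix of) tempered
distribution(s) and `‖ℙ∇S(τ)·(f ⊗ g)‖ ≤ ω(τ) ‖f‖ ‖g‖` for `0 < τ < T₀`, where `ω > 0` is
integrable on `(0, T₀)`. The norm on `E³` is the maximum of the norms of the components. -/
structure IsAdequate (ι : E →L[ℝ] Distr) (j : Test →L[ℝ] E) : Prop where
  base : IsFunctionalTranslationInvariant ι j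
  estimate : ∃ (T₀ : ℝ) (ω : ℝ → ℝ), 0 < T₀ ∧ (∀ τ ∈ Ioo 0 T₀, 0 < ω τ) ∧
    IntegrableOn ω (Ioo 0 T₀) ∧
    ∀ f g : Fin 3 → E, ∃ h : Fin 3 → Fin 3 → Distr,
      (∀ k i, IsProduct (ι (f k)) (ι (g i)) (h k i)) ∧
      ∀ τ ∈ Ioo 0 T₀, ∃ w : Fin 3 → E, IsOseen ι τ h w ∧ ‖w‖ ≤ ω τ * ‖f‖ * ‖g‖

/-- The norm has scaling degree `k`: `‖f_l‖ = l^k ‖f‖` whenever `f, f_l ∈ E`, `l > 0`. -/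
def HasScalingDegree (ι : E →L[ℝ] Distr) (k : ℝ) : Prop :=
  ∀ (f g : E) (l : ℝ), 0 < l → ι g = dilate l (ι f) → ‖g‖ = l ^ k * ‖f‖

/-- The norm of `E` extended to all of `𝓢'` by the value `∞` outside `E`. -/
noncomputable def extNorm (ι : E →L[ℝ] Distr) (f : Distr) : ℝ≥0∞ :=
  ⨅ (g : E) (_ : ι g = f), ‖g‖ₑ

/-- `‖f‖_{BE^α} = sup_{t>0} t^{α/2} ‖S(t) f‖_E`, for a vector of distributions (maximum over the
components); `f ∈ BE^α` means that this is finite. -/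
noncomputable def beNorm (ι : E →L[ℝ] Distr) (α : ℝ) (f : Fin 3 → Distr) : ℝ≥0∞ :=
  ⨆ (i : Fin 3) (t : ℝ) (_ : 0 < t), ENNReal.ofReal (t ^ (α / 2)) * extNorm ι (heat t (f i))

/-- A function `u : (0,∞) → E³`, completed by the value `u₀` at `t = 0`, belongs to the space
`C_w([0,∞), BE^α) ∩ {sup_{t>0} t^{α/2} ‖u(t)‖_E < ∞}`: it is bounded and norm continuous from
`(0,∞)` to `BE^α`, and converges weakly (in `𝓢'`) to `u₀` as `t → 0+`.
Values of `u` at `t ≤ 0` play no role. -/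
structure MemX (ι : E →L[ℝ] Distr) (α : ℝ) (u₀ : Fin 3 → Distr) (u : ℝ → Fin 3 → E) : Prop where
  be_bounded : (⨆ (t : ℝ) (_ : 0 < t), beNorm ι α (fun i => ι (u t i))) < ∞
  be_continuous : ∀ s : ℝ, 0 < s →
    Tendsto (fun t => beNorm ι α (fun i => ι (u t i) - ι (u s i))) (𝓝 s) (𝓝 0)
  weak_initial : ∀ (i : Fin 3) (φ : Test),
    Tendsto (fun t => ι (u t i) φ) (𝓝[>] 0) (𝓝 (u₀ i φ))
  weighted_bounded : (⨆ (t : ℝ) (_ : 0 < t), ENNReal.ofReal (t ^ (α / 2)) * ‖u t‖ₑ) < ∞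

/-- Mild solutions, for `t > 0`, of
`u(t) = S(t) u₀ - ∫₀ᵗ S(t-τ) ℙ ∇·(a(u) ⊗ u)(τ) dτ + ∫₀ᵗ S(t-τ) ℙ F(τ) dτ`,
where `a` acts componentwise. The integrals are Bochner integrals in `E³` of functions `N`, `G`
with `N(τ) = S(t-τ) ℙ ∇·(a(u) ⊗ u)(τ)`, `G(τ) = S(t-τ) ℙ F(τ)`. -/
def IsMildSolution (ι : E →L[ℝ] Distr) (a : Distr → Distr) (u₀ : Fin 3 → Distr)
    (F : ℝ → Fin 3 → Distr) (u : ℝ → Fin 3 → E) : Prop :=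
  ∀ t : ℝ, 0 < t → ∃ N G : ℝ → Fin 3 → E,
    (∀ τ ∈ Ioo 0 t, ∃ h : Fin 3 → Fin 3 → Distr,
      (∀ k i, IsProduct (a (ι (u τ k))) (ι (u τ i)) (h k i)) ∧ IsOseen ι (t - τ) h (N τ)) ∧
    (∀ τ ∈ Ioo 0 t, IsLeray (fun i => heat (t - τ) (F τ i)) (fun i => ι (G τ i))) ∧
    IntervalIntegrable N volume 0 t ∧ IntervalIntegrable G volume 0 t ∧
    ∀ i, ι (u t i) =
      heat t (u₀ i) - ι ((∫ τ in (0 : ℝ)..t, N τ) i) + ι ((∫ τ in (0 : ℝ)..t, G τ) i)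

/-- Mild solutions of the Navier-Stokes system. -/
def IsNSSolution (ι : E →L[ℝ] Distr) (u₀ : Fin 3 → Distr) (F : ℝ → Fin 3 → Distr)
    (u : ℝ → Fin 3 → E) : Prop :=
  IsMildSolution ι id u₀ F u

/-- Mild solutions of the mollified Navier-Stokes system, with nonlinearity `∇·((ω * v) ⊗ v)`. -/
def IsMollifiedSolution (ι : E →L[ℝ] Distr) (ω : Test) (u₀ : Fin 3 → Distr)
    (F : ℝ → Fin 3 → Distr) (v : ℝ → Fin 3 → E) : Prop :=
  IsMildSolution ι (conv ω) u₀ F v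

/-- `u` is the unique element `w` of the space `MemX` which satisfies `Sol` and
`sup_{t>0} t^{α/2} ‖w(t)‖_E ≤ R` (uniqueness on `(0,∞)`). -/
def IsUniqueSmall (ι : E →L[ℝ] Distr) (α : ℝ) (u₀ : Fin 3 → Distr)
    (Sol : (ℝ → Fin 3 → E) → Prop) (R : ℝ) (u : ℝ → Fin 3 → E) : Prop :=
  (MemX ι α u₀ u ∧ Sol u ∧ ∀ t : ℝ, 0 < t → t ^ (α / 2) * ‖u t‖ ≤ R) ∧
  ∀ w : ℝ → Fin 3 → E, MemX ι α u₀ w → Sol w → (∀ t : ℝ, 0 < t → t ^ (α / 2) * ‖w t‖ ≤ R) →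
    ∀ t : ℝ, 0 < t → w t = u t

end Spaces

end AbstractNS

/-!
The mild formulation turns both systems into a fixed point equation
`z(t) = y(t) - ∫₀ᵗ B(t - τ)(T z(τ), z(τ)) dτ` in `X = E³`, where `B(σ)(f, g) = ℙ S(σ) ∇·(f ⊗ g)`,
`T` is the identity or convolution with the mollifier, and `y` collects the contributions of the
initial value and of the force.

Put `γ = (1 - 3/p)/2`, so that the norm of `E` has scaling degree `2γ - 1`. Translations act
isometrically and, as test functions are dense, strongly continuously on `E`; hence convolution with
an integrable kernel is a Bochner integral (`cv`) bounded by the `L¹` norm of the kernel, and the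
heat semigroup is a contraction semigroup with `‖ΔS(t)‖ ≤ C / t` (`isSmoothing_heat`). Dilations act
on `E` by completeness and density (`exists_dilation`). Since the scaling degree exceeds `-3`, heat
orbits decay to zero (`tendsto_cv_heat_atTop`), so `E` contains no nonzero harmonic distribution and
Leray projections in `E` are unique (`leray_unique`). Uniqueness makes `B(σ)` bilinear, compatible
with the semigroup and with dilations. The estimate of adequacy at one single time then yields
`‖B(σ)(f, g)‖ ≤ c σ^{-(1-γ)} ‖f‖ ‖g‖` for all `σ > 0` by dilation (`exists_bilinearKernel`). The force
term is controlled by `‖ℙ S(σ) ∇·V‖ ≤ c σ^{-1/2} ‖V‖`, where `ℙ = 1 + ∇ (-Δ)⁻¹ ∇·` and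
`(-Δ)⁻¹ S(σ) = ∫_σ^∞ S(s) ds` (`forceOp`). The force is replaced by the divergence of the
self-similar path `t⁻¹ V(1)(· / √t)`, which gives the same force and is continuous in time
(`divMat_selfSimilarPath`).

With these bounds the equation is contractive in the norm `sup t^γ ‖z(t)‖`: the singular integrals
`∫₀ᵗ (t - τ)^{-(1-γ)} τ^{-2γ} dτ` converge because `0 < γ < 1/2`, and they are multiples of `t^{-γ}`.
This gives existence (`exists_mild`) and uniqueness (`mild_unique`). The Duhamel integrals are bounded
and continuous in the Besov-type norm, and tend weakly to zero at the initial time (`memX_of_mild`).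
Self-similarity follows from uniqueness, since the parabolic dilates of `u` solve the same equation
(`mild_self_similar`). For the asymptotics, `u - (ω * u)` is, in self-similar variables, the error of
mollification of `U` at scale `t^{-1/2}`, hence negligible as `t → ∞`
(`tendsto_mollify_self_similar`); by contractivity `u - v` is negligible as well (`mild_asymptotic`).
-/

namespace AbstractNS

open FourierTransform

/-! ### Operations on test functions and distributions -/

/-- Partial derivative `∂ᵢ` of a test function. -/
noncomputable def pd (i : Fin 3) : Test →L[ℝ] Test :=
  LineDeriv.lineDerivOpCLM ℝ 𝓢(R3, ℝ) (EuclideanSpace.single i (1 : ℝ))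

theorem partialD_apply (i : Fin 3) (f : Distr) (φ : Test) : partialD i f φ = -f (pd i φ) := by
  change f ((-(pd i)) φ) = _
  rw [neg_apply, map_neg]

theorem translate_apply (y : R3) (f : Distr) (φ : Test) :
    translate y f φ = f (SchwartzMap.compSubConstCLM ℝ (-y) φ) := rfl

theorem dilate_apply (l : ℝ) (f : Distr) (φ : Test) :
    dilate l f φ = (l ^ 3)⁻¹ * f (dilateTest l⁻¹ φ) := by
  change f (((l ^ 3)⁻¹ • dilateTest l⁻¹) φ) = _
  rw [smul_apply, map_smul, smul_eq_mul]

theorem conv_apply (κ : Test) (f : Distr) (φ : Test) :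
    conv κ f φ = f (convTest (reflectTest κ) φ) := rfl

/-! ### Fourier transform of real test functions -/

/-- The complex-valued Fourier transform of a real-valued test function. -/
noncomputable def fourierTest (φ : Test) : 𝓢(R3, ℂ) :=
  𝓕 (φ.postcompCLM (𝕜 := ℝ) Complex.ofRealCLM)

/-- Identities between convolutions and derivatives of test functions are checked on the Fourier side. -/
theorem test_ext_fourier {φ ψ : Test} (h : ∀ ξ, fourierTest φ ξ = fourierTest ψ ξ) : φ = ψ := by
  have h1 : fourierTest φ = fourierTest ψ := SchwartzMap.ext h
  have h2 : φ.postcompCLM (𝕜 := ℝ) Complex.ofRealCLM = ψ.postcompCLM (𝕜 := ℝ) Complex.ofRealCLM := by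
    have := congrArg (fun f : 𝓢(R3, ℂ) => 𝓕⁻ f) h1
    simpa [fourierTest] using this
  ext x
  have := congrArg (fun f : 𝓢(R3, ℂ) => f x) h2
  simpa using this

theorem fourierTest_convTest (κ φ : Test) (ξ : R3) :
    fourierTest (convTest κ φ) ξ = fourierTest κ ξ * fourierTest φ ξ := by
  have h : (convTest κ φ).postcompCLM (𝕜 := ℝ) Complex.ofRealCLM =
      SchwartzMap.convolution (ContinuousLinearMap.mul ℂ ℂ)
      (κ.postcompCLM (𝕜 := ℝ) Complex.ofRealCLM) (φ.postcompCLM (𝕜 := ℝ) Complex.ofRealCLM) := by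
    ext x
    rw [SchwartzMap.postcompCLM_apply, convTest_apply, SchwartzMap.convolution_apply,
      MeasureTheory.convolution_def]
    simp [← integral_complex_ofReal]
  rw [fourierTest, h, SchwartzMap.fourier_convolution]
  simp [fourierTest]

theorem fourierTest_pd (i : Fin 3) (φ : Test) (ξ : R3) :
    fourierTest (pd i φ) ξ = (2 * Real.pi * Complex.I) * (ξ i * fourierTest φ ξ) := by
  have h : (pd i φ).postcompCLM (𝕜 := ℝ) Complex.ofRealCLM =
      LineDeriv.lineDerivOp (EuclideanSpace.single i (1 : ℝ))
        (φ.postcompCLM (𝕜 := ℝ) Complex.ofRealCLM) := by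
    ext x
    have h1 : HasFDerivAt (fun y => (φ y : ℂ)) (Complex.ofRealCLM ∘L fderiv ℝ φ x) x :=
      Complex.ofRealCLM.hasFDerivAt.comp x (φ.hasFDerivAt x)
    rw [SchwartzMap.postcompCLM_apply, SchwartzMap.lineDerivOp_apply_eq_fderiv]
    have h2 : (fun y => (φ y : ℂ)) = ⇑(φ.postcompCLM (𝕜 := ℝ) Complex.ofRealCLM) := by
      ext y; simp
    rw [← h2, h1.fderiv]
    rfl
  rw [fourierTest, h, SchwartzMap.fourier_lineDerivOp_eq]
  have ht : (fun x : R3 => inner ℝ x (EuclideanSpace.single i (1 : ℝ))).HasTemperateGrowth := by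
    fun_prop
  rw [smul_apply, SchwartzMap.smulLeftCLM_apply_apply ht]
  have hi : inner ℝ ξ (EuclideanSpace.single i (1 : ℝ)) = ξ i := by
    simp [EuclideanSpace.inner_single_right]
  simp [fourierTest, hi]

theorem convTest_comm (κ φ : Test) : convTest κ φ = convTest φ κ :=
  test_ext_fourier fun ξ => by rw [fourierTest_convTest, fourierTest_convTest, mul_comm]

theorem convTest_assoc (κ₁ κ₂ φ : Test) :
    convTest κ₁ (convTest κ₂ φ) = convTest (convTest κ₁ κ₂) φ :=
  test_ext_fourier fun ξ => by simp only [fourierTest_convTest, mul_assoc]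

theorem convTest_left_comm (κ₁ κ₂ φ : Test) :
    convTest κ₁ (convTest κ₂ φ) = convTest κ₂ (convTest κ₁ φ) := by
  rw [convTest_assoc, convTest_comm κ₁ κ₂, convTest_assoc]

theorem pd_convTest_right (i : Fin 3) (κ φ : Test) :
    pd i (convTest κ φ) = convTest κ (pd i φ) :=
  test_ext_fourier fun ξ => by simp only [fourierTest_convTest, fourierTest_pd]; ring

theorem pd_convTest_left (i : Fin 3) (κ φ : Test) :
    pd i (convTest κ φ) = convTest (pd i κ) φ :=
  test_ext_fourier fun ξ => by simp only [fourierTest_convTest, fourierTest_pd]; ring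

theorem pd_comm (i k : Fin 3) (φ : Test) : pd i (pd k φ) = pd k (pd i φ) :=
  test_ext_fourier fun ξ => by simp only [fourierTest_pd]; ring

theorem pd_apply (i : Fin 3) (φ : Test) (x : R3) :
    pd i φ x = fderiv ℝ φ x (EuclideanSpace.single i (1 : ℝ)) := rfl

theorem pd_reflectTest (i : Fin 3) (φ : Test) : pd i (reflectTest φ) = -reflectTest (pd i φ) := by
  ext x
  have h : HasFDerivAt (fun y => φ (-y)) ((fderiv ℝ φ (-x)) ∘L (-ContinuousLinearMap.id ℝ R3)) x :=
    (φ.hasFDerivAt (-x)).comp x ((hasFDerivAt_id x).neg)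
  have h2 : ⇑(reflectTest φ) = fun y => φ (-y) := by ext y; rw [reflectTest_apply]
  rw [pd_apply, h2, h.fderiv]
  simp [reflectTest_apply, pd_apply]

theorem pd_dilateTest (i : Fin 3) {l : ℝ} (hl : 0 < l) (φ : Test) :
    pd i (dilateTest l φ) = l • dilateTest l (pd i φ) := by
  ext x
  have h : HasFDerivAt (fun y => φ (l • y)) ((fderiv ℝ φ (l • x)) ∘L (l • ContinuousLinearMap.id ℝ R3)) x :=
    HasFDerivAt.comp x (φ.hasFDerivAt (l • x)) ((hasFDerivAt_id x).const_smul l)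
  have h2 : ⇑(dilateTest l φ) = fun y => φ (l • y) := by ext y; rw [dilateTest_apply hl]
  rw [pd_apply, h2, h.fderiv]
  simp [dilateTest_apply hl, pd_apply]

theorem dilateTest_convTest {l : ℝ} (hl : 0 < l) (κ φ : Test) :
    dilateTest l (convTest κ φ) = l ^ 3 • convTest (dilateTest l κ) (dilateTest l φ) := by
  ext x
  rw [smul_apply, dilateTest_apply hl, convTest_apply, convTest_apply]
  simp only [dilateTest_apply hl, smul_sub]
  rw [Measure.integral_comp_smul volume (fun y => κ y * φ (l • x - y))]
  simp [abs_of_pos hl, hl.ne']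

theorem dilateTest_one (φ : Test) : dilateTest 1 φ = φ := by
  ext x; simp [dilateTest_apply]

theorem dilateTest_dilateTest {l m : ℝ} (hl : 0 < l) (hm : 0 < m) (φ : Test) :
    dilateTest l (dilateTest m φ) = dilateTest (m * l) φ := by
  ext x; simp [dilateTest_apply, hl, hm, smul_smul]

theorem reflectTest_dilateTest {l : ℝ} (hl : 0 < l) (φ : Test) :
    reflectTest (dilateTest l φ) = dilateTest l (reflectTest φ) := by
  ext x; simp [dilateTest_apply hl, reflectTest_apply]

theorem reflectTest_convTest (κ φ : Test) :
    reflectTest (convTest κ φ) = convTest (reflectTest κ) (reflectTest φ) := by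
  ext x
  simp only [reflectTest_apply, convTest_apply]
  rw [← integral_neg_eq_self]
  simp [sub_eq_add_neg, add_comm]

/-! ### The Gaussian kernel -/

theorem fourierTest_heatKernel {t : ℝ} (ht : 0 < t) (ξ : R3) :
    fourierTest (heatKernel t) ξ = Complex.exp (-(4 * Real.pi ^ 2 * t * ‖ξ‖ ^ 2 : ℝ)) := by
  have h : ⇑((heatKernel t).postcompCLM (𝕜 := ℝ) Complex.ofRealCLM) =
      (((4 * Real.pi * t) ^ (-(3 / 2) : ℝ) : ℝ) : ℂ) •
        fun v : R3 => Complex.exp (-((1 / (4 * t) : ℝ) : ℂ) * ‖v‖ ^ 2) := by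
    ext x
    rw [SchwartzMap.postcompCLM_apply, heatKernel_apply ht]
    simp only [Complex.ofRealCLM_apply, Complex.ofReal_mul, Pi.smul_apply, smul_eq_mul,
      Complex.ofReal_exp]
    congr 2
    push_cast
    ring
  rw [fourierTest, SchwartzMap.fourier_coe, h, Real.fourier_eq]
  simp only [Pi.smul_apply, smul_comm _ (((4 * Real.pi * t) ^ (-(3 / 2) : ℝ) : ℝ) : ℂ)]
  rw [integral_smul, ← Real.fourier_eq,
    fourier_gaussian_innerProductSpace (by rw [Complex.ofReal_re]; positivity)]
  have hb : ((Real.pi : ℂ) / ((1 / (4 * t) : ℝ) : ℂ)) = ((4 * Real.pi * t : ℝ) : ℂ) := by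
    push_cast
    have : (t : ℂ) ≠ 0 := by exact_mod_cast ht.ne'
    field_simp
  have hp : (0 : ℝ) < 4 * Real.pi * t := by positivity
  rw [hb]
  have h3 : ((Module.finrank ℝ R3 : ℂ) / 2) = ((3 / 2 : ℝ) : ℂ) := by simp
  rw [h3, ← Complex.ofReal_cpow hp.le, smul_eq_mul, ← mul_assoc, ← Complex.ofReal_mul,
    ← Real.rpow_add hp]
  norm_num
  congr 1
  have : (t : ℂ) ≠ 0 := by exact_mod_cast ht.ne'
  field_simp

theorem convTest_heatKernel {s t : ℝ} (hs : 0 < s) (ht : 0 < t) :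
    convTest (heatKernel s) (heatKernel t) = heatKernel (s + t) :=
  test_ext_fourier fun ξ => by
    rw [fourierTest_convTest, fourierTest_heatKernel hs, fourierTest_heatKernel ht,
      fourierTest_heatKernel (add_pos hs ht), ← Complex.exp_add]
    congr 1
    push_cast
    ring

theorem reflectTest_heatKernel (t : ℝ) : reflectTest (heatKernel t) = heatKernel t := by
  by_cases ht : 0 < t
  · ext x
    rw [reflectTest_apply, heatKernel_apply ht, heatKernel_apply ht, norm_neg]
  · simp [heatKernel, ht]

theorem dilateTest_heatKernel {l t : ℝ} (hl : 0 < l) (ht : 0 < t) :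
    dilateTest l (heatKernel (l ^ 2 * t)) = (l ^ 3)⁻¹ • heatKernel t := by
  have hlt : 0 < l ^ 2 * t := by positivity
  ext x
  rw [dilateTest_apply hl, smul_apply, heatKernel_apply ht, heatKernel_apply hlt,
    norm_smul, Real.norm_eq_abs, abs_of_pos hl, smul_eq_mul]
  have h1 : (4 * Real.pi * (l ^ 2 * t)) = l ^ 2 * (4 * Real.pi * t) := by ring
  rw [h1, Real.mul_rpow (by positivity) (by positivity), ← Real.rpow_natCast l 2, ← Real.rpow_mul hl.le, mul_assoc]
  congr 1
  · rw [← Real.rpow_natCast, ← Real.rpow_neg hl.le]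
    norm_num
  · congr 1
    have := hl.ne'
    rw [Real.rpow_natCast]
    field_simp

theorem heatKernel_nonneg (t : ℝ) (x : R3) : 0 ≤ heatKernel t x := by
  by_cases ht : 0 < t
  · rw [heatKernel_apply ht]; positivity
  · simp [heatKernel, ht]

theorem integral_heatKernel {t : ℝ} (ht : 0 < t) : ∫ x, heatKernel t x = 1 := by
  have h := fourierTest_heatKernel ht 0
  rw [fourierTest, SchwartzMap.fourier_coe, Real.fourier_eq] at h
  simp at h
  exact_mod_cast (integral_complex_ofReal (f := fun x => heatKernel t x) (μ := volume)).symm.trans h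

theorem heatKernel_eq_rescaled {t : ℝ} (ht : 0 < t) :
    heatKernel t = rescaled (heatKernel 1) (√t) := by
  have h := dilateTest_heatKernel (l := (√t)⁻¹) (t := t) (by positivity) ht
  have h1 : (√t)⁻¹ ^ 2 * t = 1 := by
    rw [inv_pow, Real.sq_sqrt ht.le, inv_mul_cancel₀ ht.ne']
  rw [h1] at h
  rw [rescaled, h, smul_smul, inv_pow, inv_inv, inv_mul_cancel₀ (by positivity), one_smul]

/-! ### The Gaussian kernel solves the heat equation -/

theorem pd_heatKernel_apply (i : Fin 3) {t : ℝ} (ht : 0 < t) (x : R3) :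
    pd i (heatKernel t) x = -(x i / (2 * t)) * heatKernel t x := by
  have h0 : HasFDerivAt (fun x : R3 => ‖x‖ ^ 2) (2 • innerSL ℝ x) x :=
    (hasStrictFDerivAt_norm_sq x).hasFDerivAt
  have h1 : ⇑(heatKernel t) = fun x =>
      (4 * Real.pi * t) ^ (-(3 / 2) : ℝ) * Real.exp (-(1 / (4 * t)) * ‖x‖ ^ 2) := by
    ext x
    rw [heatKernel_apply ht]
    congr 2
    ring
  have h2 := ((h0.const_mul (-(1 / (4 * t)))).exp).const_mul ((4 * Real.pi * t) ^ (-(3 / 2) : ℝ))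
  rw [pd_apply, h1, h2.fderiv]
  have hi : inner ℝ x (EuclideanSpace.single i (1 : ℝ)) = x i := by
    simp [EuclideanSpace.inner_single_right]
  simp [hi]
  field_simp
  ring

theorem pd_pd_heatKernel_apply (i : Fin 3) {t : ℝ} (ht : 0 < t) (x : R3) :
    pd i (pd i (heatKernel t)) x =
      (-(1 / (2 * t)) + x i ^ 2 / (4 * t ^ 2)) * heatKernel t x := by
  have h1 : ⇑(pd i (heatKernel t)) = fun x => -(x i / (2 * t)) * heatKernel t x :=
    funext fun x => pd_heatKernel_apply i ht x
  have h2 : HasFDerivAt (fun x : R3 => -(x i / (2 * t)))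
      (-((2 * t)⁻¹ • (EuclideanSpace.proj i : R3 →L[ℝ] ℝ))) x := by
    have := ((EuclideanSpace.proj i : R3 →L[ℝ] ℝ).hasFDerivAt (x := x)).const_mul ((2 * t)⁻¹)
    refine this.neg.congr_of_eventuallyEq (.of_forall fun y => ?_)
    simp [div_eq_inv_mul]
  have h3 := h2.mul ((heatKernel t).hasFDerivAt x)
  have h4 := pd_heatKernel_apply i ht x
  rw [pd_apply] at h4
  rw [pd_apply, h1]
  erw [h3.fderiv]
  simp [h4]
  field_simp
  ring

/-- The Laplacian of the Gaussian kernel. -/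
noncomputable def lapHeat (t : ℝ) : Test := ∑ i, pd i (pd i (heatKernel t))

theorem lapHeat_apply {t : ℝ} (ht : 0 < t) (x : R3) :
    lapHeat t x = (-(3 / (2 * t)) + ‖x‖ ^ 2 / (4 * t ^ 2)) * heatKernel t x := by
  rw [EuclideanSpace.norm_sq_eq, lapHeat]
  simp only [Fin.sum_univ_three, add_apply, pd_pd_heatKernel_apply _ ht, Real.norm_eq_abs, sq_abs]
  field_simp
  ring

theorem hasDerivAt_heatKernel {t : ℝ} (ht : 0 < t) (x : R3) :
    HasDerivAt (fun s => heatKernel s x) (lapHeat t x) t := by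
  have hp : (0 : ℝ) < 4 * Real.pi * t := by positivity
  have h1 : HasDerivAt (fun s : ℝ => (4 * Real.pi * s) ^ (-(3 / 2) : ℝ))
      (4 * Real.pi * (-(3 / 2)) * (4 * Real.pi * t) ^ (-(3 / 2) - 1 : ℝ)) t := by
    have := ((hasDerivAt_id t).const_mul (4 * Real.pi)).rpow_const (p := (-(3 / 2) : ℝ)) (Or.inl hp.ne')
    simpa using this
  have h2 : HasDerivAt (fun s : ℝ => Real.exp (-‖x‖ ^ 2 / (4 * s)))
      (Real.exp (-‖x‖ ^ 2 / (4 * t)) * (‖x‖ ^ 2 / (4 * t ^ 2))) t := by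
    have h3 : HasDerivAt (fun s : ℝ => -‖x‖ ^ 2 / (4 * s)) (‖x‖ ^ 2 / (4 * t ^ 2)) t := by
      have := (((hasDerivAt_id t).const_mul 4).inv (by simpa using ht.ne')).const_mul (-‖x‖ ^ 2)
      convert! this using 1
      simp
      field_simp
      try norm_num
    exact h3.exp
  have h := h1.mul h2
  rw [lapHeat_apply ht, heatKernel_apply ht]
  refine (h.congr_of_eventuallyEq ?_).congr_deriv ?_
  · filter_upwards [lt_mem_nhds ht] with s hs
    rw [heatKernel_apply hs, Pi.mul_apply]
  · rw [Real.rpow_sub_one hp.ne']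
    field_simp

/-- A bound for `Δ G_s` uniform for `s` near `t`, by an integrable function; it dominates the difference
quotients of `s ↦ G_s`. -/
theorem lapHeat_bound {t : ℝ} (ht : 0 < t) :
    ∃ C, ∀ s ∈ Ioo (t / 2) (3 / 2 * t), ∀ x,
      |lapHeat s x| ≤ C * (heatKernel (3 / 2 * t) x + ‖x‖ ^ 2 * heatKernel (3 / 2 * t) x) := by
  have hT : (0 : ℝ) < 3 / 2 * t := by positivity
  set A := (4 * Real.pi * (t / 2)) ^ (-(3 / 2) : ℝ)
  set B := (4 * Real.pi * (3 / 2 * t)) ^ (-(3 / 2) : ℝ) with hB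
  have hB0 : 0 < B := by positivity
  refine ⟨(3 / t + 1 / t ^ 2) * (A / B), fun s hs x => ?_⟩
  have hs0 : 0 < s := by linarith [hs.1]
  rw [lapHeat_apply hs0, abs_mul, abs_of_nonneg (heatKernel_nonneg s x)]
  have h1 : |(-(3 / (2 * s)) + ‖x‖ ^ 2 / (4 * s ^ 2))| ≤ (3 / t + 1 / t ^ 2) * (1 + ‖x‖ ^ 2) := by
    have e1 : 3 / (2 * s) ≤ 3 / t := by
      gcongr
      linarith [hs.1]
    have e2 : ‖x‖ ^ 2 / (4 * s ^ 2) ≤ ‖x‖ ^ 2 / t ^ 2 := by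
      gcongr
      nlinarith [hs.1]
    have e3 : 0 ≤ 3 / (2 * s) := by positivity
    have e4 : 0 ≤ ‖x‖ ^ 2 / (4 * s ^ 2) := by positivity
    have e5 : (3 / t + 1 / t ^ 2) * (1 + ‖x‖ ^ 2) =
      3 / t + ‖x‖ ^ 2 / t ^ 2 + (3 / t * ‖x‖ ^ 2 + 1 / t ^ 2) := by ring
    have e6 : 0 ≤ (3 / t * ‖x‖ ^ 2 + 1 / t ^ 2) := by positivity
    rw [abs_le]
    constructor <;> linarith
  have h2 : heatKernel s x ≤ A / B * heatKernel (3 / 2 * t) x := by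
    rw [heatKernel_apply hs0, heatKernel_apply hT, ← mul_assoc, div_mul_cancel₀ _ hB0.ne']
    have e1 : (4 * Real.pi * s) ^ (-(3 / 2) : ℝ) ≤ A := by
      apply Real.rpow_le_rpow_of_nonpos (by positivity) _ (by norm_num)
      gcongr
      exact hs.1.le
    have e2 : -‖x‖ ^ 2 / (4 * s) ≤ -‖x‖ ^ 2 / (4 * (3 / 2 * t)) := by
      rw [neg_div, neg_div, neg_le_neg_iff]
      gcongr
      exact hs.2.le
    gcongr
  calc _ ≤ ((3 / t + 1 / t ^ 2) * (1 + ‖x‖ ^ 2)) * (A / B * heatKernel (3 / 2 * t) x) :=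
        mul_le_mul h1 h2 (heatKernel_nonneg _ _) (by positivity)
    _ = _ := by ring

/-! ### Translations, dilations and mollifications in the Schwartz topology -/

theorem tendsto_test_iff {β : Type*} {l : Filter β} {u : β → Test} {φ : Test} :
    Tendsto u l (𝓝 φ) ↔
      ∀ k n : ℕ, Tendsto (fun b => SchwartzMap.seminorm ℝ k n (u b - φ)) l (𝓝 0) := by
  rw [(schwartz_withSeminorms ℝ R3 ℝ).tendsto_nhds]
  constructor
  · intro h k n
    rw [Metric.tendsto_nhds]
    intro ε hε
    filter_upwards [h (k, n) ε hε] with b hb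
    rw [Real.dist_0_eq_abs, abs_of_nonneg (apply_nonneg _ _)]
    exact hb
  · intro h i ε hε
    exact (h i.1 i.2).eventually (gt_mem_nhds hε)

/-- The quantitative continuity of translations in the Schwartz seminorms, with polynomial growth in the
shift `y`, so that it can be integrated against a Gaussian. -/
theorem translate_diff_bound (φ : Test) (k n : ℕ) : ∃ C, 0 ≤ C ∧ ∀ x y : R3,
    ‖x‖ ^ k * ‖iteratedFDeriv ℝ n φ (x - y) - iteratedFDeriv ℝ n φ x‖ ≤
      C * (‖y‖ * (1 + ‖y‖) ^ k) := by
  refine ⟨2 ^ k * (Finset.Iic (k, n + 1)).sup (fun m => SchwartzMap.seminorm ℝ m.1 m.2) φ,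
    by positivity, fun x y => ?_⟩
  set C := 2 ^ k * (Finset.Iic (k, n + 1)).sup (fun m => SchwartzMap.seminorm ℝ m.1 m.2) φ
  have hd : Differentiable ℝ (iteratedFDeriv ℝ n φ) :=
    (φ.smooth (n + 1 : ℕ)).differentiable_iteratedFDeriv (by norm_cast; simp)
  have h1 := Convex.norm_image_sub_le_of_norm_fderiv_le (𝕜 := ℝ)
    (f := ‖x‖ ^ k • iteratedFDeriv ℝ n φ) (s := segment ℝ x (x - y)) (x := x)
    (y := x - y) (C := C * (1 + ‖y‖) ^ k) (fun z _ => (hd z).const_smul _) ?_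
    (convex_segment _ _) (left_mem_segment _ _ _) (right_mem_segment _ _ _)
  · rw [Pi.smul_apply, Pi.smul_apply, ← smul_sub, norm_smul] at h1
    simp only [norm_pow, norm_norm, sub_sub_cancel_left, norm_neg] at h1
    linarith
  · intro z hz
    rw [fderiv_const_smul (hd z), norm_smul, norm_fderiv_iteratedFDeriv, norm_pow, norm_norm]
    have hz2 : ‖x‖ ≤ (1 + ‖z‖) * (1 + ‖y‖) := by
      have : ‖z - x‖ ≤ ‖y‖ := by
        obtain ⟨a, b, ha, hb, hab, rfl⟩ := hz
        have : a • x + b • (x - y) - x = -(b • y) := by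
          rw [← eq_sub_iff_add_eq] at hab
          subst hab
          module
        rw [this, norm_neg, norm_smul, Real.norm_eq_abs, abs_of_nonneg hb]
        exact mul_le_of_le_one_left (norm_nonneg _) (by linarith)
      have h3 := norm_sub_norm_le x z
      rw [norm_sub_rev] at h3
      nlinarith [norm_nonneg z, norm_nonneg y]
    have h2 := SchwartzMap.one_add_le_sup_seminorm_apply (𝕜 := ℝ) (m := (k, n + 1)) (k := k)
      (n := n + 1) le_rfl le_rfl φ z
    calc ‖x‖ ^ k * ‖iteratedFDeriv ℝ (n + 1) φ z‖
        ≤ ((1 + ‖z‖) * (1 + ‖y‖)) ^ k * ‖iteratedFDeriv ℝ (n + 1) φ z‖ := by gcongr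
      _ = ((1 + ‖z‖) ^ k * ‖iteratedFDeriv ℝ (n + 1) φ z‖) * (1 + ‖y‖) ^ k := by
        rw [mul_pow]; ring
      _ ≤ _ := by gcongr

theorem tendsto_compSubConst (φ : Test) :
    Tendsto (fun y : R3 => SchwartzMap.compSubConstCLM ℝ y φ) (𝓝 0) (𝓝 φ) := by
  refine tendsto_test_iff.2 fun k n => ?_
  obtain ⟨C, hC, h⟩ := translate_diff_bound φ k n
  have hlim : Tendsto (fun y : R3 => C * (‖y‖ * (1 + ‖y‖) ^ k)) (𝓝 0) (𝓝 0) := by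
    have : Continuous (fun y : R3 => C * (‖y‖ * (1 + ‖y‖) ^ k)) := by fun_prop
    simpa using this.tendsto 0
  refine squeeze_zero (fun _ => apply_nonneg _ _) (fun y => ?_) hlim
  refine SchwartzMap.seminorm_le_bound ℝ k n _ (by positivity) fun x => ?_
  have e : ⇑(SchwartzMap.compSubConstCLM ℝ y φ - φ) = (fun z => φ (z - y)) - ⇑φ := by
    ext z; simp
  have hs : ContDiff ℝ n φ := φ.smooth n
  have hs' : ContDiff ℝ n (fun z => φ (z - y)) := hs.comp (contDiff_id.sub contDiff_const)
  rw [e, iteratedFDeriv_sub_apply hs'.contDiffAt hs.contDiffAt, iteratedFDeriv_comp_sub]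
  exact h x y

theorem tendsto_dilateTest (φ : Test) :
    Tendsto (fun l : ℝ => dilateTest l φ) (𝓝 1) (𝓝 φ) := by
  refine tendsto_test_iff.2 fun k n => ?_
  set A := SchwartzMap.seminorm ℝ k n φ
  set B := SchwartzMap.seminorm ℝ (k + 1) (n + 1) φ
  have hA : 0 ≤ A := apply_nonneg _ _
  have hB : 0 ≤ B := apply_nonneg _ _
  have hlim : Tendsto (fun l : ℝ => |l ^ n - 1| * (2 ^ k * A) + 2 ^ (k + 1) * B * |l - 1|)
      (𝓝 1) (𝓝 0) := by
    have : Continuous (fun l : ℝ => |l ^ n - 1| * (2 ^ k * A) + 2 ^ (k + 1) * B * |l - 1|) := by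
      fun_prop
    simpa using this.tendsto 1
  refine squeeze_zero' (.of_forall fun _ => apply_nonneg _ _) ?_ hlim
  filter_upwards [lt_mem_nhds (show (1 / 2 : ℝ) < 1 by norm_num)] with l hl
  have hl0 : 0 < l := by linarith
  refine SchwartzMap.seminorm_le_bound ℝ k n _ (by positivity) fun x => ?_
  have e : ⇑(dilateTest l φ - φ) = (fun z => φ (l • z)) - ⇑φ := by
    ext z; simp [dilateTest_apply hl0]
  have hs : ContDiff ℝ n φ := φ.smooth n
  have hs' : ContDiff ℝ n (fun z => φ (l • z)) := hs.comp (contDiff_const_smul l)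
  rw [e, iteratedFDeriv_sub_apply hs'.contDiffAt hs.contDiffAt, iteratedFDeriv_comp_const_smul l hs]
  have hd : Differentiable ℝ (iteratedFDeriv ℝ n φ) :=
    (φ.smooth (n + 1 : ℕ)).differentiable_iteratedFDeriv (by norm_cast; simp)
  have h1 := Convex.norm_image_sub_le_of_norm_fderiv_le (𝕜 := ℝ)
    (f := ‖x‖ ^ (k + 1) • iteratedFDeriv ℝ n φ) (s := segment ℝ x (l • x)) (x := x)
    (y := l • x) (C := 2 ^ (k + 1) * B) (fun z _ => (hd z).const_smul _) ?_
    (convex_segment _ _) (left_mem_segment _ _ _) (right_mem_segment _ _ _)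
  · have hx2 : ‖x‖ ≤ 2 * ‖l • x‖ := by
      rw [norm_smul, Real.norm_eq_abs, abs_of_pos hl0]
      nlinarith [norm_nonneg x]
    have h2 : ‖x‖ ^ k * ‖iteratedFDeriv ℝ n φ (l • x)‖ ≤ 2 ^ k * A := by
      calc _ ≤ (2 * ‖l • x‖) ^ k * ‖iteratedFDeriv ℝ n φ (l • x)‖ := by gcongr
        _ = 2 ^ k * (‖l • x‖ ^ k * ‖iteratedFDeriv ℝ n φ (l • x)‖) := by rw [mul_pow]; ring
        _ ≤ _ := by gcongr; exact SchwartzMap.le_seminorm ℝ k n φ _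
    have h3 : ‖x‖ ^ k * ‖iteratedFDeriv ℝ n φ (l • x) - iteratedFDeriv ℝ n φ x‖ ≤
        2 ^ (k + 1) * B * |l - 1| := by
      rw [Pi.smul_apply, Pi.smul_apply, ← smul_sub, norm_smul, norm_pow, norm_norm] at h1
      have e2 : l • x - x = (l - 1) • x := by module
      rw [e2, norm_smul, Real.norm_eq_abs] at h1
      rcases eq_or_ne x 0 with rfl | hx
      · simp; positivity
      · have : 0 < ‖x‖ := norm_pos_iff.2 hx
        refine le_of_mul_le_mul_left ?_ this
        calc _ = ‖x‖ ^ (k + 1) * ‖iteratedFDeriv ℝ n φ (l • x) - iteratedFDeriv ℝ n φ x‖ := by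
              ring
          _ ≤ _ := h1
          _ = _ := by ring
    have e3 : l ^ n • iteratedFDeriv ℝ n φ (l • x) - iteratedFDeriv ℝ n φ x =
      (l ^ n - 1) • iteratedFDeriv ℝ n φ (l • x) +
        (iteratedFDeriv ℝ n φ (l • x) - iteratedFDeriv ℝ n φ x) := by module
    rw [e3]
    calc _ ≤ ‖x‖ ^ k * (|l ^ n - 1| * ‖iteratedFDeriv ℝ n φ (l • x)‖ +
          ‖iteratedFDeriv ℝ n φ (l • x) - iteratedFDeriv ℝ n φ x‖) := by
          gcongr
          exact (norm_add_le _ _).trans (by rw [norm_smul, Real.norm_eq_abs])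
      _ = |l ^ n - 1| * (‖x‖ ^ k * ‖iteratedFDeriv ℝ n φ (l • x)‖) +
          ‖x‖ ^ k * ‖iteratedFDeriv ℝ n φ (l • x) - iteratedFDeriv ℝ n φ x‖ := by ring
      _ ≤ _ := by gcongr
  · intro z hz
    rw [fderiv_const_smul (hd z), norm_smul, norm_fderiv_iteratedFDeriv, norm_pow, norm_norm]
    have hz2 : ‖x‖ ≤ 2 * ‖z‖ := by
      obtain ⟨a, b, ha, hb, hab, rfl⟩ := hz
      have : a • x + b • l • x = (a + b * l) • x := by module
      rw [this, norm_smul, Real.norm_eq_abs, abs_of_nonneg (by positivity)]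
      have : 1 / 2 ≤ a + b * l := by nlinarith
      nlinarith [norm_nonneg x]
    calc ‖x‖ ^ (k + 1) * ‖iteratedFDeriv ℝ (n + 1) φ z‖
        ≤ (2 * ‖z‖) ^ (k + 1) * ‖iteratedFDeriv ℝ (n + 1) φ z‖ := by gcongr
      _ = 2 ^ (k + 1) * (‖z‖ ^ (k + 1) * ‖iteratedFDeriv ℝ (n + 1) φ z‖) := by rw [mul_pow]; ring
      _ ≤ _ := by gcongr; exact SchwartzMap.le_seminorm ℝ (k + 1) (n + 1) φ z

theorem lineDeriv_convTest (v : R3) (κ φ : Test) :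
    LineDeriv.lineDerivOp v (convTest κ φ) = convTest κ (LineDeriv.lineDerivOp v φ) := by
  have h (ψ : Test) : LineDeriv.lineDerivOp v ψ = ∑ i, v i • pd i ψ := by
    have hv : v = ∑ i, v i • EuclideanSpace.single i (1 : ℝ) := by
      ext k
      simp [Pi.single_apply]
    conv_lhs => rw [hv]
    rw [LineDeriv.lineDerivOp_left_sum]
    exact Finset.sum_congr rfl fun i _ => LineDeriv.lineDerivOp_left_smul _ _ _
  rw [h, h, map_sum]
  exact Finset.sum_congr rfl fun i _ => by rw [pd_convTest_right, map_smul]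

theorem iteratedLineDeriv_convTest {n : ℕ} (m : Fin n → R3) (κ φ : Test) :
    LineDeriv.iteratedLineDerivOp m (convTest κ φ) =
      convTest κ (LineDeriv.iteratedLineDerivOp m φ) := by
  induction n with
  | zero => rfl
  | succ n ih =>
    rw [LineDeriv.iteratedLineDerivOp_succ_left, LineDeriv.iteratedLineDerivOp_succ_left, ih,
      lineDeriv_convTest]

theorem integrable_norm_mul (κ : Test) (k : ℕ) :
    Integrable (fun y : R3 => κ y * (‖y‖ * (1 + ‖y‖) ^ k)) := by
  have e : (fun y : R3 => κ y * (‖y‖ * (1 + ‖y‖) ^ k)) =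
      fun y => ∑ i ∈ Finset.range (k + 1), (k.choose i : ℝ) * (‖y‖ ^ (i + 1) * κ y) := by
    ext y
    rw [add_comm 1 ‖y‖, add_pow, Finset.mul_sum, Finset.mul_sum]
    refine Finset.sum_congr rfl fun i _ => ?_
    ring
  rw [e]
  refine integrable_finsetSum _ fun i _ => Integrable.const_mul ?_ _
  refine (κ.integrable_pow_mul volume (i + 1)).mono (by fun_prop) (.of_forall fun y => ?_)
  simp

/-- The heat semigroup tends to the identity on test functions as `t → 0+`. -/
theorem tendsto_convTest_heatKernel (φ : Test) :
    Tendsto (fun t => convTest (heatKernel t) φ) (𝓝[>] 0) (𝓝 φ) := by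
  refine tendsto_test_iff.2 fun k n => ?_
  obtain ⟨C, hC, h⟩ := translate_diff_bound φ k n
  set I := ∫ y, heatKernel 1 y * (‖y‖ * (1 + ‖y‖) ^ k)
  have hI : 0 ≤ I := integral_nonneg fun y => mul_nonneg (heatKernel_nonneg _ _) (by positivity)
  have hlim : Tendsto (fun t : ℝ => C * (√t * I)) (𝓝[>] 0) (𝓝 0) := by
    have : Continuous (fun t : ℝ => C * (√t * I)) := by fun_prop
    simpa using (this.tendsto 0).mono_left nhdsWithin_le_nhds
  refine squeeze_zero' (.of_forall fun _ => apply_nonneg _ _) ?_ hlim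
  filter_upwards [Ioo_mem_nhdsGT (show (0 : ℝ) < 1 by norm_num)] with t ht
  have ht0 : 0 < t := ht.1
  -- The moments of `G_t` are those of `G_1` at scale `√t ≤ 1`.
  have hJ : ∫ y, heatKernel t y * (‖y‖ * (1 + ‖y‖) ^ k) ≤ √t * I := by
    have hs : 0 < √t := Real.sqrt_pos.2 ht0
    have hs1 : √t ≤ 1 := Real.sqrt_le_one.2 ht.2.le
    have e : (fun y => heatKernel t y * (‖y‖ * (1 + ‖y‖) ^ k)) = fun y =>
        (√t ^ 3)⁻¹ * (fun z => heatKernel 1 z * (‖√t • z‖ * (1 + ‖√t • z‖) ^ k)) ((√t)⁻¹ • y) := by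
      ext y
      rw [heatKernel_eq_rescaled ht0, rescaled, smul_apply, dilateTest_apply (by positivity)]
      simp only [smul_smul, mul_inv_cancel₀ hs.ne', one_smul, smul_eq_mul]
      ring
    rw [e, integral_const_mul, Measure.integral_comp_smul volume
      (fun z : R3 => heatKernel 1 z * (‖√t • z‖ * (1 + ‖√t • z‖) ^ k))]
    simp only [finrank_euclideanSpace, Fintype.card_fin, inv_pow, inv_inv, smul_eq_mul,
      abs_of_pos (pow_pos hs 3)]
    rw [← mul_assoc, inv_mul_cancel₀ (by positivity), one_mul, ← integral_const_mul]
    refine integral_mono_of_nonneg (.of_forall fun y => ?_)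
      ((integrable_norm_mul _ k).const_mul _) (.of_forall fun y => ?_)
    · exact mul_nonneg (heatKernel_nonneg _ _) (by positivity)
    · have h1 : ‖√t • y‖ = √t * ‖y‖ := by
        rw [norm_smul, Real.norm_eq_abs, abs_of_pos hs]
      have h2 : √t * ‖y‖ ≤ ‖y‖ := mul_le_of_le_one_left (norm_nonneg _) hs1
      have h3 := heatKernel_nonneg 1 y
      simp only [h1]
      calc heatKernel 1 y * (√t * ‖y‖ * (1 + √t * ‖y‖) ^ k)
          ≤ heatKernel 1 y * (√t * ‖y‖ * (1 + ‖y‖) ^ k) := by gcongr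
        _ = _ := by ring
  refine SchwartzMap.seminorm_le_bound ℝ k n _ (by positivity) fun x => ?_
  suffices hm : ‖‖x‖ ^ k • iteratedFDeriv ℝ n (convTest (heatKernel t) φ - φ) x‖ ≤ C * (√t * I) by
    simpa [norm_smul] using hm
  refine ContinuousMultilinearMap.opNorm_le_bound (by positivity) fun m => ?_
  have e1 : iteratedFDeriv ℝ n (convTest (heatKernel t) φ - φ) x m =
      ∫ y, heatKernel t y *
        ((iteratedFDeriv ℝ n φ (x - y) - iteratedFDeriv ℝ n φ x) m) := by
    rw [← SchwartzMap.iteratedLineDerivOp_eq_iteratedFDeriv, sub_eq_add_neg,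
      LineDeriv.iteratedLineDerivOp_add, LineDeriv.iteratedLineDerivOp_neg,
      iteratedLineDeriv_convTest, ← sub_eq_add_neg, sub_apply, convTest_apply]
    have hsub (y : R3) : (iteratedFDeriv ℝ n φ (x - y) - iteratedFDeriv ℝ n φ x) m =
        LineDeriv.iteratedLineDerivOp m φ (x - y) - LineDeriv.iteratedLineDerivOp m φ x := by
      rw [SchwartzMap.iteratedLineDerivOp_eq_iteratedFDeriv,
        SchwartzMap.iteratedLineDerivOp_eq_iteratedFDeriv]
      rfl
    simp only [hsub, mul_sub]
    rw [integral_sub, integral_mul_const, integral_heatKernel ht0, one_mul]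
    · have := (heatKernel t).integrable (μ := volume)
      refine (this.mul_bdd (c := SchwartzMap.seminorm ℝ 0 0 (LineDeriv.iteratedLineDerivOp m φ))
        (by fun_prop) (.of_forall fun y => SchwartzMap.norm_le_seminorm ℝ _ _))
    · exact (heatKernel t).integrable.mul_const _
  rw [smul_apply, e1, smul_eq_mul, ← integral_const_mul]
  calc _ ≤ ∫ y, (C * ∏ i, ‖m i‖) * (heatKernel t y * (‖y‖ * (1 + ‖y‖) ^ k)) := by
        refine norm_integral_le_of_norm_le ((integrable_norm_mul _ k).const_mul _)
          (.of_forall fun y => ?_)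
        have h3 := heatKernel_nonneg t y
        have h4 := (iteratedFDeriv ℝ n φ (x - y) - iteratedFDeriv ℝ n φ x).le_opNorm m
        rw [norm_mul, norm_mul, norm_pow, norm_norm, Real.norm_of_nonneg h3]
        calc _ ≤ ‖x‖ ^ k * (heatKernel t y *
              (‖iteratedFDeriv ℝ n φ (x - y) - iteratedFDeriv ℝ n φ x‖ * ∏ i, ‖m i‖)) := by gcongr
          _ = (‖x‖ ^ k * ‖iteratedFDeriv ℝ n φ (x - y) - iteratedFDeriv ℝ n φ x‖) *
              (heatKernel t y * ∏ i, ‖m i‖) := by ring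
          _ ≤ (C * (‖y‖ * (1 + ‖y‖) ^ k)) * (heatKernel t y * ∏ i, ‖m i‖) :=
              mul_le_mul_of_nonneg_right (h x y) (by positivity)
          _ = _ := by ring
    _ = (C * ∏ i, ‖m i‖) * ∫ y, (heatKernel t y * (‖y‖ * (1 + ‖y‖) ^ k)) := integral_const_mul _ _
    _ ≤ (C * ∏ i, ‖m i‖) * (√t * I) := by gcongr
    _ = _ := by ring

/-! ### Singular integrals on an interval -/

section Singular

variable {X : Type*} [NormedAddCommGroup X]

theorem intervalIntegrable_of_norm_le {f : ℝ → X} {g : ℝ → ℝ} {r t : ℝ} (ht : r ≤ t)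
    (hf : AEStronglyMeasurable f (volume.restrict (Ioo r t)))
    (h : ∀ τ ∈ Ioo r t, ‖f τ‖ ≤ g τ) (hg : IntervalIntegrable g volume r t) :
    IntervalIntegrable f volume r t := by
  rw [intervalIntegrable_iff_integrableOn_Ioo_of_le ht] at hg ⊢
  exact Integrable.mono' hg hf ((ae_restrict_iff' measurableSet_Ioo).2 (.of_forall h))

theorem intervalIntegrable_congr_Ioo {f g : ℝ → X} {r t : ℝ} (ht : r ≤ t)
    (h : ∀ τ ∈ Ioo r t, f τ = g τ) :
    IntervalIntegrable f volume r t ↔ IntervalIntegrable g volume r t := by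
  rw [intervalIntegrable_iff_integrableOn_Ioo_of_le ht,
    intervalIntegrable_iff_integrableOn_Ioo_of_le ht]
  exact integrableOn_congr_fun h measurableSet_Ioo

variable [NormedSpace ℝ X]

theorem norm_integral_le_of_Ioo {f : ℝ → X} {g : ℝ → ℝ} {r t : ℝ} (ht : r ≤ t)
    (h : ∀ τ ∈ Ioo r t, ‖f τ‖ ≤ g τ) (hg : IntervalIntegrable g volume r t) :
    ‖∫ τ in r..t, f τ‖ ≤ ∫ τ in r..t, g τ := by
  refine intervalIntegral.norm_integral_le_of_norm_le ht ?_ hg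
  have : ∀ᵐ τ : ℝ, τ ≠ t := by simp [ae_iff]
  filter_upwards [this] with τ hτ hτ2
  exact h τ ⟨hτ2.1, lt_of_le_of_ne hτ2.2 hτ⟩

theorem integral_congr_Ioo {f g : ℝ → X} {r t : ℝ} (ht : r ≤ t)
    (h : ∀ τ ∈ Ioo r t, f τ = g τ) : ∫ τ in r..t, f τ = ∫ τ in r..t, g τ := by
  rw [intervalIntegral.integral_of_le ht, intervalIntegral.integral_of_le ht,
    integral_Ioc_eq_integral_Ioo, integral_Ioc_eq_integral_Ioo]
  exact setIntegral_congr_fun measurableSet_Ioo h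

theorem intervalIntegrable_sub_rpow {b : ℝ} (hb : b < 1) (r t : ℝ) :
    IntervalIntegrable (fun τ => (t - τ) ^ (-b)) volume r t := by
  have := (intervalIntegral.intervalIntegrable_rpow' (r := -b) (by linarith)
    (a := t - r) (b := 0)).comp_sub_left t
  simpa using this

theorem integral_sub_rpow {b : ℝ} (hb : b < 1) (r t : ℝ) :
    ∫ τ in r..t, (t - τ) ^ (-b) = (t - r) ^ (1 - b) / (1 - b) := by
  rw [intervalIntegral.integral_comp_sub_left (fun τ => τ ^ (-b)) t, sub_self,
    integral_rpow (Or.inl (by linarith)), Real.zero_rpow (by linarith)]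
  ring_nf

theorem integral_rpow_zero {b : ℝ} (hb : b < 1) (t : ℝ) :
    ∫ τ in (0 : ℝ)..t, τ ^ (-b) = t ^ (1 - b) / (1 - b) := by
  rw [integral_rpow (Or.inl (by linarith)), Real.zero_rpow (by linarith)]
  ring_nf

/-- A constant bounding the Beta function `B(1 - b, 1 - β)`. -/
noncomputable def betaBound (b β : ℝ) : ℝ := 2 ^ b / (1 - β) + 2 ^ β / (1 - b)

theorem betaBound_pos {b β : ℝ} (hb : b < 1) (hβ : β < 1) : 0 < betaBound b β := by
  have h1 : 0 < 1 - β := by linarith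
  have h2 : 0 < 1 - b := by linarith
  unfold betaBound
  positivity

/-- Pointwise, `(t-τ)^{-b} τ^{-β}` is dominated by a sum of two functions with one singularity each,
according to whether `τ` is in the first or the second half of the interval. -/
theorem singular_le {b β t τ : ℝ} (hb0 : 0 ≤ b) (hβ0 : 0 ≤ β) (hτ : τ ∈ Ioo 0 t) :
    (t - τ) ^ (-b) * τ ^ (-β) ≤ (t / 2) ^ (-b) * τ ^ (-β) + (t / 2) ^ (-β) * (t - τ) ^ (-b) := by
  obtain ⟨h0, h1⟩ := hτ
  have h2 : 0 < t - τ := by linarith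
  have h3 : 0 < t / 2 := by linarith
  rcases le_total τ (t / 2) with h | h
  · have : (t - τ) ^ (-b) ≤ (t / 2) ^ (-b) :=
      Real.rpow_le_rpow_of_nonpos h3 (by linarith) (by linarith)
    have := mul_le_mul_of_nonneg_right this (Real.rpow_nonneg h0.le (-β))
    have : 0 ≤ (t / 2) ^ (-β) * (t - τ) ^ (-b) := by positivity
    linarith
  · have : τ ^ (-β) ≤ (t / 2) ^ (-β) :=
      Real.rpow_le_rpow_of_nonpos h3 h (by linarith)
    have := mul_le_mul_of_nonneg_left this (Real.rpow_nonneg h2.le (-b))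
    have : 0 ≤ (t / 2) ^ (-b) * τ ^ (-β) := by positivity
    linarith

theorem intervalIntegrable_singular {b β : ℝ} (hb0 : 0 ≤ b) (hb : b < 1) (hβ0 : 0 ≤ β)
    (hβ : β < 1) {t : ℝ} (ht : 0 < t) :
    IntervalIntegrable (fun τ => (t - τ) ^ (-b) * τ ^ (-β)) volume 0 t := by
  refine intervalIntegrable_of_norm_le ht.le ?_ (fun τ hτ => ?_)
    (((intervalIntegral.intervalIntegrable_rpow' (r := -β) (by linarith)).const_mul
      ((t / 2) ^ (-b))).add ((intervalIntegrable_sub_rpow hb 0 t).const_mul ((t / 2) ^ (-β))))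
  · exact Measurable.aestronglyMeasurable (by fun_prop)
  · rw [Real.norm_of_nonneg]
    · exact singular_le hb0 hβ0 hτ
    · have := hτ.1
      have : 0 < t - τ := by linarith [hτ.2]
      positivity

theorem integral_singular_le {b β : ℝ} (hb0 : 0 ≤ b) (hb : b < 1) (hβ0 : 0 ≤ β)
    (hβ : β < 1) {t : ℝ} (ht : 0 < t) :
    ∫ τ in (0 : ℝ)..t, (t - τ) ^ (-b) * τ ^ (-β) ≤ betaBound b β * t ^ (1 - b - β) := by
  have h1 := ((intervalIntegral.intervalIntegrable_rpow' (r := -β) (by linarith) (a := 0)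
      (b := t)).const_mul ((t / 2) ^ (-b)))
  have h2 := ((intervalIntegrable_sub_rpow hb 0 t).const_mul ((t / 2) ^ (-β)))
  calc _ ≤ ∫ τ in (0 : ℝ)..t,
        ((t / 2) ^ (-b) * τ ^ (-β) + (t / 2) ^ (-β) * (t - τ) ^ (-b)) := by
        refine intervalIntegral.integral_mono_on_of_le_Ioo ht.le
          (intervalIntegrable_singular hb0 hb hβ0 hβ ht) (h1.add h2) fun τ hτ =>
          singular_le hb0 hβ0 hτ
    _ = (t / 2) ^ (-b) * (t ^ (1 - β) / (1 - β)) + (t / 2) ^ (-β) * (t ^ (1 - b) / (1 - b)) := by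
        rw [intervalIntegral.integral_add h1 h2, intervalIntegral.integral_const_mul,
          intervalIntegral.integral_const_mul, integral_sub_rpow hb, integral_rpow_zero hβ,
          sub_zero]
    _ = _ := by
        have e (c : ℝ) : (t / 2) ^ (-c) = 2 ^ c * t ^ (-c) := by
          rw [Real.div_rpow ht.le (by norm_num), Real.rpow_neg (by norm_num : (0 : ℝ) ≤ 2)]
          field_simp
        have e1 : t ^ (-b) * t ^ (1 - β) = t ^ (1 - b - β) := by
          rw [← Real.rpow_add ht]; ring_nf
        have e2 : t ^ (-β) * t ^ (1 - b) = t ^ (1 - b - β) := by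
          rw [← Real.rpow_add ht]; ring_nf
        rw [e, e, betaBound]
        calc _ = 2 ^ b / (1 - β) * (t ^ (-b) * t ^ (1 - β)) +
              2 ^ β / (1 - b) * (t ^ (-β) * t ^ (1 - b)) := by ring
          _ = _ := by rw [e1, e2]; ring

end Singular

/-! ### Duhamel integrals -/

section Duhamel

variable {X : Type*} [NormedAddCommGroup X] [NormedSpace ℝ X]

/-- A semigroup of contractions, for positive times, with the smoothing estimate of analytic
semigroups, `‖(S(t) - S(s)) f‖ ≤ L (t - s) / s ‖f‖`. Continuity at `t = 0` is not required. The
normalization `2 ≤ L` makes the estimate interpolate with the trivial bound `2 ‖f‖`. -/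
structure IsSmoothing (S : ℝ → X →L[ℝ] X) (L : ℝ) : Prop where
  two_le : 2 ≤ L
  contr : ∀ t, 0 < t → ∀ f, ‖S t f‖ ≤ ‖f‖
  semigroup : ∀ s t, 0 < s → 0 < t → ∀ f, S s (S t f) = S (s + t) f
  lip : ∀ s t, 0 < s → s ≤ t → ∀ f, ‖S t f - S s f‖ ≤ L * ((t - s) / s) * ‖f‖

/-- A family `σ ↦ k(τ, σ)` of orbits of the semigroup `S`, where `k(τ, σ)` may be singular like
`σ^{-a}` as `σ → 0` and like `τ^{-β}` as `τ → 0`. The integrands of all Duhamel terms have the form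
`k(τ, t - τ)`. -/
structure IsFlow (S : ℝ → X →L[ℝ] X) (a β A : ℝ) (k : ℝ → ℝ → X) : Prop where
  semigroup : ∀ τ σ δ, 0 < τ → 0 < σ → 0 < δ → S δ (k τ σ) = k τ (σ + δ)
  bound : ∀ τ σ, 0 < τ → 0 < σ → ‖k τ σ‖ ≤ A * (σ ^ (-a) * τ ^ (-β))
  meas : ∀ t, 0 < t → AEStronglyMeasurable (fun τ => k τ (t - τ)) (volume.restrict (Ioo 0 t))

/-- The Duhamel integral `∫₀ᵗ k(τ, t - τ) dτ`. -/
noncomputable def duhamel (k : ℝ → ℝ → X) (t : ℝ) : X := ∫ τ in (0 : ℝ)..t, k τ (t - τ)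

/-- Interpolation between the Lipschitz estimate and the contraction property. -/
theorem IsSmoothing.holder {S : ℝ → X →L[ℝ] X} {L : ℝ} (hS : IsSmoothing S L) {θ : ℝ}
    (h0 : 0 < θ) (h1 : θ < 1) {σ δ : ℝ} (hσ : 0 < σ) (hδ : 0 < δ) (f : X) :
    ‖S (σ + δ) f - S σ f‖ ≤ L * (δ / σ) ^ θ * ‖f‖ := by
  have hL := hS.two_le
  rcases le_total (δ / σ) 1 with h | h
  · refine (hS.lip σ (σ + δ) hσ (by linarith) f).trans ?_
    rw [add_sub_cancel_left]
    have := Real.rpow_le_rpow_of_exponent_ge (by positivity) h h1.le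
    rw [Real.rpow_one] at this
    gcongr
  · have : 1 ≤ (δ / σ) ^ θ := Real.one_le_rpow h h0.le
    calc _ ≤ ‖S (σ + δ) f‖ + ‖S σ f‖ := norm_sub_le _ _
      _ ≤ ‖f‖ + ‖f‖ := add_le_add (hS.contr _ (by positivity) f) (hS.contr _ hσ f)
      _ = 2 * 1 * ‖f‖ := by ring
      _ ≤ _ := by gcongr

variable {S : ℝ → X →L[ℝ] X} {L a β A : ℝ} {k : ℝ → ℝ → X}

theorem IsFlow.nonneg (hk : IsFlow S a β A k) : 0 ≤ A := by
  have := (norm_nonneg _).trans (hk.bound 1 1 one_pos one_pos)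
  simpa using this

theorem IsFlow.intervalIntegrable (hk : IsFlow S a β A k) (ha0 : 0 ≤ a) (ha : a < 1) (hβ0 : 0 ≤ β)
    (hβ : β < 1) {t : ℝ} (ht : 0 < t) :
    IntervalIntegrable (fun τ => k τ (t - τ)) volume 0 t :=
  intervalIntegrable_of_norm_le ht.le (hk.meas t ht)
    (fun τ hτ => hk.bound τ (t - τ) hτ.1 (by linarith [hτ.2]))
    ((intervalIntegrable_singular ha0 ha hβ0 hβ ht).const_mul A)

theorem IsFlow.norm_duhamel_le (hk : IsFlow S a β A k) (ha0 : 0 ≤ a) (ha : a < 1) (hβ0 : 0 ≤ β)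
    (hβ : β < 1) {t : ℝ} (ht : 0 < t) :
    ‖duhamel k t‖ ≤ A * betaBound a β * t ^ (1 - a - β) := by
  refine (norm_integral_le_of_Ioo ht.le (fun τ hτ => hk.bound τ (t - τ) hτ.1 (by linarith [hτ.2]))
    ((intervalIntegrable_singular ha0 ha hβ0 hβ ht).const_mul A)).trans ?_
  rw [intervalIntegral.integral_const_mul, mul_assoc]
  exact mul_le_mul_of_nonneg_left (integral_singular_le ha0 ha hβ0 hβ ht) hk.nonneg

variable [CompleteSpace X]

/-- The bound for the orbit of a Duhamel integral, in the weighted norm `s^γ ‖S(s) ·‖`. -/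
theorem IsFlow.norm_semigroup_duhamel_le (hk : IsFlow S a β A k) {γ : ℝ} (hγ : 0 ≤ γ)
    (haγ : γ ≤ a) (ha : a < 1) (hβ0 : 0 ≤ β) (hβ : β < 1) (hab : a + β = 1 + γ)
    {s t : ℝ} (hs : 0 < s) (ht : 0 < t) :
    s ^ γ * ‖S s (duhamel k t)‖ ≤ A * betaBound (a - γ) β := by
  have ha0 := hγ.trans haγ
  have h1 : s ^ γ • S s (duhamel k t) = ∫ τ in (0 : ℝ)..t, s ^ γ • S s (k τ (t - τ)) := by
    rw [duhamel, intervalIntegral.integral_smul,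
      ContinuousLinearMap.intervalIntegral_comp_comm _ (hk.intervalIntegrable ha0 ha hβ0 hβ ht)]
  have h2 : ‖s ^ γ • S s (duhamel k t)‖ = s ^ γ * ‖S s (duhamel k t)‖ := by
    rw [norm_smul, Real.norm_of_nonneg (by positivity)]
  rw [← h2, h1]
  refine (norm_integral_le_of_Ioo ht.le (fun τ hτ => ?_)
    ((intervalIntegrable_singular (b := a - γ) (by linarith) (by linarith) hβ0 hβ ht).const_mul
      A)).trans ?_
  · have h3 : 0 < t - τ := by linarith [hτ.2]
    rw [norm_smul, Real.norm_of_nonneg (by positivity), hk.semigroup τ _ s hτ.1 h3 hs]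
    have h4 := hk.bound τ (t - τ + s) hτ.1 (by linarith)
    have hA := hk.nonneg
    have hτ0 := hτ.1
    -- The weight `s^γ` lowers the order of the singularity at `τ = t` by `γ`.
    have h5 : s ^ γ * (t - τ + s) ^ (-a) ≤ (t - τ) ^ (-(a - γ)) := by
      calc s ^ γ * (t - τ + s) ^ (-a) ≤ (t - τ + s) ^ γ * (t - τ + s) ^ (-a) := by
            gcongr
            linarith
        _ = (t - τ + s) ^ (-(a - γ)) := by
            rw [← Real.rpow_add (by linarith)]; ring_nf
        _ ≤ _ := Real.rpow_le_rpow_of_nonpos h3 (by linarith) (by linarith)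
    calc _ ≤ s ^ γ * (A * ((t - τ + s) ^ (-a) * τ ^ (-β))) := by gcongr
      _ = A * ((s ^ γ * (t - τ + s) ^ (-a)) * τ ^ (-β)) := by ring
      _ ≤ _ := by gcongr
  · rw [intervalIntegral.integral_const_mul]
    refine mul_le_mul_of_nonneg_left ?_ hk.nonneg
    refine (integral_singular_le (by linarith) (by linarith) hβ0 hβ ht).trans ?_
    rw [show 1 - (a - γ) - β = 0 by linarith, Real.rpow_zero, mul_one]

end Duhamel

/-! ### Continuity of Duhamel integrals in time -/

section Duhamel

variable {X : Type*} [NormedAddCommGroup X] [NormedSpace ℝ X]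
variable {S : ℝ → X →L[ℝ] X} {L a β A : ℝ} {k : ℝ → ℝ → X}

/-- Hölder continuity of the orbits in the seminorm `‖Λ ·‖`, where `Λ` commutes with the semigroup. It
costs the power `θ` of singularity at `σ = 0`. -/
theorem IsFlow.norm_increment_le (hS : IsSmoothing S L) (hk : IsFlow S a β A k)
    {b θ : ℝ} (hθ0 : 0 < θ) (hθ : θ < 1) {Λ : X →L[ℝ] X}
    (hΛS : ∀ δ, 0 < δ → ∀ f, Λ (S δ f) = S δ (Λ f))
    (hΛ : ∀ τ σ, 0 < τ → 0 < σ → ‖Λ (k τ σ)‖ ≤ A * (σ ^ (-b) * τ ^ (-β)))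
    {τ σ δ : ℝ} (hτ : 0 < τ) (hσ : 0 < σ) (hδ : 0 < δ) :
    ‖Λ (k τ (σ + δ) - k τ σ)‖ ≤
      (2 ^ (θ + b) * L * A * δ ^ θ) * (σ ^ (-(b + θ)) * τ ^ (-β)) := by
  have hσ2 : 0 < σ / 2 := by positivity
  have e1 : k τ (σ + δ) = S (σ / 2 + δ) (k τ (σ / 2)) := by
    rw [hk.semigroup τ _ _ hτ hσ2 (by positivity)]; congr 1; ring
  have e2 : k τ σ = S (σ / 2) (k τ (σ / 2)) := by
    rw [hk.semigroup τ _ _ hτ hσ2 (by positivity)]; congr 1; ring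
  rw [e1, e2, map_sub, hΛS _ (by positivity), hΛS _ hσ2]
  have hL : 0 ≤ L := by linarith [hS.two_le]
  refine (hS.holder hθ0 hθ hσ2 hδ _).trans ?_
  have e3 : (δ / (σ / 2)) ^ θ = 2 ^ θ * δ ^ θ * σ ^ (-θ) := by
    rw [show δ / (σ / 2) = 2 * δ * σ⁻¹ by field_simp, Real.mul_rpow (by positivity) (by positivity),
      Real.mul_rpow (by positivity) hδ.le, Real.inv_rpow hσ.le, Real.rpow_neg hσ.le]
  have e4 : (σ / 2) ^ (-b) = 2 ^ b * σ ^ (-b) := by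
    rw [Real.div_rpow hσ.le (by norm_num), Real.rpow_neg (by norm_num : (0 : ℝ) ≤ 2)]
    field_simp
  calc _ ≤ L * (δ / (σ / 2)) ^ θ * (A * ((σ / 2) ^ (-b) * τ ^ (-β))) := by
        gcongr
        exact hΛ τ _ hτ hσ2
    _ = (2 ^ θ * 2 ^ b) * L * A * δ ^ θ * ((σ ^ (-b) * σ ^ (-θ)) * τ ^ (-β)) := by
        rw [e3, e4]; ring
    _ = _ := by
        rw [← Real.rpow_add (by norm_num), ← Real.rpow_add hσ]
        ring_nf

/-- Continuity at every positive time, in norm and uniformly in `s > 0` in the weighted seminorms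
`s^γ ‖S(s) ·‖`. -/
structure IsBesovContinuous (S : ℝ → X →L[ℝ] X) (γ : ℝ) (W : ℝ → X) : Prop where
  norm : ContinuousOn W (Ioi 0)
  weighted : ∀ t₀, 0 < t₀ → ∀ ε, 0 < ε → ∀ᶠ t in 𝓝 t₀, ∀ s, 0 < s →
    s ^ γ * ‖S s (W t - W t₀)‖ ≤ ε

theorem semigroup_comm (hS : IsSmoothing S L) {s δ : ℝ} (hs : 0 < s) (hδ : 0 < δ) (f : X) :
    S s (S δ f) = S δ (S s f) := by
  rw [hS.semigroup s δ hs hδ, hS.semigroup δ s hδ hs, add_comm]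

theorem weighted_comm (hS : IsSmoothing S L) (c : ℝ) {s : ℝ} (hs : 0 < s) (δ : ℝ) (hδ : 0 < δ)
    (f : X) : (c • S s) (S δ f) = S δ ((c • S s) f) := by
  simp [semigroup_comm hS hs hδ]

theorem IsBesovContinuous.add {γ : ℝ} {W W' : ℝ → X} (h : IsBesovContinuous S γ W)
    (h' : IsBesovContinuous S γ W') : IsBesovContinuous S γ (fun t => W t + W' t) := by
  refine ⟨h.norm.add h'.norm, fun t₀ ht₀ ε hε => ?_⟩
  filter_upwards [h.weighted t₀ ht₀ _ (half_pos hε), h'.weighted t₀ ht₀ _ (half_pos hε)]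
    with t h1 h2 s hs
  have := h1 s hs
  have := h2 s hs
  rw [add_sub_add_comm, map_add]
  calc _ ≤ s ^ γ * (‖S s (W t - W t₀)‖ + ‖S s (W' t - W' t₀)‖) := by
        gcongr
        exact norm_add_le _ _
    _ ≤ ε := by linarith

theorem IsBesovContinuous.neg {γ : ℝ} {W : ℝ → X} (h : IsBesovContinuous S γ W) :
    IsBesovContinuous S γ (fun t => -W t) := by
  refine ⟨h.norm.neg, fun t₀ ht₀ ε hε => ?_⟩
  filter_upwards [h.weighted t₀ ht₀ _ hε] with t h1 s hs
  rw [← neg_sub', map_neg, norm_neg]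
  exact h1 s hs

/-- An orbit `y` of the semigroup with `‖y(t)‖ ≤ A t^{-γ}` is continuous for positive times in the
weighted norm. -/
theorem isBesovContinuous_orbit (hS : IsSmoothing S L) {γ : ℝ} (hγ : 0 ≤ γ) {y : ℝ → X}
    (hy : ∀ s t, 0 < s → 0 < t → S s (y t) = y (s + t))
    (hA : ∀ t, 0 < t → ‖y t‖ ≤ A * t ^ (-γ)) : IsBesovContinuous S γ y := by
  have hL : 0 ≤ L := by linarith [hS.two_le]
  have hA0 : 0 ≤ A := by
    have := (norm_nonneg _).trans (hA 1 one_pos)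
    simpa using this
  have key (Λ : X →L[ℝ] X) (hΛS : ∀ δ, 0 < δ → ∀ f, Λ (S δ f) = S δ (Λ f)) (t₀ : ℝ) (B : ℝ)
      (hB : ∀ σ, t₀ / 4 ≤ σ → ‖Λ (y σ)‖ ≤ B) (t : ℝ) (ht₀ : 0 < t₀)
      (ht : t₀ / 2 < t) : ‖Λ (y t - y t₀)‖ ≤ L * (|t - t₀| / (t₀ / 4)) * B := by
    have main (r t : ℝ) (hr : t₀ / 2 ≤ r) (hrt : r ≤ t) :
        ‖Λ (y t - y r)‖ ≤ L * (|t - r| / (t₀ / 4)) * B := by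
      have hr0 : 0 < r / 2 := by linarith
      have e1 : y t = S (t - r / 2) (y (r / 2)) := by
        rw [hy _ _ (by linarith) hr0]; congr 1; ring
      have e2 : y r = S (r / 2) (y (r / 2)) := by
        rw [hy _ _ hr0 hr0]; congr 1; ring
      rw [e1, e2, map_sub, hΛS _ (by linarith), hΛS _ hr0]
      refine (hS.lip _ _ hr0 (by linarith) _).trans ?_
      rw [abs_of_nonneg (by linarith), show t - r / 2 - r / 2 = t - r by ring]
      have h1 : 0 ≤ t - r := by linarith
      have h2 : (t - r) / (r / 2) ≤ (t - r) / (t₀ / 4) :=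
        div_le_div_of_nonneg_left h1 (by positivity) (by linarith)
      have h3 : ‖Λ (y (r / 2))‖ ≤ B := hB _ (by linarith)
      gcongr
    rcases le_total t t₀ with h | h
    · have := main t t₀ ht.le h
      rwa [abs_sub_comm, ← norm_neg, ← map_neg, neg_sub] at this
    · exact main t₀ t (by linarith) h
  have hlim (t₀ B : ℝ) : Tendsto (fun t => L * (|t - t₀| / (t₀ / 4)) * B) (𝓝 t₀) (𝓝 0) := by
    have : Continuous (fun t => L * (|t - t₀| / (t₀ / 4)) * B) := by fun_prop
    simpa using this.tendsto t₀
  constructor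
  · intro t₀ ht₀
    have ht₀ : 0 < t₀ := ht₀
    refine ContinuousAt.continuousWithinAt (Metric.tendsto_nhds.2 fun ε hε => ?_)
    filter_upwards [(hlim t₀ (A * (t₀ / 4) ^ (-γ))).eventually (gt_mem_nhds hε),
      lt_mem_nhds (show t₀ / 2 < t₀ by linarith)] with t h1 h2
    rw [dist_eq_norm]
    refine lt_of_le_of_lt ?_ h1
    refine key (ContinuousLinearMap.id ℝ X) (fun _ _ _ => rfl) t₀ _ (fun σ hσ => ?_) t ht₀ h2
    refine (hA σ (by linarith)).trans ?_
    have := Real.rpow_le_rpow_of_nonpos (by positivity) hσ (show -γ ≤ 0 by linarith)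
    gcongr
  · intro t₀ ht₀ ε hε
    filter_upwards [(hlim t₀ A).eventually (gt_mem_nhds hε),
      lt_mem_nhds (show t₀ / 2 < t₀ by linarith)] with t h1 h2 s hs
    have hsγ : 0 ≤ s ^ γ := by positivity
    have := key (s ^ γ • S s) (weighted_comm hS _ hs) t₀ A (fun σ hσ => ?_) t ht₀ h2
    · rw [smul_apply, norm_smul, Real.norm_of_nonneg hsγ] at this
      linarith
    · have hσ0 : 0 < σ := by linarith
      rw [smul_apply, norm_smul, Real.norm_of_nonneg hsγ, hy s σ hs hσ0]
      calc _ ≤ (s + σ) ^ γ * (A * (s + σ) ^ (-γ)) := by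
            gcongr
            · linarith
            · exact hA _ (by positivity)
        _ = A * ((s + σ) ^ γ * (s + σ) ^ (-γ)) := by ring
        _ = A := by rw [← Real.rpow_add (by positivity), add_neg_cancel, Real.rpow_zero, mul_one]

/-- A function singular like `σ^{-a}`, `a < 1`, at `0`, with a derivative equally singular,
is bounded. -/
theorem abs_le_of_hasDerivAt_singular {g g' : ℝ → ℝ} {B B' : ℝ} (ha : a < 1)
    (hg : ∀ σ, 0 < σ → HasDerivAt g (g' σ) σ) (h1 : |g 1| ≤ B)
    (h2 : ∀ σ, 0 < σ → |g' σ| ≤ B' * σ ^ (-a)) {σ : ℝ} (hσ : 0 < σ) (hσ1 : σ ≤ 1) :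
    |g σ| ≤ B + B' / (1 - a) := by
  have ha' : 0 < 1 - a := by linarith
  have hB' : 0 ≤ B' := by simpa using (abs_nonneg _).trans (h2 1 one_pos)
  have hP (x : ℝ) (hx : 0 < x) :
      HasDerivAt (fun x => B' / (1 - a) * x ^ (1 - a) - B' / (1 - a) * σ ^ (1 - a))
        (B' * x ^ (-a)) x := by
    have := ((Real.hasDerivAt_rpow_const (p := 1 - a) (Or.inl hx.ne')).const_mul
      (B' / (1 - a))).sub_const (B' / (1 - a) * σ ^ (1 - a))
    refine this.congr_deriv ?_
    rw [show 1 - a - 1 = -a by ring]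
    field_simp
  have h := image_norm_le_of_norm_deriv_right_le_deriv_boundary' (a := σ) (b := 1)
    (f := fun x => g x - g σ) (f' := g')
    (B := fun x => B' / (1 - a) * x ^ (1 - a) - B' / (1 - a) * σ ^ (1 - a))
    (B' := fun x => B' * x ^ (-a))
    (fun x hx => ((hg x (hσ.trans_le hx.1)).sub_const _).continuousAt.continuousWithinAt)
    (fun x hx => ((hg x (hσ.trans_le hx.1)).sub_const _).hasDerivWithinAt)
    (by simp)
    (fun x hx => (hP x (hσ.trans_le hx.1)).continuousAt.continuousWithinAt)
    (fun x hx => (hP x (hσ.trans_le hx.1)).hasDerivWithinAt)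
    (fun x hx => h2 x (hσ.trans_le hx.1)) (right_mem_Icc.2 hσ1)
  simp only [Real.one_rpow, mul_one, Real.norm_eq_abs] at h
  have h3 : 0 ≤ B' / (1 - a) * σ ^ (1 - a) := by positivity
  have h4 : |g σ| ≤ |g 1| + |g 1 - g σ| := by
    have := abs_sub_abs_le_abs_sub (g σ) (g 1)
    rw [abs_sub_comm] at this
    linarith
  linarith

variable [CompleteSpace X]

/-- Hölder continuity of Duhamel integrals, for the seminorm `‖Λ ·‖`. The increment is split into
the integral over the added time interval and the increments of the orbits. -/
theorem IsFlow.norm_duhamel_sub_le (hS : IsSmoothing S L) (hk : IsFlow S a β A k)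
    (ha0 : 0 ≤ a) (ha : a < 1) (hβ0 : 0 ≤ β) (hβ : β < 1)
    {b θ : ℝ} (hb0 : 0 ≤ b) (hθ0 : 0 < θ) (hbθ : b + θ < 1) {Λ : X →L[ℝ] X}
    (hΛS : ∀ δ, 0 < δ → ∀ f, Λ (S δ f) = S δ (Λ f))
    (hΛ : ∀ τ σ, 0 < τ → 0 < σ → ‖Λ (k τ σ)‖ ≤ A * (σ ^ (-b) * τ ^ (-β)))
    {r t : ℝ} (hr : 0 < r) (hrt : r < t) :
    ‖Λ (duhamel k t - duhamel k r)‖ ≤ A * r ^ (-β) * ((t - r) ^ (1 - b) / (1 - b)) +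
      (2 ^ (θ + b) * L * A * (t - r) ^ θ) * (betaBound (b + θ) β * r ^ (1 - (b + θ) - β)) := by
  have ht : 0 < t := hr.trans hrt
  have hA := hk.nonneg
  have hL : 0 ≤ L := by linarith [hS.two_le]
  have hI := hk.intervalIntegrable ha0 ha hβ0 hβ ht
  have hI1 : IntervalIntegrable (fun τ => k τ (t - τ)) volume 0 r :=
    hI.mono_set (by rw [uIcc_of_le hr.le, uIcc_of_le ht.le]; exact Icc_subset_Icc_right hrt.le)
  have hI2 : IntervalIntegrable (fun τ => k τ (t - τ)) volume r t :=
    hI.mono_set (by rw [uIcc_of_le hrt.le, uIcc_of_le ht.le]; exact Icc_subset_Icc_left hr.le)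
  have hI3 := hk.intervalIntegrable ha0 ha hβ0 hβ hr
  have e : duhamel k t - duhamel k r =
      (∫ τ in r..t, k τ (t - τ)) + ∫ τ in (0 : ℝ)..r, (k τ (t - τ) - k τ (r - τ)) := by
    rw [duhamel, duhamel, intervalIntegral.integral_sub hI1 hI3,
      ← intervalIntegral.integral_add_adjacent_intervals hI1 hI2]
    abel
  rw [e, map_add, ← ContinuousLinearMap.intervalIntegral_comp_comm _ hI2,
    ← ContinuousLinearMap.intervalIntegral_comp_comm _ (hI1.sub hI3)]
  refine (norm_add_le _ _).trans (add_le_add ?_ ?_)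
  · refine (norm_integral_le_of_Ioo (g := fun τ => A * r ^ (-β) * (t - τ) ^ (-b)) hrt.le
      (fun τ hτ => ?_) ((intervalIntegrable_sub_rpow (by linarith) r t).const_mul _)).trans ?_
    · have h1 : 0 < t - τ := by linarith [hτ.2]
      have h2 : 0 < τ := hr.trans hτ.1
      have h3 : τ ^ (-β) ≤ r ^ (-β) :=
        Real.rpow_le_rpow_of_nonpos hr hτ.1.le (by linarith)
      calc _ ≤ A * ((t - τ) ^ (-b) * τ ^ (-β)) := hΛ τ _ h2 h1
        _ ≤ A * ((t - τ) ^ (-b) * r ^ (-β)) := by gcongr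
        _ = _ := by ring
    · rw [intervalIntegral.integral_const_mul, integral_sub_rpow (by linarith)]
  · refine (norm_integral_le_of_Ioo hr.le (fun τ hτ => ?_)
      ((intervalIntegrable_singular (b := b + θ) (by linarith) hbθ hβ0 hβ hr).const_mul
        (2 ^ (θ + b) * L * A * (t - r) ^ θ))).trans ?_
    · have h1 : 0 < r - τ := by linarith [hτ.2]
      have := hk.norm_increment_le hS hθ0 (by linarith) hΛS hΛ hτ.1 h1 (sub_pos.2 hrt)
      rwa [show r - τ + (t - r) = t - τ by ring] at this
    · rw [intervalIntegral.integral_const_mul]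
      have : 0 ≤ (t - r) ^ θ := Real.rpow_nonneg (by linarith) _
      exact mul_le_mul_of_nonneg_left (integral_singular_le (by linarith) hbθ hβ0 hβ hr)
        (by positivity)

/-- A modulus of continuity at `s > 0` of Duhamel integrals, uniform over all seminorms `‖Λ ·‖`
with the same bounds. -/
theorem IsFlow.exists_modulus (hS : IsSmoothing S L) (hk : IsFlow S a β A k)
    (ha0 : 0 ≤ a) (ha : a < 1) (hβ0 : 0 ≤ β) (hβ : β < 1) {b : ℝ} (hb0 : 0 ≤ b) (hb : b < 1)
    {s : ℝ} (hs : 0 < s) {ε : ℝ} (hε : 0 < ε) :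
    ∀ᶠ t in 𝓝 s, ∀ Λ : X →L[ℝ] X, (∀ δ, 0 < δ → ∀ f, Λ (S δ f) = S δ (Λ f)) →
      (∀ τ σ, 0 < τ → 0 < σ → ‖Λ (k τ σ)‖ ≤ A * (σ ^ (-b) * τ ^ (-β))) →
      ‖Λ (duhamel k t - duhamel k s)‖ ≤ ε := by
  have hA := hk.nonneg
  have hL : 0 ≤ L := by linarith [hS.two_le]
  -- Any Hölder exponent `θ` with `b + θ < 1` keeps the integrals convergent.
  set θ := (1 - b) / 2 with hθ
  have hθ0 : 0 < θ := by rw [hθ]; linarith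
  have hbθ : b + θ < 1 := by rw [hθ]; linarith
  set e := 1 - (b + θ) - β
  have hK := betaBound_pos hbθ hβ
  set C₁ := A * (s / 2) ^ (-β) with hC₁
  set C₂ := 2 ^ (θ + b) * L * A with hC₂
  set C₃ := betaBound (b + θ) β * ((s / 2) ^ e + s ^ e) with hC₃
  have hlim : Tendsto (fun t : ℝ => C₁ * (|t - s| ^ (1 - b) / (1 - b)) + C₂ * |t - s| ^ θ * C₃)
      (𝓝 s) (𝓝 0) := by
    have h1 (q : ℝ) (hq : 0 < q) : Tendsto (fun t : ℝ => |t - s| ^ q) (𝓝 s) (𝓝 0) := by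
      have : Continuous fun t : ℝ => |t - s| ^ q := by
        have : Continuous fun t : ℝ => |t - s| := by fun_prop
        exact this.rpow_const fun _ => Or.inr hq.le
      simpa [Real.zero_rpow hq.ne'] using this.tendsto s
    have := (((h1 (1 - b) (by linarith)).div_const (1 - b)).const_mul C₁).add
      (((h1 θ hθ0).const_mul C₂).mul_const C₃)
    simpa using this
  have main : ∀ Λ : X →L[ℝ] X, (∀ δ, 0 < δ → ∀ f, Λ (S δ f) = S δ (Λ f)) →
      (∀ τ σ, 0 < τ → 0 < σ → ‖Λ (k τ σ)‖ ≤ A * (σ ^ (-b) * τ ^ (-β))) →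
      ∀ r t, s / 2 ≤ r → r ≤ s → r < t →
      ‖Λ (duhamel k t - duhamel k r)‖ ≤
        C₁ * ((t - r) ^ (1 - b) / (1 - b)) + C₂ * (t - r) ^ θ * C₃ := by
    intro Λ h1 h2 r t hr hrs hrt
    have hs2 : 0 < s / 2 := by positivity
    have hr0 : 0 < r := hs2.trans_le hr
    have htr : 0 < t - r := by linarith
    refine (hk.norm_duhamel_sub_le hS ha0 ha hβ0 hβ hb0 hθ0 hbθ h1 h2 hr0 hrt).trans ?_
    have h3 : r ^ (-β) ≤ (s / 2) ^ (-β) := Real.rpow_le_rpow_of_nonpos hs2 hr (by linarith)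
    have h4 : r ^ e ≤ (s / 2) ^ e + s ^ e := by
      have p1 : 0 ≤ (s / 2) ^ e := by positivity
      have p2 : 0 ≤ s ^ e := by positivity
      rcases le_total 0 e with he | he
      · linarith [Real.rpow_le_rpow hr0.le hrs he]
      · linarith [Real.rpow_le_rpow_of_nonpos hs2 hr he]
    have h5 : 0 < 1 - b := by linarith
    have h6 : A * r ^ (-β) ≤ C₁ := by rw [hC₁]; gcongr
    have h7 : betaBound (b + θ) β * r ^ (1 - (b + θ) - β) ≤ C₃ := by rw [hC₃]; gcongr
    have h8 : 0 ≤ C₂ := by positivity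
    have h9 : 0 ≤ (t - r) ^ θ := by positivity
    gcongr
  filter_upwards [hlim.eventually (gt_mem_nhds hε), lt_mem_nhds (show s / 2 < s by linarith)]
    with t ht1 ht2 Λ h1 h2
  rcases lt_trichotomy t s with h | h | h
  · have := main Λ h1 h2 t s ht2.le h.le h
    rw [abs_sub_comm, abs_of_pos (sub_pos.2 h)] at ht1
    rw [← neg_sub, map_neg, norm_neg]
    linarith
  · subst h
    simpa using hε.le
  · have := main Λ h1 h2 s t (by linarith) le_rfl h
    rw [abs_of_pos (sub_pos.2 h)] at ht1
    linarith

/-- Duhamel integrals are continuous for positive times in the weighted norm: the seminorms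
`s^γ ‖S(s) ·‖` satisfy the bounds of `IsFlow.exists_modulus` with constants independent of `s`. -/
theorem IsFlow.isBesovContinuous (hS : IsSmoothing S L) (hk : IsFlow S a β A k)
    {γ : ℝ} (hγ : 0 ≤ γ) (haγ : γ ≤ a) (ha : a < 1) (hβ0 : 0 ≤ β) (hβ : β < 1) :
    IsBesovContinuous S γ (duhamel k) := by
  have ha0 := hγ.trans haγ
  have hA := hk.nonneg
  constructor
  · intro s hs
    refine ContinuousAt.continuousWithinAt (Metric.tendsto_nhds.2 fun ε hε => ?_)
    filter_upwards [hk.exists_modulus hS ha0 ha hβ0 hβ ha0 ha hs (half_pos hε)] with t ht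
    have := ht (ContinuousLinearMap.id ℝ X) (fun _ _ _ => rfl) hk.bound
    rw [dist_eq_norm]
    simp only [ContinuousLinearMap.id_apply] at this
    linarith
  · intro t₀ ht₀ ε hε
    filter_upwards [hk.exists_modulus hS ha0 ha hβ0 hβ (b := a - γ) (by linarith) (by linarith)
      ht₀ hε] with t ht s hs
    have hsγ : 0 ≤ s ^ γ := by positivity
    have := ht (s ^ γ • S s) (weighted_comm hS _ hs) ?_
    · rwa [smul_apply, norm_smul, Real.norm_of_nonneg hsγ] at this
    · intro τ σ hτ hσ
      rw [smul_apply, norm_smul, Real.norm_of_nonneg hsγ, hk.semigroup τ σ s hτ hσ hs]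
      have h5 : s ^ γ * (σ + s) ^ (-a) ≤ σ ^ (-(a - γ)) := by
        calc s ^ γ * (σ + s) ^ (-a) ≤ (σ + s) ^ γ * (σ + s) ^ (-a) := by
              gcongr
              linarith
          _ = (σ + s) ^ (-(a - γ)) := by
              rw [← Real.rpow_add (by linarith)]; ring_nf
          _ ≤ _ := Real.rpow_le_rpow_of_nonpos hσ (by linarith) (by linarith)
      calc _ ≤ s ^ γ * (A * ((σ + s) ^ (-a) * τ ^ (-β))) := by
            gcongr
            exact hk.bound τ _ hτ (by positivity)
        _ = A * ((s ^ γ * (σ + s) ^ (-a)) * τ ^ (-β)) := by ring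
        _ ≤ _ := by gcongr

/-- A Duhamel integral tends weakly to zero at the initial time if the orbits are weakly bounded. -/
theorem IsFlow.tendsto_duhamel_zero (hk : IsFlow S a β A k) (ha0 : 0 ≤ a) (ha : a < 1)
    (hβ0 : 0 ≤ β) (hβ : β < 1) (ℓ : X →L[ℝ] ℝ) {C : ℝ}
    (hℓ : ∀ τ σ, 0 < τ → 0 < σ → σ ≤ 1 → |ℓ (k τ σ)| ≤ C * τ ^ (-β)) :
    Tendsto (fun t => ℓ (duhamel k t)) (𝓝[>] 0) (𝓝 0) := by
  have hlim : Tendsto (fun t : ℝ => C * (t ^ (1 - β) / (1 - β))) (𝓝[>] 0) (𝓝 0) := by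
    have h1 : Continuous fun t : ℝ => C * (t ^ (1 - β) / (1 - β)) := by
      have : Continuous fun t : ℝ => t ^ (1 - β) :=
        continuous_id.rpow_const fun _ => Or.inr (by linarith)
      fun_prop
    have := (h1.tendsto 0).mono_left (nhdsWithin_le_nhds (s := Ioi 0))
    simpa [Real.zero_rpow (show 1 - β ≠ 0 by linarith)] using this
  refine squeeze_zero_norm' ?_ hlim
  filter_upwards [Ioo_mem_nhdsGT (show (0 : ℝ) < 1 by norm_num)] with t ht
  rw [duhamel, ← ContinuousLinearMap.intervalIntegral_comp_comm _
    (hk.intervalIntegrable ha0 ha hβ0 hβ ht.1), ← integral_rpow_zero hβ,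
    ← intervalIntegral.integral_const_mul]
  exact norm_integral_le_of_Ioo ht.1.le (fun τ hτ => hℓ τ _ hτ.1 (by linarith [hτ.2])
    (by linarith [hτ.1, ht.2])) ((intervalIntegral.intervalIntegrable_rpow'
      (by linarith)).const_mul _)

end Duhamel

/-! ### Bilinear integral equations -/

section Picard

variable {X Y : Type*} [NormedAddCommGroup X] [NormedSpace ℝ X]
  [NormedAddCommGroup Y] [NormedSpace ℝ Y]
variable {S : ℝ → X →L[ℝ] X} {L γ c : ℝ}

/-- The semigroup is norm continuous for positive times. -/
theorem IsSmoothing.continuousOn (hS : IsSmoothing S L) : ContinuousOn S (Ioi 0) := by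
  have hL : 0 ≤ L := by linarith [hS.two_le]
  have main (s t : ℝ) (hs : 0 < s) (hst : s ≤ t) : ‖S t - S s‖ ≤ L * ((t - s) / s) := by
    have : 0 ≤ t - s := by linarith
    exact ContinuousLinearMap.opNorm_le_bound _ (by positivity) fun f => hS.lip s t hs hst f
  intro s hs
  have hs : 0 < s := hs
  refine ContinuousAt.continuousWithinAt (tendsto_iff_norm_sub_tendsto_zero.2 ?_)
  have hlim : Tendsto (fun t => L * (|t - s| / (s / 2))) (𝓝 s) (𝓝 0) := by
    have : Continuous (fun t => L * (|t - s| / (s / 2))) := by fun_prop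
    simpa using this.tendsto s
  refine squeeze_zero' (.of_forall fun _ => norm_nonneg _) ?_ hlim
  filter_upwards [lt_mem_nhds (show s / 2 < s by linarith)] with t ht
  rcases le_total s t with h | h
  · refine (main s t hs h).trans ?_
    rw [abs_of_nonneg (by linarith)]
    have : 0 ≤ t - s := by linarith
    gcongr
    linarith
  · rw [norm_sub_rev, abs_sub_comm]
    refine (main t s (by linarith) h).trans ?_
    rw [abs_of_nonneg (by linarith)]
    have : 0 ≤ s - t := by linarith
    gcongr

theorem continuousOn_of_semigroup (hS : IsSmoothing S L) {P : ℝ → Y →L[ℝ] X}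
    (hP : ∀ σ δ, 0 < σ → 0 < δ → ∀ f, S δ (P σ f) = P (σ + δ) f) : ContinuousOn P (Ioi 0) := by
  intro s hs
  have hs : 0 < s := hs
  refine ContinuousAt.continuousWithinAt ?_
  have h1 : ContinuousAt (fun σ => S (σ - s / 2) ∘L P (s / 2)) s := by
    have h2 : ContinuousAt (fun σ => S (σ - s / 2)) s := by
      refine ContinuousAt.comp (g := S) (f := fun σ => σ - s / 2) ?_ (by fun_prop)
      exact hS.continuousOn.continuousAt (Ioi_mem_nhds (by linarith))
    exact h2.clm_comp continuousAt_const
  refine h1.congr ?_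
  filter_upwards [lt_mem_nhds (show s / 2 < s by linarith)] with σ hσ
  ext f
  rw [ContinuousLinearMap.comp_apply, hP _ _ (by linarith) (by linarith)]
  congr 2
  ring

/-- Bilinear maps `B(σ)`, `σ > 0`, behaving like `(f, g) ↦ ℙ∇S(σ)·(f ⊗ g)` on a space whose norm has
scaling degree `2γ - 1`. -/
structure IsBilinearKernel (S : ℝ → X →L[ℝ] X) (γ c : ℝ) (B : ℝ → X →L[ℝ] X →L[ℝ] X) : Prop where
  bound : ∀ σ, 0 < σ → ∀ f g, ‖B σ f g‖ ≤ c * σ ^ (-(1 - γ)) * ‖f‖ * ‖g‖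
  semigroup : ∀ σ δ, 0 < σ → 0 < δ → ∀ f g, S δ (B σ f g) = B (σ + δ) f g

variable {B : ℝ → X →L[ℝ] X →L[ℝ] X}

theorem IsBilinearKernel.continuousOn (hS : IsSmoothing S L) (hB : IsBilinearKernel S γ c B) :
    ContinuousOn B (Ioi 0) := by
  intro s hs
  have hs : 0 < s := hs
  refine ContinuousAt.continuousWithinAt ?_
  have h1 : ContinuousAt
      (fun σ => (ContinuousLinearMap.compL ℝ X X X (S (σ - s / 2))) ∘L B (s / 2)) s := by
    have h2 : ContinuousAt (fun σ => S (σ - s / 2)) s := by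
      refine ContinuousAt.comp (g := S) (f := fun σ => σ - s / 2) ?_ (by fun_prop)
      exact hS.continuousOn.continuousAt (Ioi_mem_nhds (by linarith))
    have h3 : ContinuousAt (fun σ => ContinuousLinearMap.compL ℝ X X X (S (σ - s / 2))) s :=
      (ContinuousLinearMap.compL ℝ X X X).continuous.continuousAt.comp h2
    exact h3.clm_comp continuousAt_const
  refine h1.congr ?_
  filter_upwards [lt_mem_nhds (show s / 2 < s by linarith)] with σ hσ
  ext f g
  simp only [ContinuousLinearMap.comp_apply, ContinuousLinearMap.compL_apply]
  rw [hB.semigroup _ _ (by linarith) (by linarith)]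
  congr 3
  ring

theorem measurable_flow {P : ℝ → Y →L[ℝ] X} (hP : ContinuousOn P (Ioi 0)) {V : ℝ → Y}
    (hV : ContinuousOn V (Ioi 0)) (t : ℝ) :
    AEStronglyMeasurable (fun τ => P (t - τ) (V τ)) (volume.restrict (Ioo 0 t)) := by
  refine ContinuousOn.aestronglyMeasurable ?_ measurableSet_Ioo
  refine ContinuousOn.clm_apply (hP.comp (by fun_prop) fun τ hτ => ?_)
    (hV.mono fun τ hτ => hτ.1)
  exact sub_pos.2 hτ.2

theorem isFlow_linear (hS : IsSmoothing S L) {P : ℝ → Y →L[ℝ] X}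
    (hP : ∀ σ δ, 0 < σ → 0 < δ → ∀ f, S δ (P σ f) = P (σ + δ) f) {a : ℝ}
    (hPb : ∀ σ, 0 < σ → ∀ f, ‖P σ f‖ ≤ c * σ ^ (-a) * ‖f‖) {V : ℝ → Y} {M β : ℝ} (hc : 0 ≤ c)
    (hV : ContinuousOn V (Ioi 0)) (hVb : ∀ τ, 0 < τ → ‖V τ‖ ≤ M * τ ^ (-β)) :
    IsFlow S a β (c * M) (fun τ σ => P σ (V τ)) where
  semigroup τ σ δ _ hσ hδ := hP σ δ hσ hδ _
  bound τ σ hτ hσ := by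
    refine (hPb σ hσ _).trans ?_
    calc _ ≤ c * σ ^ (-a) * (M * τ ^ (-β)) := by
          gcongr
          exact hVb τ hτ
      _ = _ := by ring
  meas t _ := measurable_flow (continuousOn_of_semigroup hS hP) hV t

theorem IsBilinearKernel.isFlow (hS : IsSmoothing S L) (hB : IsBilinearKernel S γ c B)
    (hc : 0 ≤ c) {f g : ℝ → X} {R R' : ℝ} (hR : 0 ≤ R)
    (hf : ContinuousOn f (Ioi 0)) (hfb : ∀ τ, 0 < τ → ‖f τ‖ ≤ R * τ ^ (-γ))
    (hg : ContinuousOn g (Ioi 0)) (hgb : ∀ τ, 0 < τ → ‖g τ‖ ≤ R' * τ ^ (-γ)) :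
    IsFlow S (1 - γ) (2 * γ) (c * R * R') (fun τ σ => B σ (f τ) (g τ)) where
  semigroup τ σ δ _ hσ hδ := hB.semigroup σ δ hσ hδ _ _
  bound τ σ hτ hσ := by
    refine (hB.bound σ hσ _ _).trans ?_
    calc _ ≤ c * σ ^ (-(1 - γ)) * (R * τ ^ (-γ)) * (R' * τ ^ (-γ)) := by
          gcongr
          · exact hfb τ hτ
          · exact hgb τ hτ
      _ = c * R * R' * (σ ^ (-(1 - γ)) * (τ ^ (-γ) * τ ^ (-γ))) := by ring
      _ = _ := by
          rw [← Real.rpow_add hτ]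
          ring_nf
  meas t _ := by
    refine ContinuousOn.aestronglyMeasurable ?_ measurableSet_Ioo
    have h1 : ContinuousOn (fun τ => B (t - τ)) (Ioo 0 t) :=
      (hB.continuousOn hS).comp (by fun_prop) fun τ hτ => sub_pos.2 hτ.2
    exact (h1.clm_apply (hf.mono fun τ hτ => hτ.1)).clm_apply (hg.mono fun τ hτ => hτ.1)

/-- Contraction principle in the space of continuous functions `u : (0,∞) → X` with the norm
`sup t^γ ‖u(t)‖`. -/
theorem exists_fixedPoint_weighted [CompleteSpace X] {R : ℝ} (hR : 0 ≤ R)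
    (Φ : (ℝ → X) → ℝ → X)
    (hΦ : ∀ u : ℝ → X, ContinuousOn u (Ioi 0) → (∀ t, 0 < t → ‖u t‖ ≤ R * t ^ (-γ)) →
      ContinuousOn (Φ u) (Ioi 0) ∧ ∀ t, 0 < t → ‖Φ u t‖ ≤ R * t ^ (-γ))
    (hc : ∀ u v : ℝ → X, ContinuousOn u (Ioi 0) → (∀ t, 0 < t → ‖u t‖ ≤ R * t ^ (-γ)) →
      ContinuousOn v (Ioi 0) → (∀ t, 0 < t → ‖v t‖ ≤ R * t ^ (-γ)) → ∀ M,
      (∀ t, 0 < t → ‖u t - v t‖ ≤ M * t ^ (-γ)) →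
      ∀ t, 0 < t → ‖Φ u t - Φ v t‖ ≤ M / 2 * t ^ (-γ)) :
    ∃ u : ℝ → X, ContinuousOn u (Ioi 0) ∧ (∀ t, 0 < t → ‖u t‖ ≤ R * t ^ (-γ)) ∧
      ∀ t, 0 < t → u t = Φ u t := by
  -- The substitution `t = exp x` identifies this space with bounded continuous functions on `ℝ`.
  let Z := Metric.closedBall (0 : BoundedContinuousFunction ℝ X) R
  let D : Z → ℝ → X := fun v t => t ^ (-γ) • v.1 (Real.log t)
  have hD1 (v : Z) : ContinuousOn (D v) (Ioi 0) := by
    refine ContinuousOn.smul (fun t ht => ?_) (v.1.continuous.comp_continuousOn fun t ht => ?_)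
    · exact (Real.continuousAt_rpow_const t _ (Or.inl (ne_of_gt ht))).continuousWithinAt
    · exact (Real.continuousAt_log (ne_of_gt ht)).continuousWithinAt
  have hD2 (v : Z) (t : ℝ) (ht : 0 < t) : ‖D v t‖ ≤ R * t ^ (-γ) := by
    have h0 : (0 : ℝ) ≤ t ^ (-γ) := by positivity
    rw [norm_smul, Real.norm_of_nonneg h0, mul_comm]
    gcongr
    exact (v.1.norm_coe_le_norm _).trans (mem_closedBall_zero_iff.1 v.2)
  have hD3 (v w : Z) (t : ℝ) (ht : 0 < t) : ‖D v t - D w t‖ ≤ dist v w * t ^ (-γ) := by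
    have h0 : (0 : ℝ) ≤ t ^ (-γ) := by positivity
    rw [← smul_sub, norm_smul, Real.norm_of_nonneg h0, mul_comm, ← dist_eq_norm]
    gcongr
    exact BoundedContinuousFunction.dist_coe_le_dist _
  have hexp (x : ℝ) : Real.exp x ^ (-γ) = Real.exp (-(γ * x)) := by
    rw [← Real.exp_mul]; ring_nf
  have hb (v : Z) (x : ℝ) : ‖Real.exp (γ * x) • Φ (D v) (Real.exp x)‖ ≤ R := by
    have := (hΦ (D v) (hD1 v) (hD2 v)).2 _ (Real.exp_pos x)
    rw [hexp] at this
    rw [norm_smul, Real.norm_of_nonneg (Real.exp_pos _).le]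
    calc _ ≤ Real.exp (γ * x) * (R * Real.exp (-(γ * x))) := by gcongr
      _ = R * (Real.exp (γ * x) * Real.exp (-(γ * x))) := by ring
      _ = R := by rw [← Real.exp_add, add_neg_cancel, Real.exp_zero, mul_one]
  have hcont (v : Z) : Continuous fun x => Real.exp (γ * x) • Φ (D v) (Real.exp x) := by
    refine Continuous.smul (by fun_prop) ?_
    rw [← continuousOn_univ]
    exact (hΦ (D v) (hD1 v) (hD2 v)).1.comp (by fun_prop) fun x _ => Real.exp_pos x
  let Ψ : Z → Z := fun v => ⟨BoundedContinuousFunction.ofNormedAddCommGroup _ (hcont v) R (hb v),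
    mem_closedBall_zero_iff.2 (BoundedContinuousFunction.norm_ofNormedAddCommGroup_le _ hR _)⟩
  have hΨ : ContractingWith (1 / 2) Ψ := by
    refine ⟨by rw [← NNReal.coe_lt_coe]; norm_num, LipschitzWith.of_dist_le_mul fun v w => ?_⟩
    have h0 : 0 ≤ dist v w := dist_nonneg
    refine (BoundedContinuousFunction.dist_le (by positivity)).2 fun x => ?_
    have := hc _ _ (hD1 v) (hD2 v) (hD1 w) (hD2 w) _ (hD3 v w) _ (Real.exp_pos x)
    rw [hexp] at this
    change dist (Real.exp (γ * x) • Φ (D v) (Real.exp x))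
      (Real.exp (γ * x) • Φ (D w) (Real.exp x)) ≤ _
    rw [dist_eq_norm, ← smul_sub, norm_smul, Real.norm_of_nonneg (Real.exp_pos _).le]
    calc _ ≤ Real.exp (γ * x) * (dist v w / 2 * Real.exp (-(γ * x))) := by gcongr
      _ = dist v w / 2 * (Real.exp (γ * x) * Real.exp (-(γ * x))) := by ring
      _ = _ := by
        rw [← Real.exp_add, add_neg_cancel, Real.exp_zero, mul_one]
        simp
        ring
  have : Nonempty Z := ⟨⟨0, by simpa [Z] using hR⟩⟩
  have : CompleteSpace Z := (Metric.isClosed_closedBall).completeSpace_coe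
  set v := hΨ.fixedPoint
  have hv : Ψ v = v := hΨ.fixedPoint_isFixedPt
  refine ⟨D v, hD1 v, hD2 v, fun t ht => ?_⟩
  have h1 : v.1 (Real.log t) = (Ψ v).1 (Real.log t) := by rw [hv]
  have h2 : (Ψ v).1 (Real.log t) = Real.exp (γ * Real.log t) • Φ (D v) (Real.exp (Real.log t)) :=
    rfl
  change t ^ (-γ) • v.1 (Real.log t) = _
  rw [h1, h2, Real.exp_log ht, smul_smul, mul_comm γ, ← Real.rpow_def_of_pos ht,
    ← Real.rpow_add ht, neg_add_cancel, Real.rpow_zero, one_smul]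

/-- The right-hand side `y(t) - ∫₀ᵗ B(t - τ)(T u(τ), u(τ)) dτ` of the integral equation. Here `T` is
the identity or a mollification. -/
noncomputable def mildMap (B : ℝ → X →L[ℝ] X →L[ℝ] X) (T : X →L[ℝ] X) (y u : ℝ → X) (t : ℝ) : X :=
  y t - duhamel (fun τ σ => B σ (T (u τ)) (u τ)) t

section Solve

variable {T : X →L[ℝ] X} {R : ℝ} {y : ℝ → X}

theorem norm_bilinear_sub_le (hB : IsBilinearKernel S γ c B) (hc : 0 ≤ c)
    (hT : ∀ f, ‖T f‖ ≤ ‖f‖) {f g : X} {ρ m σ : ℝ} (hσ : 0 < σ) (hf : ‖f‖ ≤ ρ) (hg : ‖g‖ ≤ ρ)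
    (hfg : ‖f - g‖ ≤ m) :
    ‖B σ (T f) f - B σ (T g) g‖ ≤ c * σ ^ (-(1 - γ)) * (2 * ρ * m) := by
  have hρ := (norm_nonneg _).trans hf
  have hm := (norm_nonneg _).trans hfg
  have e : B σ (T f) f - B σ (T g) g = B σ (T (f - g)) f + B σ (T g) (f - g) := by
    simp only [map_sub, sub_apply]
    abel
  rw [e]
  calc _ ≤ c * σ ^ (-(1 - γ)) * ‖T (f - g)‖ * ‖f‖ + c * σ ^ (-(1 - γ)) * ‖T g‖ * ‖f - g‖ :=
        (norm_add_le _ _).trans (add_le_add (hB.bound σ hσ _ _) (hB.bound σ hσ _ _))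
    _ ≤ c * σ ^ (-(1 - γ)) * m * ρ + c * σ ^ (-(1 - γ)) * ρ * m := by
        gcongr
        · exact (hT _).trans hfg
        · exact (hT _).trans hg
    _ = _ := by ring

/-- In the norm `sup t^γ ‖u(t)‖`, the map is a contraction by the factor `1 / 2` on the ball of
radius `R`. The functions need not be continuous. -/
theorem norm_mildMap_sub_le (hB : IsBilinearKernel S γ c B) (hc : 0 ≤ c) (hγ0 : 0 < γ)
    (hγ : γ < 1 / 2) (hT : ∀ f, ‖T f‖ ≤ ‖f‖)
    (hR : 4 * c * betaBound (1 - γ) (2 * γ) * R ≤ 1) {u w : ℝ → X}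
    (hu : ∀ t, 0 < t → ‖u t‖ ≤ R * t ^ (-γ)) (hw : ∀ t, 0 < t → ‖w t‖ ≤ R * t ^ (-γ))
    {t : ℝ} (ht : 0 < t)
    (hui : IntervalIntegrable (fun τ => B (t - τ) (T (u τ)) (u τ)) volume 0 t)
    (hwi : IntervalIntegrable (fun τ => B (t - τ) (T (w τ)) (w τ)) volume 0 t)
    {M : ℝ} (hM : ∀ t, 0 < t → ‖u t - w t‖ ≤ M * t ^ (-γ)) :
    ‖mildMap B T y u t - mildMap B T y w t‖ ≤ M / 2 * t ^ (-γ) := by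
  have hR0 : 0 ≤ R := by simpa using (norm_nonneg _).trans (hu 1 one_pos)
  have hM0 : 0 ≤ M := by simpa using (norm_nonneg _).trans (hM 1 one_pos)
  rw [mildMap, mildMap, sub_sub_sub_cancel_left, duhamel, duhamel,
    ← intervalIntegral.integral_sub hwi hui]
  refine (norm_integral_le_of_Ioo ht.le (fun τ hτ => ?_)
    ((intervalIntegrable_singular (b := 1 - γ) (β := 2 * γ) (by linarith) (by linarith)
      (by linarith) (by linarith) ht).const_mul (2 * c * R * M))).trans ?_
  · have h1 : 0 < t - τ := by linarith [hτ.2]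
    have hτ0 := hτ.1
    rw [norm_sub_rev]
    refine (norm_bilinear_sub_le hB hc hT h1 (hu τ hτ0) (hw τ hτ0) (hM τ hτ0)).trans (le_of_eq ?_)
    have : τ ^ (-(2 * γ)) = τ ^ (-γ) * τ ^ (-γ) := by
      rw [← Real.rpow_add hτ0]; ring_nf
    rw [this]
    ring
  · rw [intervalIntegral.integral_const_mul]
    have h2 := integral_singular_le (b := 1 - γ) (β := 2 * γ) (by linarith) (by linarith)
      (by linarith) (by linarith) ht
    rw [show 1 - (1 - γ) - 2 * γ = -γ by ring] at h2
    have h3 : 0 ≤ t ^ (-γ) := by positivity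
    calc _ ≤ 2 * c * R * M * (betaBound (1 - γ) (2 * γ) * t ^ (-γ)) := by gcongr
      _ = (4 * c * betaBound (1 - γ) (2 * γ) * R) * (M / 2 * t ^ (-γ)) := by ring
      _ ≤ 1 * (M / 2 * t ^ (-γ)) := by gcongr
      _ = _ := one_mul _

theorem intervalIntegrable_mild (hS : IsSmoothing S L) (hB : IsBilinearKernel S γ c B)
    (hc : 0 ≤ c) (hγ0 : 0 < γ) (hγ : γ < 1 / 2) (hT : ∀ f, ‖T f‖ ≤ ‖f‖) {u : ℝ → X}
    (huc : ContinuousOn u (Ioi 0)) (hu : ∀ t, 0 < t → ‖u t‖ ≤ R * t ^ (-γ)) {t : ℝ} (ht : 0 < t) :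
    IntervalIntegrable (fun τ => B (t - τ) (T (u τ)) (u τ)) volume 0 t := by
  have hR0 : 0 ≤ R := by simpa using (norm_nonneg _).trans (hu 1 one_pos)
  exact (hB.isFlow hS hc hR0 (T.continuous.comp_continuousOn huc)
    (fun τ hτ => (hT _).trans (hu τ hτ)) huc hu).intervalIntegrable (by linarith) (by linarith)
    (by linarith) (by linarith) ht

theorem isFlow_mild (hS : IsSmoothing S L) (hB : IsBilinearKernel S γ c B)
    (hc : 0 ≤ c) (hT : ∀ f, ‖T f‖ ≤ ‖f‖) {u : ℝ → X}
    (huc : ContinuousOn u (Ioi 0)) (hu : ∀ t, 0 < t → ‖u t‖ ≤ R * t ^ (-γ)) :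
    IsFlow S (1 - γ) (2 * γ) (c * R * R) (fun τ σ => B σ (T (u τ)) (u τ)) := by
  have hR0 : 0 ≤ R := by simpa using (norm_nonneg _).trans (hu 1 one_pos)
  exact hB.isFlow hS hc hR0 (T.continuous.comp_continuousOn huc)
    (fun τ hτ => (hT _).trans (hu τ hτ)) huc hu

/-- Existence of a small solution of the integral equation. -/
theorem exists_mild [CompleteSpace X] (hS : IsSmoothing S L) (hB : IsBilinearKernel S γ c B)
    (hc : 0 ≤ c) (hγ0 : 0 < γ) (hγ : γ < 1 / 2) (hT : ∀ f, ‖T f‖ ≤ ‖f‖) (hR0 : 0 ≤ R)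
    (hR : 4 * c * betaBound (1 - γ) (2 * γ) * R ≤ 1) (hyc : ContinuousOn y (Ioi 0))
    (hy : ∀ t, 0 < t → ‖y t‖ ≤ R / 2 * t ^ (-γ)) :
    ∃ u : ℝ → X, ContinuousOn u (Ioi 0) ∧ (∀ t, 0 < t → ‖u t‖ ≤ R * t ^ (-γ)) ∧
      ∀ t, 0 < t → u t = mildMap B T y u t := by
  refine exists_fixedPoint_weighted hR0 (mildMap B T y) (fun u huc hu => ?_)
    (fun u v huc hu hvc hv M hM t ht => ?_)
  · have hk := isFlow_mild hS hB hc hT huc hu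
    refine ⟨hyc.sub (hk.isBesovContinuous hS (γ := γ) hγ0.le (by linarith) (by linarith)
      (by linarith) (by linarith)).norm, fun t ht => ?_⟩
    have h1 := hk.norm_duhamel_le (by linarith) (by linarith) (by linarith) (by linarith) ht
    rw [show 1 - (1 - γ) - 2 * γ = -γ by ring] at h1
    have h3 : 0 ≤ t ^ (-γ) := by positivity
    calc _ ≤ R / 2 * t ^ (-γ) + c * R * R * betaBound (1 - γ) (2 * γ) * t ^ (-γ) :=
          (norm_sub_le _ _).trans (add_le_add (hy t ht) h1)
      _ = R / 2 * t ^ (-γ) +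
          (4 * c * betaBound (1 - γ) (2 * γ) * R) * (R / 4 * t ^ (-γ)) := by ring
      _ ≤ R / 2 * t ^ (-γ) + 1 * (R / 4 * t ^ (-γ)) := by gcongr
      _ ≤ _ := by nlinarith [mul_nonneg hR0 h3]
  · exact norm_mildMap_sub_le hB hc hγ0 hγ hT hR hu hv ht
      (intervalIntegrable_mild hS hB hc hγ0 hγ hT huc hu ht)
      (intervalIntegrable_mild hS hB hc hγ0 hγ hT hvc hv ht) hM

/-- Uniqueness of small solutions; the competitors need not be continuous. -/
theorem mild_unique (hB : IsBilinearKernel S γ c B)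
    (hc : 0 ≤ c) (hγ0 : 0 < γ) (hγ : γ < 1 / 2) (hT : ∀ f, ‖T f‖ ≤ ‖f‖)
    (hR : 4 * c * betaBound (1 - γ) (2 * γ) * R ≤ 1) {u w : ℝ → X}
    (hu : ∀ t, 0 < t → ‖u t‖ ≤ R * t ^ (-γ)) (hw : ∀ t, 0 < t → ‖w t‖ ≤ R * t ^ (-γ))
    (hui : ∀ t, 0 < t → IntervalIntegrable (fun τ => B (t - τ) (T (u τ)) (u τ)) volume 0 t)
    (hwi : ∀ t, 0 < t → IntervalIntegrable (fun τ => B (t - τ) (T (w τ)) (w τ)) volume 0 t)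
    (hue : ∀ t, 0 < t → u t = mildMap B T y u t) (hwe : ∀ t, 0 < t → w t = mildMap B T y w t)
    {t : ℝ} (ht : 0 < t) : u t = w t := by
  have h (n : ℕ) : ∀ t, 0 < t → ‖u t - w t‖ ≤ (2 * R * (1 / 2) ^ n) * t ^ (-γ) := by
    induction n with
    | zero =>
      intro t ht
      have := (norm_sub_le (u t) (w t)).trans (add_le_add (hu t ht) (hw t ht))
      simp only [pow_zero, mul_one]
      linarith
    | succ n ih =>
      intro t ht
      rw [hue t ht, hwe t ht]
      refine (norm_mildMap_sub_le hB hc hγ0 hγ hT hR hu hw ht (hui t ht) (hwi t ht) ih).trans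
        (le_of_eq ?_)
      ring
  have hlim : Tendsto (fun n : ℕ => (2 * R * (1 / 2 : ℝ) ^ n) * t ^ (-γ)) atTop (𝓝 0) := by
    have := ((tendsto_pow_atTop_nhds_zero_of_lt_one (r := (1 / 2 : ℝ)) (by norm_num)
      (by norm_num)).const_mul (2 * R)).mul_const (t ^ (-γ))
    simpa using this
  have := ge_of_tendsto' hlim fun n => h n t ht
  exact sub_eq_zero.1 (norm_le_zero_iff.1 this)

end Solve

end Picard

/-! ### Scaling and asymptotics of solutions -/

section Scaling

variable {X : Type*} [NormedAddCommGroup X] [NormedSpace ℝ X]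
variable {S : ℝ → X →L[ℝ] X} {L γ c R : ℝ} {B : ℝ → X →L[ℝ] X →L[ℝ] X} {y : ℝ → X}

/-- Parabolic scaling of Duhamel integrals, by the substitution `τ ↦ l² τ`. -/
theorem duhamel_scale [CompleteSpace X] {l : ℝ} (hl : 0 < l) (D : X →L[ℝ] X) {k k' : ℝ → ℝ → X}
    {t : ℝ} (ht : 0 < t)
    (hi : IntervalIntegrable (fun τ => k τ (l ^ 2 * t - τ)) volume 0 (l ^ 2 * t))
    (h : ∀ τ σ, 0 < τ → 0 < σ → k' τ σ = l ^ 3 • D (k (l ^ 2 * τ) (l ^ 2 * σ))) :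
    duhamel k' t = l • D (duhamel k (l ^ 2 * t)) := by
  have hl2 : l ^ 2 ≠ 0 := by positivity
  rw [duhamel, duhamel, ← ContinuousLinearMap.intervalIntegral_comp_comm _ hi]
  have h1 := intervalIntegral.integral_comp_mul_left (a := 0) (b := t)
    (fun τ => D (k τ (l ^ 2 * t - τ))) hl2
  rw [mul_zero] at h1
  have h2 : ∫ τ in (0 : ℝ)..(l ^ 2 * t), D (k τ (l ^ 2 * t - τ)) =
      l ^ 2 • ∫ τ in (0 : ℝ)..t, D (k (l ^ 2 * τ) (l ^ 2 * t - l ^ 2 * τ)) := by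
    rw [h1, smul_smul, mul_inv_cancel₀ hl2, one_smul]
  rw [h2, smul_smul, ← intervalIntegral.integral_smul]
  refine integral_congr_Ioo ht.le fun τ hτ => ?_
  rw [h τ _ hτ.1 (by linarith [hτ.2]), mul_sub]
  congr 1
  ring

/-- A small solution with data invariant under the parabolic scaling `u ↦ l D_l u(l² ·)` is itself
invariant, by uniqueness. -/
theorem mild_self_similar [CompleteSpace X] (hS : IsSmoothing S L)
    (hB : IsBilinearKernel S γ c B) (hc : 0 ≤ c) (hγ0 : 0 < γ) (hγ : γ < 1 / 2)
    (hR : 4 * c * betaBound (1 - γ) (2 * γ) * R ≤ 1) {D : ℝ → X →L[ℝ] X}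
    (hD : ∀ l, 0 < l → ∀ f, ‖D l f‖ = l ^ (-(1 - 2 * γ)) * ‖f‖)
    (hDB : ∀ l σ, 0 < l → 0 < σ → ∀ f g, D l (B (l ^ 2 * σ) f g) = l⁻¹ • B σ (D l f) (D l g))
    (hy : ∀ l t, 0 < l → 0 < t → y t = l • D l (y (l ^ 2 * t))) {u : ℝ → X}
    (huc : ContinuousOn u (Ioi 0)) (hu : ∀ t, 0 < t → ‖u t‖ ≤ R * t ^ (-γ))
    (hue : ∀ t, 0 < t → u t = mildMap B (ContinuousLinearMap.id ℝ X) y u t)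
    {l t : ℝ} (hl : 0 < l) (ht : 0 < t) : u t = l • D l (u (l ^ 2 * t)) := by
  set w : ℝ → X := fun t => l • D l (u (l ^ 2 * t)) with hwdef
  have hT : ∀ f : X, ‖ContinuousLinearMap.id ℝ X f‖ ≤ ‖f‖ := fun f => le_rfl
  have hpos (t : ℝ) (ht : 0 < t) : 0 < l ^ 2 * t := by positivity
  have hwc : ContinuousOn w (Ioi 0) :=
    ((D l).continuous.comp_continuousOn (huc.comp (by fun_prop) fun t ht => hpos t ht)).const_smul l
  have hw (t : ℝ) (ht : 0 < t) : ‖w t‖ ≤ R * t ^ (-γ) := by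
    rw [hwdef]
    simp only
    rw [norm_smul, Real.norm_of_nonneg hl.le, hD l hl]
    calc _ ≤ l * (l ^ (-(1 - 2 * γ)) * (R * (l ^ 2 * t) ^ (-γ))) := by
          gcongr
          exact hu _ (hpos t ht)
      _ = (l ^ (1 : ℝ) * l ^ (-(1 - 2 * γ)) * l ^ (2 * -γ)) * (R * t ^ (-γ)) := by
          rw [Real.mul_rpow (by positivity) ht.le, ← Real.rpow_natCast l 2,
            ← Real.rpow_mul hl.le, Real.rpow_one]
          push_cast
          ring
      _ = _ := by
          rw [← Real.rpow_add hl, ← Real.rpow_add hl,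
            show 1 + -(1 - 2 * γ) + 2 * -γ = 0 by ring, Real.rpow_zero, one_mul]
  refine mild_unique hB hc hγ0 hγ hT hR hu hw
    (fun t ht => intervalIntegrable_mild hS hB hc hγ0 hγ hT huc hu ht)
    (fun t ht => intervalIntegrable_mild hS hB hc hγ0 hγ hT hwc hw ht) hue (fun t ht => ?_) ht
  have h1 := duhamel_scale (k := fun τ σ => B σ (u τ) (u τ)) (k' := fun τ σ => B σ (w τ) (w τ))
    hl (D l) ht (intervalIntegrable_mild hS hB hc hγ0 hγ hT huc hu (hpos t ht))
    fun τ σ hτ hσ => by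
      rw [hDB l σ hl hσ, hwdef]
      simp only [map_smul, smul_apply, smul_smul]
      congr 1
      field_simp
  simp only [mildMap, ContinuousLinearMap.id_apply]
  rw [h1, hy l t hl ht, hwdef]
  simp only
  rw [hue _ (hpos t ht), mildMap, map_sub, smul_sub]
  rfl

/-- If the operator `T` is asymptotically the identity along the solution `u` of the equation with
nonlinearity `B(u, u)`, then `u` is asymptotic to the solution `v` with nonlinearity `B(T v, v)`. -/
theorem mild_asymptotic [CompleteSpace X] (hS : IsSmoothing S L)
    (hB : IsBilinearKernel S γ c B) (hc : 0 ≤ c) (hγ0 : 0 < γ) (hγ : γ < 1 / 2)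
    (hR : 4 * c * betaBound (1 - γ) (2 * γ) * R ≤ 1) {T : X →L[ℝ] X} (hT : ∀ f, ‖T f‖ ≤ ‖f‖)
    {u v : ℝ → X}
    (huc : ContinuousOn u (Ioi 0)) (hu : ∀ t, 0 < t → ‖u t‖ ≤ R * t ^ (-γ))
    (hue : ∀ t, 0 < t → u t = mildMap B (ContinuousLinearMap.id ℝ X) y u t)
    (hvc : ContinuousOn v (Ioi 0)) (hv : ∀ t, 0 < t → ‖v t‖ ≤ R * t ^ (-γ))
    (hve : ∀ t, 0 < t → v t = mildMap B T y v t)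
    (hTu : Tendsto (fun t => t ^ γ * ‖u t - T (u t)‖) atTop (𝓝 0)) :
    Tendsto (fun t => t ^ γ * ‖u t - v t‖) atTop (𝓝 0) := by
  have hid : ∀ f : X, ‖ContinuousLinearMap.id ℝ X f‖ ≤ ‖f‖ := fun f => le_rfl
  have hR0 : 0 ≤ R := by simpa using (norm_nonneg _).trans (hu 1 one_pos)
  have inv_mul (t : ℝ) (ht : 0 < t) : t ^ γ * t ^ (-γ) = 1 := by
    rw [← Real.rpow_add ht, add_neg_cancel, Real.rpow_zero]
  have hψ (t : ℝ) (ht : 0 < t) : ‖u t - v t‖ = t ^ γ * ‖u t - v t‖ * t ^ (-γ) := by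
    rw [mul_right_comm, inv_mul t ht, one_mul]
  have hδ (t : ℝ) (ht : 0 < t) : ‖u t - T (u t)‖ = t ^ γ * ‖u t - T (u t)‖ * t ^ (-γ) := by
    rw [mul_right_comm, inv_mul t ht, one_mul]
  have hψR (t : ℝ) (ht : 0 < t) : t ^ γ * ‖u t - v t‖ ≤ 2 * R := by
    calc _ ≤ t ^ γ * (R * t ^ (-γ) + R * t ^ (-γ)) := by
          gcongr
          exact (norm_sub_le _ _).trans (add_le_add (hu t ht) (hv t ht))
      _ = 2 * R * (t ^ γ * t ^ (-γ)) := by ring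
      _ = _ := by rw [inv_mul t ht, mul_one]
  have hδR (t : ℝ) (ht : 0 < t) : t ^ γ * ‖u t - T (u t)‖ ≤ 2 * R := by
    calc _ ≤ t ^ γ * (R * t ^ (-γ) + R * t ^ (-γ)) := by
          gcongr
          exact (norm_sub_le _ _).trans (add_le_add (hu t ht) ((hT _).trans (hu t ht)))
      _ = 2 * R * (t ^ γ * t ^ (-γ)) := by ring
      _ = _ := by rw [inv_mul t ht, mul_one]
  -- The extra singularity `τ^{-κ}` pays for the times at which no smallness is available: their
  -- contribution decays like `t^{-κ}` relative to `t^{-γ}`.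
  set κ := (1 - 2 * γ) / 2 with hκ
  have hκ0 : 0 < κ := by rw [hκ]; linarith
  have hκ1 : 2 * γ + κ < 1 := by rw [hκ]; linarith
  -- An eventual bound `m` for `t^γ ‖u(t) - v(t)‖` improves itself to `3m/4`.
  have step (m : ℝ) (hm : 0 < m) (h : ∀ᶠ t in atTop, t ^ γ * ‖u t - v t‖ ≤ m) :
      ∀ᶠ t in atTop, t ^ γ * ‖u t - v t‖ ≤ 3 / 4 * m := by
    obtain ⟨T₁, hT₁⟩ := eventually_atTop.1
      (h.and (hTu.eventually (gt_mem_nhds (show 0 < m / 2 by positivity))))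
    set T₀ := max T₁ 1
    have hT₀ : 0 < T₀ := lt_of_lt_of_le one_pos (le_max_right _ _)
    set K' := betaBound (1 - γ) (2 * γ + κ)
    have hlim : Tendsto (fun t : ℝ => c * R * (6 * R * T₀ ^ κ) * K' * t ^ (-κ)) atTop (𝓝 0) := by
      simpa using (tendsto_rpow_neg_atTop hκ0).const_mul (c * R * (6 * R * T₀ ^ κ) * K')
    filter_upwards [hlim.eventually (gt_mem_nhds (show 0 < m / 8 by positivity)),
      eventually_gt_atTop 0] with t ht1 ht
    have iu : IntervalIntegrable (fun τ => B (t - τ) (u τ) (u τ)) volume 0 t :=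
      intervalIntegrable_mild hS hB hc hγ0 hγ hid huc hu ht
    have e : u t - v t = ∫ τ in (0 : ℝ)..t, (B (t - τ) (T (v τ)) (v τ) - B (t - τ) (u τ) (u τ)) := by
      rw [intervalIntegral.integral_sub
        (intervalIntegrable_mild hS hB hc hγ0 hγ hT hvc hv ht) iu, hue t ht, hve t ht, mildMap,
        mildMap, sub_sub_sub_cancel_left]
      rfl
    have i1 := intervalIntegrable_singular (b := 1 - γ) (β := 2 * γ) (by linarith) (by linarith)
      (by linarith) (by linarith) ht
    have i2 := intervalIntegrable_singular (b := 1 - γ) (β := 2 * γ + κ) (by linarith) (by linarith)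
      (by linarith) (by linarith) ht
    have hb : ‖u t - v t‖ ≤ ∫ τ in (0 : ℝ)..t,
        (c * R * (5 / 2 * m) * ((t - τ) ^ (-(1 - γ)) * τ ^ (-(2 * γ))) +
          c * R * (6 * R * T₀ ^ κ) * ((t - τ) ^ (-(1 - γ)) * τ ^ (-(2 * γ + κ)))) := by
      rw [e]
      refine norm_integral_le_of_Ioo ht.le (fun τ hτ => ?_)
        ((i1.const_mul _).add (i2.const_mul _))
      have hσ : 0 < t - τ := by linarith [hτ.2]
      have hτ0 := hτ.1
      -- The first term is the effect of `T` along `u`, the other two are linear in `u - v`.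
      have e2 : B (t - τ) (u τ) (u τ) - B (t - τ) (T (v τ)) (v τ) =
          B (t - τ) (u τ - T (u τ)) (u τ) + B (t - τ) (T (u τ - v τ)) (u τ) +
            B (t - τ) (T (v τ)) (u τ - v τ) := by
        simp only [map_sub, sub_apply]
        abel
      rw [norm_sub_rev, e2]
      set δ := τ ^ γ * ‖u τ - T (u τ)‖
      set ψ := τ ^ γ * ‖u τ - v τ‖
      have hδ0 : 0 ≤ δ := by positivity
      have hψ0 : 0 ≤ ψ := by positivity
      have e3 : τ ^ (-(2 * γ)) = τ ^ (-γ) * τ ^ (-γ) := by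
        rw [← Real.rpow_add hτ0]; ring_nf
      have e4 : τ ^ (-(2 * γ + κ)) = τ ^ (-(2 * γ)) * τ ^ (-κ) := by
        rw [← Real.rpow_add hτ0]; ring_nf
      have h5 : δ + 2 * ψ ≤ 5 / 2 * m + 6 * R * T₀ ^ κ * τ ^ (-κ) := by
        rcases le_or_gt T₀ τ with hT | hT
        · have := hT₁ τ ((le_max_left _ _).trans hT)
          have h6 : 0 ≤ 6 * R * T₀ ^ κ * τ ^ (-κ) := by positivity
          linarith [this.1, this.2]
        · have h7 : 1 ≤ T₀ ^ κ * τ ^ (-κ) := by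
            rw [Real.rpow_neg hτ0.le, ← div_eq_mul_inv, one_le_div (by positivity)]
            exact Real.rpow_le_rpow hτ0.le hT.le hκ0.le
          have h8 : 6 * R * 1 ≤ 6 * R * (T₀ ^ κ * τ ^ (-κ)) := by gcongr
          linarith [hψR τ hτ0, hδR τ hτ0]
      have hτγ : 0 ≤ τ ^ (-γ) := by positivity
      have b1 := hB.bound (t - τ) hσ (u τ - T (u τ)) (u τ)
      have b2 := hB.bound (t - τ) hσ (T (u τ - v τ)) (u τ)
      have b3 := hB.bound (t - τ) hσ (T (v τ)) (u τ - v τ)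
      set q := c * (t - τ) ^ (-(1 - γ)) with hq
      have hq0 : 0 ≤ q := by positivity
      calc _ ≤ q * ‖u τ - T (u τ)‖ * ‖u τ‖ + q * ‖T (u τ - v τ)‖ * ‖u τ‖ +
            q * ‖T (v τ)‖ * ‖u τ - v τ‖ :=
            (norm_add₃_le).trans (add_le_add (add_le_add b1 b2) b3)
        _ ≤ q * (δ * τ ^ (-γ)) * (R * τ ^ (-γ)) + q * (ψ * τ ^ (-γ)) * (R * τ ^ (-γ)) +
            q * (R * τ ^ (-γ)) * (ψ * τ ^ (-γ)) := by
            have a1 := (hδ τ hτ0).le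
            have a2 := (hψ τ hτ0).le
            have a3 := (hT (u τ - v τ)).trans a2
            have a4 := (hT (v τ)).trans (hv τ hτ0)
            have a5 := hu τ hτ0
            gcongr
        _ = q * R * (δ + 2 * ψ) * τ ^ (-(2 * γ)) := by rw [e3]; ring
        _ ≤ q * R * (5 / 2 * m + 6 * R * T₀ ^ κ * τ ^ (-κ)) * τ ^ (-(2 * γ)) := by gcongr
        _ = _ := by rw [e4, hq]; ring
    have j1 := integral_singular_le (b := 1 - γ) (β := 2 * γ) (by linarith) (by linarith)
      (by linarith) (by linarith) ht
    have j2 := integral_singular_le (b := 1 - γ) (β := 2 * γ + κ) (by linarith) (by linarith)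
      (by linarith) (by linarith) ht
    rw [show 1 - (1 - γ) - 2 * γ = -γ by ring] at j1
    rw [show 1 - (1 - γ) - (2 * γ + κ) = -γ + -κ by ring, Real.rpow_add ht] at j2
    rw [intervalIntegral.integral_add (i1.const_mul _) (i2.const_mul _),
      intervalIntegral.integral_const_mul, intervalIntegral.integral_const_mul] at hb
    calc t ^ γ * ‖u t - v t‖
        ≤ t ^ γ * (c * R * (5 / 2 * m) * (betaBound (1 - γ) (2 * γ) * t ^ (-γ)) +
          c * R * (6 * R * T₀ ^ κ) * (K' * (t ^ (-γ) * t ^ (-κ)))) := by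
          gcongr
          refine hb.trans ?_
          gcongr
      _ = (t ^ γ * t ^ (-γ)) * ((4 * c * betaBound (1 - γ) (2 * γ) * R) * (5 / 8 * m) +
          c * R * (6 * R * T₀ ^ κ) * K' * t ^ (-κ)) := by ring
      _ ≤ 1 * (1 * (5 / 8 * m) + m / 8) := by
          rw [inv_mul t ht]
          gcongr
      _ = _ := by ring
  have iter (n : ℕ) : ∀ᶠ t in atTop, t ^ γ * ‖u t - v t‖ ≤ (3 / 4) ^ n * (2 * R + 1) := by
    induction n with
    | zero =>
      filter_upwards [eventually_gt_atTop 0] with t ht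
      have := hψR t ht
      simp only [pow_zero, one_mul]
      linarith
    | succ n ih =>
      have := step _ (by positivity) ih
      rwa [← mul_assoc, ← pow_succ'] at this
  rw [Metric.tendsto_nhds]
  intro ε hε
  have hlim : Tendsto (fun n : ℕ => (3 / 4 : ℝ) ^ n * (2 * R + 1)) atTop (𝓝 0) := by
    simpa using (tendsto_pow_atTop_nhds_zero_of_lt_one (r := (3 / 4 : ℝ)) (by norm_num)
      (by norm_num)).mul_const (2 * R + 1)
  obtain ⟨n, hn⟩ := (hlim.eventually (gt_mem_nhds hε)).exists
  filter_upwards [iter n, eventually_gt_atTop 0] with t ht ht0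
  rw [Real.dist_0_eq_abs, abs_of_nonneg (by positivity)]
  linarith

end Scaling

universe u

/-! ### Translations and convolutions on a translation-invariant space -/

section Space

variable {E : Type u} [NormedAddCommGroup E] [NormedSpace ℝ E]
variable {ι : E →L[ℝ] Distr} {j : Test →L[ℝ] E}

/-- The evaluation `f ↦ ⟨f, φ⟩` as a continuous linear functional. -/
noncomputable def evalTest (ι : E →L[ℝ] Distr) (φ : Test) : E →L[ℝ] ℝ where
  toFun f := ι f φ
  map_add' f g := by rw [map_add]; rfl
  map_smul' c f := by rw [map_smul]; rfl
  cont := (PointwiseConvergenceCLM.evalCLM (RingHom.id ℝ) ℝ φ).continuous.comp ι.continuous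

theorem evalTest_apply (φ : Test) (f : E) : evalTest ι φ f = ι f φ := rfl

theorem IsFunctional.ext (h : IsFunctional ι j) {f g : E} (hfg : ∀ φ, ι f φ = ι g φ) : f = g :=
  h.injective (DFunLike.ext _ _ hfg)

/-- The translates given by translation invariance depend linearly on `f`, since `ι` is injective. -/
theorem exists_translation (hE : IsFunctionalTranslationInvariant ι j) (y : R3) :
    ∃ T : E →ₗᵢ[ℝ] E, ∀ f, ι (T f) = translate y (ι f) := by
  choose g hg hn using fun f => hE.translation_invariant f y
  refine ⟨⟨⟨⟨g, fun a b => hE.functional.injective ?_⟩, fun c a => hE.functional.injective ?_⟩,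
    hn⟩, hg⟩
  · rw [hg, map_add, map_add, map_add, hg, hg]
  · rw [hg, map_smul, map_smul, RingHom.id_apply, map_smul, hg]

/-- A space of distributions satisfying the standing assumptions: functional, translation
invariant, and containing the test functions as a dense subset. -/
structure IsRegular (ι : E →L[ℝ] Distr) (j : Test →L[ℝ] E) : Prop where
  base : IsFunctionalTranslationInvariant ι j
  dense : DenseRange j

theorem IsRegular.inj (h : IsRegular ι j) {f g : E} (hfg : ι f = ι g) : f = g :=
  h.base.functional.injective hfg

/-- Translation `f ↦ f(· - y)` as an isometry of the space. -/
noncomputable def trans (h : IsRegular ι j) (y : R3) : E →ₗᵢ[ℝ] E :=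
  (exists_translation h.base y).choose

theorem ι_trans (h : IsRegular ι j) (y : R3) (f : E) : ι (trans h y f) = translate y (ι f) :=
  (exists_translation h.base y).choose_spec f

theorem ι_trans_apply (h : IsRegular ι j) (y : R3) (f : E) (φ : Test) :
    ι (trans h y f) φ = ι f (SchwartzMap.compSubConstCLM ℝ (-y) φ) := by
  rw [ι_trans, translate_apply]

theorem trans_test (h : IsRegular ι j) (y : R3) (φ : Test) :
    trans h y (j φ) = j (SchwartzMap.compSubConstCLM ℝ y φ) := by
  refine h.base.functional.ext fun ψ => ?_
  rw [ι_trans_apply, h.base.functional.inclusion, h.base.functional.inclusion]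
  simp only [SchwartzMap.compSubConstCLM_apply, sub_neg_eq_add]
  rw [← integral_sub_right_eq_self _ y]
  simp

theorem trans_trans (h : IsRegular ι j) (y z : R3) (f : E) :
    trans h y (trans h z f) = trans h (y + z) f := by
  refine h.base.functional.ext fun ψ => ?_
  simp only [ι_trans_apply, SchwartzMap.compSubConstCLM_comp]
  rw [neg_add]

theorem trans_zero (h : IsRegular ι j) (f : E) : trans h 0 f = f := by
  refine h.base.functional.ext fun ψ => ?_
  simp [ι_trans_apply]

/-- Translations are strongly continuous, because they are so on test functions. -/
theorem continuous_trans (h : IsRegular ι j) (f : E) : Continuous fun y => trans h y f := by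
  have h0 : Tendsto (fun y => trans h y f) (𝓝 0) (𝓝 f) := by
    rw [Metric.tendsto_nhds]
    intro ε hε
    obtain ⟨φ, hφ⟩ := Metric.denseRange_iff.1 h.dense f (ε / 3) (by positivity)
    have h1 : Tendsto (fun y => trans h y (j φ)) (𝓝 0) (𝓝 (j φ)) := by
      simp only [trans_test]
      exact (j.continuous.tendsto _).comp (tendsto_compSubConst φ)
    filter_upwards [Metric.tendsto_nhds.1 h1 (ε / 3) (by positivity)] with y hy
    have h2 : dist (trans h y f) (trans h y (j φ)) = dist f (j φ) := (trans h y).isometry.dist_eq _ _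
    have h3 := dist_triangle4 (trans h y f) (trans h y (j φ)) (j φ) f
    rw [dist_comm (j φ) f] at h3
    linarith
  rw [continuous_iff_continuousAt]
  intro y₀
  have h1 : Tendsto (fun y => trans h y₀ (trans h (y - y₀) f)) (𝓝 y₀) (𝓝 (trans h y₀ f)) := by
    refine ((trans h y₀).continuous.tendsto f).comp (h0.comp ?_)
    have : Continuous fun y => y - y₀ := by fun_prop
    simpa using this.tendsto y₀
  refine h1.congr fun y => ?_
  rw [trans_trans, add_sub_cancel]

theorem integrable_conv (h : IsRegular ι j) {κ : R3 → ℝ} (hκ : Integrable κ) (f : E) :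
    Integrable fun y => κ y • trans h y f :=
  hκ.smul_bdd ‖f‖ (continuous_trans h f).aestronglyMeasurable
    (.of_forall fun y => ((trans h y).norm_map f).le)

/-- The `L¹` norm of a test function. -/
noncomputable def l1 (κ : Test) : ℝ := ∫ y, ‖κ y‖

theorem l1_nonneg (κ : Test) : 0 ≤ l1 κ := integral_nonneg fun _ => norm_nonneg _

/-- Convolution `f ↦ κ * f = ∫ κ(y) f(· - y) dy` on the space. -/
noncomputable def cv (h : IsRegular ι j) (κ : Test) : E →L[ℝ] E :=
  LinearMap.mkContinuous
    { toFun := fun f => ∫ y, κ y • trans h y f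
      map_add' := fun f g => by
        simp only [map_add, smul_add]
        exact integral_add (integrable_conv h κ.integrable f) (integrable_conv h κ.integrable g)
      map_smul' := fun c f => by
        simp only [map_smul, smul_comm _ c, RingHom.id_apply]
        exact integral_smul c _ }
    (l1 κ) fun f => by
      refine (norm_integral_le_integral_norm _).trans (le_of_eq ?_)
      simp only [norm_smul, LinearIsometry.norm_map]
      exact integral_mul_const _ _

theorem cv_apply (h : IsRegular ι j) (κ : Test) (f : E) : cv h κ f = ∫ y, κ y • trans h y f := rfl

theorem norm_cv_le (h : IsRegular ι j) (κ : Test) (f : E) : ‖cv h κ f‖ ≤ l1 κ * ‖f‖ := by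
  refine (norm_integral_le_integral_norm _).trans (le_of_eq ?_)
  simp only [norm_smul, LinearIsometry.norm_map]
  exact integral_mul_const _ _

theorem ι_cv_apply (h : IsRegular ι j) [CompleteSpace E] (κ : Test) (f : E) (φ : Test) :
    ι (cv h κ f) φ = ∫ y, κ y * ι (trans h y f) φ := by
  have := ((evalTest ι φ).integral_comp_comm (integrable_conv h κ.integrable f)).symm
  rw [cv_apply]
  simpa [evalTest_apply] using this

/-- The Bochner integral defining `cv` is the convolution of distributions. By density it suffices to
check this on test functions, where it is Fubini's theorem. -/
theorem ι_cv (h : IsRegular ι j) [CompleteSpace E] (κ : Test) (f : E) :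
    ι (cv h κ f) = conv κ (ι f) := by
  refine DFunLike.ext _ _ fun φ => ?_
  rw [conv_apply]
  have key : ⇑(evalTest ι φ ∘L cv h κ) = ⇑(evalTest ι (convTest (reflectTest κ) φ)) := by
    refine h.dense.equalizer (ContinuousLinearMap.continuous _) (ContinuousLinearMap.continuous _)
      (funext fun ψ => ?_)
    simp only [Function.comp_apply, ContinuousLinearMap.comp_apply, evalTest_apply]
    rw [ι_cv_apply, h.base.functional.inclusion]
    simp only [convTest_apply, reflectTest_apply, ← integral_const_mul]
    have e1 (x : R3) : ∫ y, ψ x * (κ (-y) * φ (x - y)) = ∫ y, κ y * (ψ x * φ (x + y)) := by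
      rw [← integral_neg_eq_self]
      refine integral_congr_ae (.of_forall fun y => ?_)
      simp only [neg_neg, sub_neg_eq_add]
      ring
    have e2 (y : R3) : κ y * ι (trans h y (j ψ)) φ = ∫ x, κ y * (ψ x * φ (x + y)) := by
      rw [ι_trans_apply, h.base.functional.inclusion, ← integral_const_mul]
      simp
    simp only [e1, e2]
    refine integral_integral_swap ?_
    have := (κ.integrable (μ := volume)).mul_prod (ψ.integrable (μ := volume))
    refine (this.mul_bdd (c := SchwartzMap.seminorm ℝ 0 0 φ)
      (g := fun q : R3 × R3 => φ (q.2 + q.1)) ?_ ?_).congr (.of_forall fun q => ?_)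
    · exact (φ.continuous.comp (by fun_prop)).aestronglyMeasurable
    · exact .of_forall fun q => SchwartzMap.norm_le_seminorm ℝ _ _
    · simp only [Function.uncurry]
      ring
  exact congrFun key f

theorem cv_test (h : IsRegular ι j) [CompleteSpace E] (κ φ : Test) :
    cv h κ (j φ) = j (convTest κ φ) := by
  refine h.base.functional.ext fun ψ => ?_
  rw [ι_cv, conv_apply, h.base.functional.inclusion, h.base.functional.inclusion]
  simp only [convTest_apply, reflectTest_apply, ← integral_const_mul, ← integral_mul_const]
  have e1 (x : R3) : ∫ y, φ x * (κ (-y) * ψ (x - y)) = ∫ z, κ (z - x) * φ x * ψ z := by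
    rw [← integral_sub_left_eq_self _ _ x]
    refine integral_congr_ae (.of_forall fun y => ?_)
    simp only [neg_sub, sub_sub_cancel]
    ring
  have e2 (x : R3) : ∫ y, κ y * φ (x - y) * ψ x = ∫ z, κ (x - z) * φ z * ψ x := by
    rw [← integral_sub_left_eq_self _ _ x]
    refine integral_congr_ae (.of_forall fun y => ?_)
    simp only [sub_sub_cancel]
  simp only [e1, e2]
  refine integral_integral_swap ?_
  have := (φ.integrable (μ := volume)).mul_prod (ψ.integrable (μ := volume))
  refine (this.mul_bdd (c := SchwartzMap.seminorm ℝ 0 0 κ)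
    (g := fun q : R3 × R3 => κ (q.2 - q.1)) ?_ ?_).congr (.of_forall fun q => ?_)
  · exact (κ.continuous.comp (by fun_prop)).aestronglyMeasurable
  · exact .of_forall fun q => SchwartzMap.norm_le_seminorm ℝ _ _
  · simp only [Function.uncurry]
    ring

theorem conv_conv (κ₁ κ₂ : Test) (f : Distr) :
    conv κ₁ (conv κ₂ f) = conv (convTest κ₁ κ₂) f := by
  refine DFunLike.ext _ _ fun φ => ?_
  simp only [conv_apply]
  rw [reflectTest_convTest, ← convTest_assoc, convTest_left_comm]

theorem partialD_conv (i : Fin 3) (κ : Test) (f : Distr) :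
    partialD i (conv κ f) = conv κ (partialD i f) := by
  refine DFunLike.ext _ _ fun φ => ?_
  simp only [conv_apply, partialD_apply]
  rw [pd_convTest_right]

theorem partialD_conv_left (i : Fin 3) (κ : Test) (f : Distr) :
    partialD i (conv κ f) = conv (pd i κ) f := by
  refine DFunLike.ext _ _ fun φ => ?_
  simp only [conv_apply, partialD_apply]
  rw [← pd_convTest_right, pd_convTest_left, pd_reflectTest, convTest_comm, map_neg, map_neg,
    neg_neg, convTest_comm]

theorem partialD_comm (i k : Fin 3) (f : Distr) :
    partialD i (partialD k f) = partialD k (partialD i f) := by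
  refine DFunLike.ext _ _ fun φ => ?_
  simp only [partialD_apply]
  rw [pd_comm]

theorem heat_heat {s t : ℝ} (hs : 0 < s) (ht : 0 < t) (f : Distr) :
    heat s (heat t f) = heat (s + t) f := by
  rw [heat, heat, conv_conv, convTest_heatKernel hs ht, heat]

theorem cv_cv (h : IsRegular ι j) [CompleteSpace E] (κ₁ κ₂ : Test) (f : E) :
    cv h κ₁ (cv h κ₂ f) = cv h (convTest κ₁ κ₂) f :=
  h.inj (by rw [ι_cv, ι_cv, ι_cv, conv_conv])

theorem cv_sum (h : IsRegular ι j) [CompleteSpace E] {α : Type*} (s : Finset α) (κ : α → Test)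
    (f : E) : cv h (∑ a ∈ s, κ a) f = ∑ a ∈ s, cv h (κ a) f := by
  simp only [cv_apply, sum_apply, Finset.sum_smul]
  exact integral_finsetSum _ fun a _ => integrable_conv h (κ a).integrable f

/-! ### Rescaled kernels -/

theorem pd_rescaled (i : Fin 3) (κ : Test) {ε : ℝ} (hε : 0 < ε) :
    pd i (rescaled κ ε) = ε⁻¹ • rescaled (pd i κ) ε := by
  rw [rescaled, map_smul, pd_dilateTest i (by positivity), rescaled, smul_comm]

theorem integral_rescaled_smul {F : Type*} [NormedAddCommGroup F] [NormedSpace ℝ F] (κ : Test)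
    {ε : ℝ} (hε : 0 < ε) (g : R3 → F) :
    ∫ y, rescaled κ ε y • g y = ∫ y, κ y • g (ε • y) := by
  have e : (fun y => rescaled κ ε y • g y) =
      fun y => (ε ^ 3)⁻¹ • (fun z => κ z • g (ε • z)) (ε⁻¹ • y) := by
    ext y
    rw [rescaled, smul_apply, dilateTest_apply (by positivity)]
    simp only [smul_smul, mul_inv_cancel₀ hε.ne', one_smul, smul_eq_mul]
  rw [e, integral_smul, Measure.integral_comp_smul volume (fun z => κ z • g (ε • z)) ε⁻¹]
  simp only [finrank_euclideanSpace, Fintype.card_fin, inv_pow, inv_inv, smul_smul,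
    abs_of_pos (pow_pos hε 3)]
  rw [inv_mul_cancel₀ (by positivity), one_smul]

theorem l1_rescaled (κ : Test) {ε : ℝ} (hε : 0 < ε) : l1 (rescaled κ ε) = l1 κ := by
  have e : (fun y => ‖rescaled κ ε y‖) =
      fun y => (ε ^ 3)⁻¹ * (fun z => ‖κ z‖) (ε⁻¹ • y) := by
    ext y
    rw [rescaled, smul_apply, dilateTest_apply (by positivity), norm_smul,
      Real.norm_of_nonneg (by positivity)]
  rw [l1, e, integral_const_mul, Measure.integral_comp_smul volume (fun z => ‖κ z‖) ε⁻¹]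
  simp only [finrank_euclideanSpace, Fintype.card_fin, inv_pow, inv_inv, smul_eq_mul,
    abs_of_pos (pow_pos hε 3)]
  rw [← mul_assoc, inv_mul_cancel₀ (by positivity), one_mul, l1]

theorem l1_smul (κ : Test) (a : ℝ) : l1 (a • κ) = |a| * l1 κ := by
  simp only [l1, smul_apply, norm_smul, integral_const_mul, Real.norm_eq_abs]

/-- Approximate identities converge strongly. -/
theorem tendsto_cv_rescaled (h : IsRegular ι j) [CompleteSpace E] {κ : Test} (hκ : ∫ y, κ y = 1)
    (f : E) : Tendsto (fun ε => cv h (rescaled κ ε) f) (𝓝[>] 0) (𝓝 f) := by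
  have e1 : ∫ y, κ y • trans h ((0 : ℝ) • y) f = f := by
    simp only [zero_smul, trans_zero]
    rw [integral_smul_const, hκ, one_smul]
  have key : Tendsto (fun ε : ℝ => ∫ y, κ y • trans h (ε • y) f) (𝓝[>] 0)
      (𝓝 (∫ y, κ y • trans h ((0 : ℝ) • y) f)) := by
    refine tendsto_integral_filter_of_dominated_convergence (fun y => ‖κ y‖ * ‖f‖)
      (.of_forall fun ε => ?_) (.of_forall fun ε => .of_forall fun y => ?_)
      (κ.integrable.norm.mul_const _) (.of_forall fun y => ?_)
    · exact (κ.continuous.smul ((continuous_trans h f).comp (by fun_prop))).aestronglyMeasurable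
    · rw [norm_smul, LinearIsometry.norm_map]
    · have : Continuous fun ε : ℝ => κ y • trans h (ε • y) f :=
        continuous_const.smul ((continuous_trans h f).comp (by fun_prop))
      exact (this.tendsto 0).mono_left nhdsWithin_le_nhds
  rw [e1] at key
  refine key.congr' ?_
  filter_upwards [self_mem_nhdsWithin] with ε hε
  rw [cv_apply, integral_rescaled_smul κ hε]

end Space

/-! ### Dilations of the space -/

section Space

variable {E : Type u} [NormedAddCommGroup E] [NormedSpace ℝ E]
variable {ι : E →L[ℝ] Distr} {j : Test →L[ℝ] E} {k : ℝ}

theorem ι_test_dilate (h : IsRegular ι j) {l : ℝ} (hl : 0 < l) (φ : Test) :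
    ι (j (dilateTest l φ)) = dilate l (ι (j φ)) := by
  refine DFunLike.ext _ _ fun ψ => ?_
  rw [dilate_apply, h.base.functional.inclusion, h.base.functional.inclusion]
  simp only [dilateTest_apply hl, dilateTest_apply (inv_pos.2 hl)]
  have := Measure.integral_comp_smul volume (fun x : R3 => φ x * ψ (l⁻¹ • x)) l
  simp only [smul_smul, inv_mul_cancel₀ hl.ne', one_smul, finrank_euclideanSpace, Fintype.card_fin,
    smul_eq_mul, abs_of_pos (inv_pos.2 (pow_pos hl 3))] at this
  exact this

/-- The scaling degree only concerns dilates that belong to the space; that they all do follows from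
completeness and the density of test functions. -/
theorem exists_dilation (h : IsRegular ι j) [CompleteSpace E] (hk : HasScalingDegree ι k)
    {l : ℝ} (hl : 0 < l) : ∃ D : E →L[ℝ] E, ∀ f, ι (D f) = dilate l (ι f) := by
  -- The set of `f` with a dilation in `E` is closed and contains the test functions.
  have main (f : E) : ∃ g, ι g = dilate l (ι f) := by
    obtain ⟨x, hx, hxf⟩ := mem_closure_iff_seq_limit.1 (h.dense f)
    choose φ hφ using hx
    set g : ℕ → E := fun n => j (dilateTest l (φ n))
    have hg (n : ℕ) : ι (g n) = dilate l (ι (x n)) := by rw [← hφ n]; exact ι_test_dilate h hl _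
    have hn (m n : ℕ) : ‖g m - g n‖ = l ^ k * ‖x m - x n‖ :=
      hk _ _ l hl (by rw [map_sub, hg, hg, map_sub, map_sub])
    have hc : CauchySeq g := by
      have hx := hxf.cauchySeq
      rw [Metric.cauchySeq_iff] at hx ⊢
      intro ε hε
      obtain ⟨N, hN⟩ := hx (ε / l ^ k) (by positivity)
      refine ⟨N, fun m hm n hn' => ?_⟩
      have := hN m hm n hn'
      rw [dist_eq_norm] at this ⊢
      rw [hn]
      rwa [lt_div_iff₀ (by positivity), mul_comm] at this
    obtain ⟨g₀, hg₀⟩ := cauchySeq_tendsto_of_complete hc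
    refine ⟨g₀, DFunLike.ext _ _ fun ψ => ?_⟩
    have h1 := ((evalTest ι ψ).continuous.tendsto g₀).comp hg₀
    have h2 := (((evalTest ι (dilateTest l⁻¹ ψ)).continuous.tendsto f).comp hxf).const_mul (l ^ 3)⁻¹
    rw [dilate_apply]
    refine tendsto_nhds_unique h1 (h2.congr fun n => ?_)
    simp only [Function.comp_apply, evalTest_apply, hg, dilate_apply]
  choose g hg using main
  refine ⟨LinearMap.mkContinuous ⟨⟨g, fun a b => h.inj ?_⟩, fun c a => h.inj ?_⟩ (l ^ k)
    fun f => ?_, hg⟩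
  · rw [hg, map_add, map_add, map_add, hg, hg]
  · rw [hg, map_smul, map_smul, RingHom.id_apply, map_smul, hg]
  · exact (hk f (g f) l hl (hg f)).le

/-- The dilation `f ↦ f(l ·)` of the space, for `l > 0` (and `0` otherwise). -/
noncomputable def dil (h : IsRegular ι j) [CompleteSpace E] (hk : HasScalingDegree ι k) (l : ℝ) :
    E →L[ℝ] E :=
  if hl : 0 < l then (exists_dilation h hk hl).choose else 0

theorem ι_dil (h : IsRegular ι j) [CompleteSpace E] (hk : HasScalingDegree ι k) {l : ℝ}
    (hl : 0 < l) (f : E) : ι (dil h hk l f) = dilate l (ι f) := by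
  rw [dil, dif_pos hl]
  exact (exists_dilation h hk hl).choose_spec f

theorem norm_dil (h : IsRegular ι j) [CompleteSpace E] (hk : HasScalingDegree ι k) {l : ℝ}
    (hl : 0 < l) (f : E) : ‖dil h hk l f‖ = l ^ k * ‖f‖ :=
  hk _ _ l hl (ι_dil h hk hl f)

theorem dilate_dilate {l m : ℝ} (hl : 0 < l) (hm : 0 < m) (f : Distr) :
    dilate l (dilate m f) = dilate (l * m) f := by
  refine DFunLike.ext _ _ fun φ => ?_
  simp only [dilate_apply]
  rw [dilateTest_dilateTest (by positivity) (by positivity), ← mul_inv, ← mul_assoc, ← mul_inv,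
    ← mul_pow]

theorem dilate_one (f : Distr) : dilate 1 f = f := by
  refine DFunLike.ext _ _ fun φ => ?_
  simp [dilate_apply, dilateTest_one]

theorem partialD_dilate (i : Fin 3) {l : ℝ} (hl : 0 < l) (f : Distr) :
    partialD i (dilate l f) = l • dilate l (partialD i f) := by
  refine DFunLike.ext _ _ fun φ => ?_
  rw [smul_apply]
  simp only [dilate_apply, partialD_apply]
  rw [pd_dilateTest i (by positivity), map_smul]
  simp only [smul_eq_mul]
  field_simp

/-- `κ * f(l ·) = (κ_l * f)(l ·)` with `κ_l = l⁻³ κ(· / l)`. -/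
theorem dilate_conv {l : ℝ} (hl : 0 < l) (κ : Test) (f : Distr) :
    dilate l (conv (rescaled κ l) f) = conv κ (dilate l f) := by
  refine DFunLike.ext _ _ fun φ => ?_
  simp only [conv_apply, dilate_apply]
  have e : convTest (reflectTest (rescaled κ l)) (dilateTest l⁻¹ φ) =
      dilateTest l⁻¹ (convTest (reflectTest κ) φ) := by
    rw [dilateTest_convTest (by positivity), rescaled, map_smul,
      reflectTest_dilateTest (by positivity), convTest_comm, map_smul, convTest_comm, inv_pow]
  rw [e]

theorem heat_dilate {l t : ℝ} (hl : 0 < l) (ht : 0 < t) (f : Distr) :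
    heat t (dilate l f) = dilate l (heat (l ^ 2 * t) f) := by
  have hlt : 0 < l ^ 2 * t := by positivity
  have e : heatKernel (l ^ 2 * t) = rescaled (heatKernel t) l := by
    have h1 := dilateTest_heatKernel hl ht
    have h2 := congrArg (dilateTest l⁻¹) h1
    rw [dilateTest_dilateTest (by positivity) hl, mul_inv_cancel₀ hl.ne', dilateTest_one,
      map_smul] at h2
    exact h2
  rw [heat, heat, e, dilate_conv hl]

/-- Dilations are strongly continuous, because they are so on test functions. -/
theorem continuousOn_dil (h : IsRegular ι j) [CompleteSpace E] (hk : HasScalingDegree ι k) (f : E) :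
    ContinuousOn (fun l => dil h hk l f) (Ioi 0) := by
  have h0 : Tendsto (fun l => dil h hk l f) (𝓝 1) (𝓝 f) := by
    rw [Metric.tendsto_nhds]
    intro ε hε
    obtain ⟨φ, hφ⟩ := Metric.denseRange_iff.1 h.dense f (ε / 4) (by positivity)
    have h1 : Tendsto (fun l => j (dilateTest l φ)) (𝓝 1) (𝓝 (j φ)) :=
      (j.continuous.tendsto _).comp (tendsto_dilateTest φ)
    have h2 : Tendsto (fun l : ℝ => l ^ k) (𝓝 1) (𝓝 1) := by
      have := (Real.continuousAt_rpow_const 1 k (Or.inl one_ne_zero)).tendsto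
      rwa [Real.one_rpow] at this
    filter_upwards [Metric.tendsto_nhds.1 h1 (ε / 4) (by positivity),
      h2.eventually (gt_mem_nhds (show (1 : ℝ) < 2 by norm_num)),
      lt_mem_nhds (show (0 : ℝ) < 1 by norm_num)] with l hy hl2 hl
    have e : dil h hk l (j φ) = j (dilateTest l φ) :=
      h.inj (by rw [ι_dil h hk hl, ι_test_dilate h hl])
    have h2 : dist (dil h hk l f) (j (dilateTest l φ)) ≤ 2 * dist f (j φ) := by
      rw [← e, dist_eq_norm, ← map_sub, norm_dil h hk hl, dist_eq_norm]
      gcongr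
    have h3 := dist_triangle4 (dil h hk l f) (j (dilateTest l φ)) (j φ) f
    rw [dist_comm (j φ) f] at h3
    linarith
  intro l₀ hl₀
  have hl₀ : 0 < l₀ := hl₀
  refine ContinuousAt.continuousWithinAt ?_
  have h1 : Tendsto (fun l => dil h hk l₀ (dil h hk (l / l₀) f)) (𝓝 l₀) (𝓝 (dil h hk l₀ f)) := by
    refine ((dil h hk l₀).continuous.tendsto f).comp (h0.comp ?_)
    have : Continuous fun l => l / l₀ := by fun_prop
    simpa [div_self hl₀.ne'] using this.tendsto l₀
  refine h1.congr' ?_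
  filter_upwards [lt_mem_nhds hl₀] with l hl
  refine h.inj ?_
  rw [ι_dil h hk hl₀, ι_dil h hk (by positivity), ι_dil h hk hl,
    dilate_dilate hl₀ (by positivity), mul_div_cancel₀ _ hl₀.ne']

/-! ### The heat semigroup on the space -/

theorem ι_cv_heat (h : IsRegular ι j) [CompleteSpace E] (t : ℝ) (f : E) :
    ι (cv h (heatKernel t) f) = heat t (ι f) := ι_cv h _ f

theorem l1_heatKernel {t : ℝ} (ht : 0 < t) : l1 (heatKernel t) = 1 := by
  simp only [l1, Real.norm_of_nonneg (heatKernel_nonneg t _), integral_heatKernel ht]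

theorem hasDerivAt_cv_heat (h : IsRegular ι j) [CompleteSpace E] {t : ℝ} (ht : 0 < t) (f : E) :
    HasDerivAt (fun s => cv h (heatKernel s) f) (cv h (lapHeat t) f) t := by
  obtain ⟨C, hC⟩ := lapHeat_bound ht
  simp only [cv_apply]
  refine (hasDerivAt_integral_of_dominated_loc_of_deriv_le
    (F := fun s y => heatKernel s y • trans h y f) (F' := fun s y => lapHeat s y • trans h y f)
    (bound := fun y => C * (heatKernel (3 / 2 * t) y + ‖y‖ ^ 2 * heatKernel (3 / 2 * t) y) * ‖f‖)
    (Ioo_mem_nhds (show t / 2 < t by linarith) (show t < 3 / 2 * t by linarith)) ?_ ?_ ?_ ?_ ?_ ?_).2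
  · exact .of_forall fun s => (integrable_conv h (heatKernel s).integrable f).1
  · exact integrable_conv h (heatKernel t).integrable f
  · exact (integrable_conv h (lapHeat t).integrable f).1
  · refine .of_forall fun y s hs => ?_
    rw [norm_smul, LinearIsometry.norm_map]
    gcongr
    exact hC s hs y
  · have h1 := (heatKernel (3 / 2 * t)).integrable (μ := volume)
    have h2 : Integrable (fun y => ‖y‖ ^ 2 * heatKernel (3 / 2 * t) y) := by
      refine ((heatKernel (3 / 2 * t)).integrable_pow_mul volume 2).congr (.of_forall fun y => ?_)
      simp only [Real.norm_of_nonneg (heatKernel_nonneg _ y)]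
    exact ((h1.add h2).const_mul C).mul_const _
  · refine .of_forall fun y s hs => ?_
    exact (hasDerivAt_heatKernel (by linarith [hs.1]) y).smul_const _

/-- A constant in the bound `‖ΔS(t)‖ ≤ C / t`. -/
noncomputable def lapConst : ℝ := ∑ i, l1 (pd i (pd i (heatKernel 1)))

theorem lapConst_nonneg : 0 ≤ lapConst := Finset.sum_nonneg fun _ _ => l1_nonneg _

theorem norm_cv_lapHeat_le (h : IsRegular ι j) [CompleteSpace E] {t : ℝ} (ht : 0 < t) (f : E) :
    ‖cv h (lapHeat t) f‖ ≤ lapConst / t * ‖f‖ := by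
  have hs : 0 < √t := Real.sqrt_pos.2 ht
  rw [lapHeat, cv_sum]
  refine (norm_sum_le _ _).trans ?_
  rw [lapConst, Finset.sum_div, Finset.sum_mul]
  refine Finset.sum_le_sum fun i _ => (norm_cv_le h _ f).trans (le_of_eq ?_)
  rw [heatKernel_eq_rescaled ht, pd_rescaled i _ hs, map_smul, pd_rescaled i _ hs, smul_smul,
    l1_smul, l1_rescaled _ hs, ← mul_inv, Real.mul_self_sqrt ht.le, abs_of_pos (inv_pos.2 ht)]
  ring

theorem isSmoothing_heat (h : IsRegular ι j) [CompleteSpace E] :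
    IsSmoothing (fun t => cv h (heatKernel t)) (2 + lapConst) where
  two_le := by linarith [lapConst_nonneg]
  contr t ht f := by
    simpa [l1_heatKernel ht] using norm_cv_le h (heatKernel t) f
  semigroup s t hs ht f := by rw [cv_cv, convTest_heatKernel hs ht]
  lip s t hs hst f := by
    have h1 := Convex.norm_image_sub_le_of_norm_hasDerivWithin_le
      (f := fun s => cv h (heatKernel s) f) (f' := fun s => cv h (lapHeat s) f) (s := Icc s t)
      (x := s) (y := t) (C := lapConst / s * ‖f‖)
      (fun x hx => (hasDerivAt_cv_heat h (hs.trans_le hx.1) f).hasDerivWithinAt)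
      (fun x hx => (norm_cv_lapHeat_le h (hs.trans_le hx.1) f).trans ?_) (convex_Icc s t)
      (left_mem_Icc.2 hst) (right_mem_Icc.2 hst)
    · have h0 := lapConst_nonneg
      have h2 : 0 ≤ t - s := by linarith
      rw [Real.norm_of_nonneg h2] at h1
      calc _ ≤ lapConst / s * ‖f‖ * (t - s) := h1
        _ = lapConst * ((t - s) / s) * ‖f‖ := by ring
        _ ≤ _ := by
          gcongr
          linarith
    · have h0 := lapConst_nonneg
      gcongr
      exact hx.1

/-- If the norm has scaling degree greater than `-3`, the heat semigroup tends strongly to zero. -/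
theorem tendsto_cv_heat_atTop (h : IsRegular ι j) [CompleteSpace E] (hk : HasScalingDegree ι k)
    (hk3 : -3 < k) (f : E) : Tendsto (fun t => cv h (heatKernel t) f) atTop (𝓝 0) := by
  have h1 (φ : Test) : Tendsto (fun t => cv h (heatKernel t) (j φ)) atTop (𝓝 0) := by
    have hlim : Tendsto (fun t : ℝ => t ^ (-((3 + k) / 2)) * (l1 φ * ‖j (heatKernel 1)‖)) atTop
        (𝓝 0) := by
      simpa using (tendsto_rpow_neg_atTop (show 0 < (3 + k) / 2 by linarith)).mul_const
        (l1 φ * ‖j (heatKernel 1)‖)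
    refine squeeze_zero_norm' ?_ hlim
    filter_upwards [eventually_gt_atTop 0] with t ht
    have hs : 0 < √t := Real.sqrt_pos.2 ht
    -- For a test function, `S(t) φ = φ * G_t`, and `‖G_t‖` is known by scaling.
    rw [cv_test, convTest_comm, ← cv_test h]
    have e : j (heatKernel t) = (√t ^ 3)⁻¹ • dil h hk (√t)⁻¹ (j (heatKernel 1)) := by
      refine h.inj ?_
      rw [heatKernel_eq_rescaled ht, rescaled, map_smul, map_smul, map_smul, ι_dil h hk
        (by positivity), ι_test_dilate h (by positivity)]
    have e2 : ‖j (heatKernel t)‖ = t ^ (-((3 + k) / 2)) * ‖j (heatKernel 1)‖ := by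
      rw [e, norm_smul, norm_dil h hk (by positivity), ← mul_assoc]
      congr 1
      rw [Real.norm_of_nonneg (by positivity), Real.sqrt_eq_rpow, ← Real.rpow_natCast,
        ← Real.rpow_mul ht.le, ← Real.rpow_neg ht.le, ← Real.rpow_neg ht.le, ← Real.rpow_mul ht.le,
        ← Real.rpow_add ht]
      congr 1
      push_cast
      ring
    calc _ ≤ l1 φ * ‖j (heatKernel t)‖ := norm_cv_le h _ _
      _ = _ := by rw [e2]; ring
  rw [Metric.tendsto_nhds]
  intro ε hε
  obtain ⟨φ, hφ⟩ := Metric.denseRange_iff.1 h.dense f (ε / 2) (by positivity)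
  filter_upwards [Metric.tendsto_nhds.1 (h1 φ) (ε / 2) (by positivity), eventually_gt_atTop 0]
    with t ht ht0
  have h3 := (isSmoothing_heat h).contr t ht0 (f - j φ)
  rw [map_sub, ← dist_eq_norm, ← dist_eq_norm] at h3
  have := dist_triangle (cv h (heatKernel t) f) (cv h (heatKernel t) (j φ)) 0
  linarith

end Space

/-! ### The Leray projection -/

/-- The Leray projection commutes with operators that commute with derivatives up to a factor. -/
theorem IsLeray.map {f w : Fin 3 → Distr} (h : IsLeray f w) (T : Distr →L[ℝ] Distr) (c : ℝ)
    (hT : ∀ i g, partialD i (T g) = c • T (partialD i g)) :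
    IsLeray (fun i => T (f i)) (fun i => T (w i)) := by
  refine ⟨?_, fun i k => ?_⟩
  · simp only [hT, ← Finset.smul_sum, ← map_sum, h.1, map_zero, smul_zero]
  · rw [← map_sub, ← map_sub, hT, hT, h.2 i k]

theorem IsLeray.add {f w f' w' : Fin 3 → Distr} (h : IsLeray f w) (h' : IsLeray f' w') :
    IsLeray (fun i => f i + f' i) (fun i => w i + w' i) := by
  refine ⟨?_, fun i k => ?_⟩
  · simp only [map_add, Finset.sum_add_distrib, h.1, h'.1, add_zero]
  · rw [add_sub_add_comm, add_sub_add_comm, map_add, map_add, h.2 i k, h'.2 i k]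

theorem IsLeray.smul {f w : Fin 3 → Distr} (h : IsLeray f w) (c : ℝ) :
    IsLeray (fun i => c • f i) (fun i => c • w i) :=
  h.map (c • ContinuousLinearMap.id ℝ Distr) 1 fun i g => by simp

theorem IsLeray.conv {f w : Fin 3 → Distr} (h : IsLeray f w) (κ : Test) :
    IsLeray (fun i => AbstractNS.conv κ (f i)) (fun i => AbstractNS.conv κ (w i)) :=
  h.map _ 1 fun i g => by rw [partialD_conv, one_smul]

theorem IsLeray.dilate {f w : Fin 3 → Distr} (h : IsLeray f w) {l : ℝ} (hl : 0 < l) :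
    IsLeray (fun i => AbstractNS.dilate l (f i)) (fun i => AbstractNS.dilate l (w i)) :=
  h.map _ l fun i g => partialD_dilate i hl g

theorem conv_sum {α : Type*} (s : Finset α) (κ : α → Test) (f : Distr) :
    conv (∑ a ∈ s, κ a) f = ∑ a ∈ s, conv (κ a) f := by
  refine DFunLike.ext _ _ fun φ => ?_
  have h1 : convTest (reflectTest (∑ a ∈ s, κ a)) φ = ∑ a ∈ s, convTest (reflectTest (κ a)) φ := by
    rw [convTest_comm, map_sum, map_sum]
    exact Finset.sum_congr rfl fun a _ => convTest_comm _ _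
  rw [conv_apply, h1, map_sum]
  simp only [sum_apply, conv_apply]

section Unique

variable {E : Type u} [NormedAddCommGroup E] [NormedSpace ℝ E] {ι : E →L[ℝ] Distr}
  {j : Test →L[ℝ] E} {k : ℝ}

/-- A harmonic element of the space vanishes: its heat orbit is constant, and tends to zero. -/
theorem eq_zero_of_laplacian (h : IsRegular ι j) [CompleteSpace E] (hk : HasScalingDegree ι k)
    (hk3 : -3 < k) {f : E} (hf : ∑ i, partialD i (partialD i (ι f)) = 0) : f = 0 := by
  have hlap (t : ℝ) : cv h (lapHeat t) f = 0 := by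
    refine h.inj ?_
    rw [ι_cv, lapHeat, conv_sum, map_zero]
    simp only [← partialD_conv_left, partialD_conv]
    rw [← map_sum, hf, map_zero]
  have hconst (s t : ℝ) (hs : 0 < s) (ht : 0 < t) :
      cv h (heatKernel s) f = cv h (heatKernel t) f := by
    refine isOpen_Ioi.is_const_of_deriv_eq_zero (s := Ioi (0 : ℝ))
      (f := fun s => cv h (heatKernel s) f) isPreconnected_Ioi
      (fun x hx => (hasDerivAt_cv_heat h hx f).differentiableAt.differentiableWithinAt)
      (fun x hx => ?_) hs ht
    rw [(hasDerivAt_cv_heat h hx f).deriv, hlap, Pi.zero_apply]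
  have hzero (s : ℝ) (hs : 0 < s) : cv h (heatKernel s) f = 0 := by
    refine tendsto_nhds_unique (f := fun t : ℝ => cv h (heatKernel s) f) (l := atTop)
      tendsto_const_nhds ((tendsto_cv_heat_atTop h hk hk3 f).congr' ?_)
    filter_upwards [eventually_gt_atTop 0] with t ht using hconst t s ht hs
  refine tendsto_nhds_unique (tendsto_cv_rescaled h (integral_heatKernel one_pos) f)
    (tendsto_const_nhds.congr' ?_)
  filter_upwards [self_mem_nhdsWithin] with ε hε
  have hε : 0 < ε := hε
  have := hzero (ε ^ 2) (by positivity)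
  rw [heatKernel_eq_rescaled (by positivity), Real.sqrt_sq hε.le] at this
  exact this.symm

/-- The Leray projection takes at most one value in the space: the difference of two values is
divergence free and curl free, hence harmonic. -/
theorem leray_unique (h : IsRegular ι j) [CompleteSpace E] (hk : HasScalingDegree ι k)
    (hk3 : -3 < k) {f : Fin 3 → Distr} {w w' : Fin 3 → E} (hw : IsLeray f fun i => ι (w i))
    (hw' : IsLeray f fun i => ι (w' i)) : w = w' := by
  funext m
  refine sub_eq_zero.1 (eq_zero_of_laplacian h hk hk3 ?_)
  have hcurl (i m : Fin 3) :
      partialD i (ι (w m - w' m)) = partialD m (ι (w i - w' i)) := by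
    have h1 := hw.2 i m
    have h2 := hw'.2 i m
    simp only [map_sub] at h1 h2 ⊢
    linear_combination (norm := module) h2 - h1
  have hdiv : ∑ i, partialD i (ι (w i - w' i)) = 0 := by
    simp only [map_sub, Finset.sum_sub_distrib, hw.1, hw'.1, sub_zero]
  calc ∑ i, partialD i (partialD i (ι (w m - w' m)))
      = ∑ i, partialD m (partialD i (ι (w i - w' i))) :=
        Finset.sum_congr rfl fun i _ => by rw [hcurl i m, partialD_comm]
    _ = 0 := by rw [← map_sum, hdiv, map_zero]

end Unique

/-! ### Operators on vectors -/

section Vector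

variable {E : Type*} [NormedAddCommGroup E] [NormedSpace ℝ E]

/-- The componentwise action of an operator on vectors. -/
noncomputable def vec (T : E →L[ℝ] E) : (Fin 3 → E) →L[ℝ] (Fin 3 → E) :=
  ContinuousLinearMap.pi fun i => T ∘L ContinuousLinearMap.proj i

theorem vec_apply (T : E →L[ℝ] E) (f : Fin 3 → E) (i : Fin 3) : vec T f i = T (f i) := rfl

theorem norm_vec_le {T : E →L[ℝ] E} {c : ℝ} (hc : 0 ≤ c) (hT : ∀ f, ‖T f‖ ≤ c * ‖f‖)
    (f : Fin 3 → E) : ‖vec T f‖ ≤ c * ‖f‖ := by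
  refine (pi_norm_le_iff_of_nonneg (by positivity)).2 fun i => (hT _).trans ?_
  gcongr
  exact norm_le_pi_norm f i

theorem norm_vec_eq {T : E →L[ℝ] E} {c : ℝ} (hc : 0 < c) (hT : ∀ f, ‖T f‖ = c * ‖f‖)
    (f : Fin 3 → E) : ‖vec T f‖ = c * ‖f‖ := by
  refine le_antisymm (norm_vec_le hc.le (fun f => (hT f).le) f) ?_
  rw [← le_div_iff₀' hc]
  refine (pi_norm_le_iff_of_nonneg (by positivity)).2 fun i => ?_
  rw [le_div_iff₀' hc, ← hT]
  exact norm_le_pi_norm (vec T f) i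

theorem IsSmoothing.vec {S : ℝ → E →L[ℝ] E} {L : ℝ} (hS : IsSmoothing S L) :
    IsSmoothing (fun t => AbstractNS.vec (S t)) L where
  two_le := hS.two_le
  contr t ht f := by
    simpa using norm_vec_le (T := S t) zero_le_one (fun f => by simpa using hS.contr t ht f) f
  semigroup s t hs ht f := funext fun i => hS.semigroup s t hs ht (f i)
  lip s t hs hst f := by
    have hL : 0 ≤ L := by linarith [hS.two_le]
    have h0 : 0 ≤ (t - s) / s := div_nonneg (by linarith) hs.le
    refine (pi_norm_le_iff_of_nonneg (by positivity)).2 fun i => ?_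
    refine (hS.lip s t hs hst (f i)).trans ?_
    gcongr
    exact norm_le_pi_norm f i

end Vector

/-! ### The forcing term -/

/-- The third derivative `∂ᵢ∂ₗ∂ₖ` of the heat kernel. -/
noncomputable def thirdD (i l k : Fin 3) (s : ℝ) : Test := pd i (pd l (pd k (heatKernel s)))

theorem l1_pd_heatKernel (k : Fin 3) {s : ℝ} (hs : 0 < s) :
    l1 (pd k (heatKernel s)) = s ^ (-(1 / 2) : ℝ) * l1 (pd k (heatKernel 1)) := by
  have h1 : 0 < √s := Real.sqrt_pos.2 hs
  rw [heatKernel_eq_rescaled hs, pd_rescaled k _ h1, l1_smul, l1_rescaled _ h1,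
    abs_of_pos (by positivity), Real.sqrt_eq_rpow, ← Real.rpow_neg hs.le]

theorem l1_thirdD (i l k : Fin 3) {s : ℝ} (hs : 0 < s) :
    l1 (thirdD i l k s) = s ^ (-(3 / 2) : ℝ) * l1 (thirdD i l k 1) := by
  have h1 : 0 < √s := Real.sqrt_pos.2 hs
  rw [thirdD, heatKernel_eq_rescaled hs, pd_rescaled k _ h1, map_smul, pd_rescaled l _ h1,
    map_smul, map_smul, pd_rescaled i _ h1, l1_smul, l1_smul, l1_smul, l1_rescaled _ h1,
    abs_of_pos (by positivity), ← mul_assoc, ← mul_assoc, Real.sqrt_eq_rpow, ← Real.rpow_neg hs.le,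
    ← Real.rpow_add hs, ← Real.rpow_add hs, thirdD]
  norm_num

section Force

variable {E : Type u} [NormedAddCommGroup E] [NormedSpace ℝ E] {ι : E →L[ℝ] Distr}
  {j : Test →L[ℝ] E} {kk : ℝ}

theorem norm_cv_thirdD_le (h : IsRegular ι j) (i l k : Fin 3) {s : ℝ} (hs : 0 < s) :
    ‖cv h (thirdD i l k s)‖ ≤ s ^ (-(3 / 2) : ℝ) * l1 (thirdD i l k 1) :=
  ContinuousLinearMap.opNorm_le_bound _ (mul_nonneg (by positivity) (l1_nonneg _)) fun f => by
    rw [← l1_thirdD i l k hs]; exact norm_cv_le h _ f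

theorem continuousOn_cv_thirdD (h : IsRegular ι j) [CompleteSpace E] (i l k : Fin 3) :
    ContinuousOn (fun s => cv h (thirdD i l k s)) (Ioi 0) := by
  refine continuousOn_of_semigroup (isSmoothing_heat h) fun σ δ hσ hδ f => ?_
  rw [cv_cv, thirdD, ← pd_convTest_right, ← pd_convTest_right, ← pd_convTest_right,
    convTest_heatKernel hδ hσ, add_comm, thirdD]

theorem integrableOn_cv_thirdD (h : IsRegular ι j) [CompleteSpace E] (i l k : Fin 3) {σ : ℝ}
    (hσ : 0 < σ) : IntegrableOn (fun s => cv h (thirdD i l k s)) (Ioi σ) := by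
  refine Integrable.mono' ((integrableOn_Ioi_rpow_of_lt (a := -(3 / 2)) (by norm_num) hσ).mul_const
    (l1 (thirdD i l k 1)))
    (((continuousOn_cv_thirdD h i l k).mono fun s hs => hσ.trans hs).aestronglyMeasurable
      measurableSet_Ioi) ?_
  filter_upwards [ae_restrict_mem measurableSet_Ioi] with s hs
  exact norm_cv_thirdD_le h i l k (hσ.trans hs)

/-- The operator `∂ᵢ∂ₗ∂ₖ (-Δ)⁻¹ S(σ) = ∫_σ^∞ ∂ᵢ∂ₗ∂ₖ S(s) ds`. -/
noncomputable def tailOp (h : IsRegular ι j) (i l k : Fin 3) (σ : ℝ) : E →L[ℝ] E :=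
  ∫ s in Ioi σ, cv h (thirdD i l k s)

theorem norm_tailOp_le (h : IsRegular ι j) (i l k : Fin 3) {σ : ℝ}
    (hσ : 0 < σ) : ‖tailOp h i l k σ‖ ≤ 2 * l1 (thirdD i l k 1) * σ ^ (-(1 / 2) : ℝ) := by
  have h1 : ‖tailOp h i l k σ‖ ≤ ∫ s in Ioi σ, s ^ (-(3 / 2) : ℝ) * l1 (thirdD i l k 1) := by
    refine norm_integral_le_of_norm_le ((integrableOn_Ioi_rpow_of_lt (by norm_num) hσ).mul_const _)
      ?_
    filter_upwards [ae_restrict_mem measurableSet_Ioi] with s hs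
    exact norm_cv_thirdD_le h i l k (hσ.trans hs)
  refine h1.trans (le_of_eq ?_)
  rw [integral_mul_const, integral_Ioi_rpow_of_lt (by norm_num) hσ]
  norm_num
  ring

theorem ι_tailOp_apply (h : IsRegular ι j) [CompleteSpace E] (i l k : Fin 3) {σ : ℝ}
    (hσ : 0 < σ) (f : E) (φ : Test) :
    ι (tailOp h i l k σ f) φ = ∫ s in Ioi σ, conv (thirdD i l k s) (ι f) φ := by
  have hi := integrableOn_cv_thirdD h i l k hσ
  rw [tailOp, ContinuousLinearMap.integral_apply hi, ← evalTest_apply,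
    ← ContinuousLinearMap.integral_comp_comm _ (hi.apply_continuousLinearMap f)]
  simp only [evalTest_apply, ι_cv]

theorem partialD_tailOp (h : IsRegular ι j) [CompleteSpace E] (m i l k : Fin 3) {σ : ℝ}
    (hσ : 0 < σ) (f : E) (φ : Test) :
    partialD m (ι (tailOp h i l k σ f)) φ =
      ∫ s in Ioi σ, conv (pd m (thirdD i l k s)) (ι f) φ := by
  rw [partialD_apply, ι_tailOp_apply h i l k hσ, ← integral_neg]
  refine integral_congr_ae (.of_forall fun s => ?_)
  simp only
  rw [← partialD_apply, partialD_conv_left]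

theorem integrableOn_conv_thirdD (h : IsRegular ι j) [CompleteSpace E] (m i l k : Fin 3) {σ : ℝ}
    (hσ : 0 < σ) (f : E) (φ : Test) :
    IntegrableOn (fun s => conv (pd m (thirdD i l k s)) (ι f) φ) (Ioi σ) := by
  have hi := (integrableOn_cv_thirdD h i l k hσ).apply_continuousLinearMap f
  refine ((evalTest ι (-(pd m φ))).integrable_comp hi).congr (.of_forall fun s => ?_)
  simp only [evalTest_apply, ι_cv]
  rw [map_neg, ← partialD_apply, partialD_conv_left]

/-- The trace over `i = m` of the derivative `∂ₘ` of `tailOp i` recovers `-∂ₗ∂ₖ S(σ)`, since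
`∑ᵢ ∂ᵢ∂ᵢ S(s) = dS/ds`. -/
theorem sum_partialD_tailOp (h : IsRegular ι j) [CompleteSpace E] (hk : HasScalingDegree ι kk)
    (hk3 : -3 < kk) (l k : Fin 3) {σ : ℝ} (hσ : 0 < σ) (f : E) :
    ∑ i, partialD i (ι (tailOp h i l k σ f)) = -conv (pd l (pd k (heatKernel σ))) (ι f) := by
  refine DFunLike.ext _ _ fun φ => ?_
  simp only [sum_apply, neg_apply, partialD_tailOp h _ _ l k hσ]
  rw [← integral_finsetSum _ fun i _ => integrableOn_conv_thirdD h i i l k hσ f φ]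
  have e (κ : Test) : conv (pd l (pd k κ)) (ι f) φ = evalTest ι (pd k (pd l φ)) (cv h κ f) := by
    rw [← partialD_conv_left, ← partialD_conv_left, partialD_apply, partialD_apply, neg_neg,
      evalTest_apply, ι_cv]
  have e2 (s : ℝ) : ∑ i, conv (pd i (thirdD i l k s)) (ι f) φ =
      evalTest ι (pd k (pd l φ)) (cv h (lapHeat s) f) := by
    rw [← e, lapHeat, map_sum, map_sum, conv_sum, sum_apply]
    refine Finset.sum_congr rfl fun i _ => ?_
    rw [thirdD, pd_comm k i, pd_comm k i, pd_comm l i, pd_comm l i]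
  have hder (s : ℝ) (hs : 0 < s) :
      HasDerivAt (fun s => evalTest ι (pd k (pd l φ)) (cv h (heatKernel s) f))
        (evalTest ι (pd k (pd l φ)) (cv h (lapHeat s) f)) s :=
    (evalTest ι _).hasFDerivAt.comp_hasDerivAt s (hasDerivAt_cv_heat h hs f)
  have hlim := ((evalTest ι (pd k (pd l φ))).continuous.tendsto 0).comp
    (tendsto_cv_heat_atTop h hk hk3 f)
  rw [map_zero] at hlim
  have hint := integrable_finsetSum Finset.univ
    fun i _ => integrableOn_conv_thirdD h i i l k hσ f φ
  simp only [e2] at hint ⊢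
  rw [integral_Ioi_of_hasDerivAt_of_tendsto' (fun s hs => hder s (hσ.trans_le hs)) hint hlim,
    zero_sub, e]

/-- The operator `V ↦ ℙ S(σ) ∇·V`, from the formula `ℙ f = f + ∇ (-Δ)⁻¹ ∇·f`. -/
noncomputable def forceOp (h : IsRegular ι j) (σ : ℝ) : (Fin 3 → Fin 3 → E) →L[ℝ] (Fin 3 → E) :=
  ContinuousLinearMap.pi fun i =>
    ∑ k, (cv h (pd k (heatKernel σ)) ∘L (ContinuousLinearMap.proj i ∘L
        ContinuousLinearMap.proj k) +
      ∑ l, tailOp h i l k σ ∘L (ContinuousLinearMap.proj l ∘L ContinuousLinearMap.proj k))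

theorem forceOp_apply (h : IsRegular ι j) (σ : ℝ) (V : Fin 3 → Fin 3 → E) (i : Fin 3) :
    forceOp h σ V i =
      ∑ k, (cv h (pd k (heatKernel σ)) (V k i) + ∑ l, tailOp h i l k σ (V k l)) := by
  simp [forceOp]

/-- `forceOp` is the Leray projection of `S(σ) ∇·V`: its divergence vanishes by `sum_partialD_tailOp`,
and its gradient part is curl free because third derivatives commute. -/
theorem isLeray_forceOp (h : IsRegular ι j) [CompleteSpace E] (hk : HasScalingDegree ι kk)
    (hk3 : -3 < kk) {σ : ℝ} (hσ : 0 < σ) (V : Fin 3 → Fin 3 → E) :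
    IsLeray (fun i => heat σ (divMat (fun k i => ι (V k i)) i)) (fun i => ι (forceOp h σ V i)) := by
  have hw (i : Fin 3) : ι (forceOp h σ V i) = heat σ (divMat (fun k i => ι (V k i)) i) +
      ∑ k, ∑ l, ι (tailOp h i l k σ (V k l)) := by
    simp only [forceOp_apply, map_sum, map_add, Finset.sum_add_distrib, ι_cv, divMat, heat]
    congr 1
    refine Finset.sum_congr rfl fun k _ => ?_
    rw [← partialD_conv_left, partialD_conv]
  constructor
  · simp only [hw, map_add, Finset.sum_add_distrib, map_sum]
    have h1 : ∑ i, ∑ k, ∑ l, partialD i (ι (tailOp h i l k σ (V k l))) =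
        ∑ l, ∑ k, -conv (pd l (pd k (heatKernel σ))) (ι (V k l)) := by
      simp only [← sum_partialD_tailOp h hk hk3 _ _ hσ]
      rw [Finset.sum_comm]
      exact (Finset.sum_congr rfl fun k _ => Finset.sum_comm).trans Finset.sum_comm
    rw [h1, ← Finset.sum_add_distrib]
    refine Finset.sum_eq_zero fun i _ => ?_
    rw [divMat, map_sum, map_sum, ← Finset.sum_add_distrib]
    refine Finset.sum_eq_zero fun k _ => ?_
    rw [heat, ← partialD_conv, partialD_conv_left, partialD_conv_left, add_neg_cancel]
  · intro i m
    have h1 (i : Fin 3) : heat σ (divMat (fun k i => ι (V k i)) i) - ι (forceOp h σ V i) =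
        -∑ k, ∑ l, ι (tailOp h i l k σ (V k l)) := by
      rw [hw]; abel
    rw [h1, h1]
    simp only [map_neg, map_sum]
    congr 1
    refine Finset.sum_congr rfl fun k _ => Finset.sum_congr rfl fun l _ => ?_
    refine DFunLike.ext _ _ fun φ => ?_
    rw [partialD_tailOp h _ _ _ _ hσ, partialD_tailOp h _ _ _ _ hσ]
    simp only [thirdD]
    refine integral_congr_ae (.of_forall fun s => ?_)
    simp only
    rw [pd_comm i m]

/-- The constant in the bound `‖ℙ S(σ) ∇·V‖ ≤ c σ^{-1/2} ‖V‖`. -/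
noncomputable def forceConst : ℝ :=
  ∑ i, ∑ k, (l1 (pd k (heatKernel 1)) + ∑ l, 2 * l1 (thirdD i l k 1))

theorem forceConst_nonneg : 0 ≤ forceConst :=
  Finset.sum_nonneg fun _ _ => Finset.sum_nonneg fun _ _ => add_nonneg (l1_nonneg _) <|
    Finset.sum_nonneg fun _ _ => mul_nonneg zero_le_two (l1_nonneg _)

theorem norm_forceOp_le (h : IsRegular ι j) {σ : ℝ} (hσ : 0 < σ) (V : Fin 3 → Fin 3 → E) :
    ‖forceOp h σ V‖ ≤ forceConst * σ ^ (-(1 / 2) : ℝ) * ‖V‖ := by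
  have hc := forceConst_nonneg
  have hs : 0 ≤ σ ^ (-(1 / 2) : ℝ) := by positivity
  refine (pi_norm_le_iff_of_nonneg (by positivity)).2 fun i => ?_
  have hV (k l : Fin 3) : ‖V k l‖ ≤ ‖V‖ := (norm_le_pi_norm (V k) l).trans (norm_le_pi_norm V k)
  have h1 : ‖forceOp h σ V i‖ ≤ ∑ k, (l1 (pd k (heatKernel 1)) +
      ∑ l, 2 * l1 (thirdD i l k 1)) * (σ ^ (-(1 / 2) : ℝ) * ‖V‖) := by
    rw [forceOp_apply]
    refine (norm_sum_le _ _).trans (Finset.sum_le_sum fun k _ => ?_)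
    rw [add_mul, Finset.sum_mul]
    refine (norm_add_le _ _).trans (add_le_add ?_ ((norm_sum_le _ _).trans
      (Finset.sum_le_sum fun l _ => ?_)))
    · refine (norm_cv_le h _ _).trans ?_
      rw [l1_pd_heatKernel k hσ]
      calc _ ≤ σ ^ (-(1 / 2) : ℝ) * l1 (pd k (heatKernel 1)) * ‖V‖ :=
            mul_le_mul_of_nonneg_left (hV k i) (mul_nonneg hs (l1_nonneg _))
        _ = _ := by ring
    · refine ((tailOp h i l k σ).le_opNorm _).trans ?_
      calc _ ≤ (2 * l1 (thirdD i l k 1) * σ ^ (-(1 / 2) : ℝ)) * ‖V‖ :=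
            mul_le_mul (norm_tailOp_le h i l k hσ) (hV k l) (norm_nonneg _)
              (mul_nonneg (mul_nonneg zero_le_two (l1_nonneg _)) hs)
        _ = _ := by ring
  rw [← Finset.sum_mul] at h1
  refine h1.trans ?_
  rw [mul_assoc]
  refine mul_le_mul_of_nonneg_right ?_ (by positivity)
  exact Finset.single_le_sum (f := fun i => ∑ k, (l1 (pd k (heatKernel 1)) +
    ∑ l, 2 * l1 (thirdD i l k 1))) (fun i _ => Finset.sum_nonneg fun k _ =>
      add_nonneg (l1_nonneg _) <| Finset.sum_nonneg fun l _ => mul_nonneg zero_le_two (l1_nonneg _))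
    (Finset.mem_univ i)

/-- Both sides are Leray projections of the same field, so that uniqueness applies. -/
theorem heat_forceOp (h : IsRegular ι j) [CompleteSpace E] (hk : HasScalingDegree ι kk)
    (hk3 : -3 < kk) {σ δ : ℝ} (hσ : 0 < σ) (hδ : 0 < δ) (V : Fin 3 → Fin 3 → E) :
    vec (cv h (heatKernel δ)) (forceOp h σ V) = forceOp h (σ + δ) V := by
  refine leray_unique h hk hk3 (f := fun i => heat (σ + δ) (divMat (fun k i => ι (V k i)) i)) ?_
    (isLeray_forceOp h hk hk3 (by positivity) V)
  have := (isLeray_forceOp h hk hk3 hσ V).conv (heatKernel δ)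
  simp only [vec_apply, ι_cv]
  convert this using 2 with i
  change _ = heat δ _
  rw [heat_heat hδ hσ, add_comm]

theorem divMat_dilate {l : ℝ} (hl : 0 < l) (g : Fin 3 → Fin 3 → Distr) (i : Fin 3) :
    divMat (fun k i => dilate l (g k i)) i = l • dilate l (divMat g i) := by
  simp only [divMat, partialD_dilate _ hl, map_sum, Finset.smul_sum]

theorem dil_forceOp (h : IsRegular ι j) [CompleteSpace E] (hk : HasScalingDegree ι kk)
    (hk3 : -3 < kk) {l σ : ℝ} (hl : 0 < l) (hσ : 0 < σ) (V : Fin 3 → Fin 3 → E) :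
    vec (dil h hk l) (forceOp h (l ^ 2 * σ) V) =
      l⁻¹ • forceOp h σ (fun k => vec (dil h hk l) (V k)) := by
  have h1 := (isLeray_forceOp h hk hk3 (show 0 < l ^ 2 * σ by positivity) V).dilate hl
  have h2 := (isLeray_forceOp h hk hk3 hσ (fun k => vec (dil h hk l) (V k))).smul l⁻¹
  refine leray_unique h hk hk3 (f := fun i => dilate l (heat (l ^ 2 * σ)
    (divMat (fun k i => ι (V k i)) i))) ?_ ?_
  · simpa only [vec_apply, ι_dil h hk hl] using h1
  · simp only [Pi.smul_apply, map_smul]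
    convert h2 using 2 with i
    simp only [vec_apply, ι_dil h hk hl]
    rw [divMat_dilate hl, map_smul, smul_smul, inv_mul_cancel₀ hl.ne', one_smul,
      heat_dilate hl hσ]

end Force

/-! ### Products -/

theorem exists_isMollifier : ∃ ρ : Test, IsMollifier ρ := by
  let f : ContDiffBump (0 : R3) := ⟨1, 2, one_pos, one_lt_two⟩
  exact ⟨(f.hasCompactSupport_normed (μ := volume)).toSchwartzMap (f.contDiff_normed (n := ⊤)),
    f.hasCompactSupport_normed, fun x => f.nonneg_normed x, f.integral_normed⟩

theorem IsProduct.unique {f g h h' : Distr} (H : IsProduct f g h) (H' : IsProduct f g h') :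
    h = h' := by
  obtain ⟨ρ, hρ⟩ := exists_isMollifier
  exact DFunLike.ext _ _ fun φ => tendsto_nhds_unique (H ρ hρ φ) (H' ρ hρ φ)

theorem IsProduct.symm {f g h : Distr} (H : IsProduct f g h) : IsProduct g f h := by
  intro ρ hρ φ
  simpa only [mul_comm (convFun _ g _)] using H ρ hρ φ

theorem convFun_add (κ : Test) (f g : Distr) (x : R3) :
    convFun κ (f + g) x = convFun κ f x + convFun κ g x := rfl

theorem convFun_smul (κ : Test) (c : ℝ) (f : Distr) (x : R3) :
    convFun κ (c • f) x = c * convFun κ f x := rfl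

theorem IsProduct.smul {f g h : Distr} (H : IsProduct f g h) (c : ℝ) :
    IsProduct (c • f) g (c • h) := by
  intro ρ hρ φ
  simp only [convFun_smul, mul_assoc, integral_const_mul]
  simpa only [mul_assoc, smul_apply, smul_eq_mul] using (H ρ hρ φ).const_mul c

theorem convFun_dilate (ρ : Test) {l ε : ℝ} (hl : 0 < l) (hε : 0 < ε) (f : Distr) (x : R3) :
    convFun (rescaled ρ ε) (dilate l f) x = convFun (rescaled ρ (l * ε)) f (l • x) := by
  rw [convFun, convFun, dilate_apply, ← smul_eq_mul, ← map_smul]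
  congr 1
  ext y
  simp only [smul_apply, dilateTest_apply (inv_pos.2 hl), SchwartzMap.compSubConstCLM_apply,
    reflectTest_apply, rescaled, dilateTest_apply (inv_pos.2 hε),
    dilateTest_apply (inv_pos.2 (mul_pos hl hε)), smul_eq_mul]
  rw [← mul_assoc, ← mul_inv, mul_pow]
  congr 2
  rw [mul_inv, mul_comm l⁻¹, mul_smul]
  congr 1
  rw [smul_neg, smul_sub, smul_smul l⁻¹ l, inv_mul_cancel₀ hl.ne', one_smul]

theorem IsProduct.dilate {f g h : Distr} (H : IsProduct f g h) {l : ℝ} (hl : 0 < l) :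
    IsProduct (AbstractNS.dilate l f) (AbstractNS.dilate l g) (AbstractNS.dilate l h) := by
  intro ρ hρ φ
  have h1 : Tendsto (fun ε : ℝ => l * ε) (𝓝[>] 0) (𝓝[>] 0) := by
    refine tendsto_nhdsWithin_of_tendsto_nhds_of_eventually_within _ ?_ ?_
    · have : Tendsto (fun ε : ℝ => l * ε) (𝓝 0) (𝓝 (l * 0)) := (continuous_const_mul l).tendsto 0
      rw [mul_zero] at this
      exact this.mono_left nhdsWithin_le_nhds
    · filter_upwards [self_mem_nhdsWithin] with ε hε using mul_pos hl hε
  rw [dilate_apply]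
  refine (((H ρ hρ (dilateTest l⁻¹ φ)).comp h1).const_mul (l ^ 3)⁻¹).congr' ?_
  filter_upwards [self_mem_nhdsWithin] with ε hε
  simp only [convFun_dilate ρ hl hε, Function.comp_apply]
  have h2 := Measure.integral_comp_smul (volume : Measure R3)
    (fun y => convFun (rescaled ρ (l * ε)) f y * convFun (rescaled ρ (l * ε)) g y *
      dilateTest l⁻¹ φ y) l
  simp only [dilateTest_apply (inv_pos.2 hl), smul_smul, inv_mul_cancel₀ hl.ne', one_smul] at h2
  rw [h2]
  simp only [finrank_euclideanSpace, Fintype.card_fin, smul_eq_mul,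
    dilateTest_apply (inv_pos.2 hl)]
  rw [abs_of_pos (by positivity)]

section Product

variable {E : Type u} [NormedAddCommGroup E] [NormedSpace ℝ E] {ι : E →L[ℝ] Distr}
  {j : Test →L[ℝ] E} {k : ℝ}

theorem convFun_eq (h : IsRegular ι j) (κ : Test) (f : E) (x : R3) :
    convFun κ (ι f) x = evalTest ι (reflectTest κ) (trans h (-x) f) := by
  rw [evalTest_apply, ι_trans_apply, neg_neg, convFun]

theorem continuous_convFun (h : IsRegular ι j) (κ : Test) (f : E) :
    Continuous (convFun κ (ι f)) := by
  rw [show convFun κ (ι f) = _ from funext (convFun_eq h κ f)]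
  exact (evalTest ι _).continuous.comp ((continuous_trans h f).comp continuous_neg)

theorem abs_convFun_le (h : IsRegular ι j) (κ : Test) (f : E) (x : R3) :
    ‖convFun κ (ι f) x‖ ≤ ‖evalTest ι (reflectTest κ)‖ * ‖f‖ := by
  rw [convFun_eq h, ← (trans h (-x)).norm_map f]
  exact (evalTest ι (reflectTest κ)).le_opNorm _

theorem integrable_convFun_mul (h : IsRegular ι j) (κ : Test) (f g : E) (φ : Test) :
    Integrable fun x => convFun κ (ι f) x * convFun κ (ι g) x * φ x := by
  refine φ.integrable.bdd_mul (c := ‖evalTest ι (reflectTest κ)‖ * ‖f‖ *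
    (‖evalTest ι (reflectTest κ)‖ * ‖g‖))
    ((continuous_convFun h κ f).mul (continuous_convFun h κ g)).aestronglyMeasurable
    (.of_forall fun x => ?_)
  rw [norm_mul]
  gcongr
  · exact abs_convFun_le h κ f x
  · exact abs_convFun_le h κ g x

/-- Products are additive on the space: there the mollified functions are bounded, so that the integrals
converge absolutely. -/
theorem IsProduct.add (h : IsRegular ι j) {f f' g : E} {m m' : Distr}
    (H : IsProduct (ι f) (ι g) m) (H' : IsProduct (ι f') (ι g) m') :
    IsProduct (ι (f + f')) (ι g) (m + m') := by
  intro ρ hρ φ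
  rw [add_apply]
  refine ((H ρ hρ φ).add (H' ρ hρ φ)).congr fun ε => ?_
  rw [← integral_add (integrable_convFun_mul h _ f g φ) (integrable_convFun_mul h _ f' g φ)]
  refine integral_congr_ae (.of_forall fun x => ?_)
  simp only [map_add, convFun_add]
  ring

end Product

/-! ### The nonlinearity -/

section Nonlinear

variable {E : Type u} [NormedAddCommGroup E] [NormedSpace ℝ E] {ι : E →L[ℝ] Distr}
  {j : Test →L[ℝ] E} {k : ℝ}

/-- `w = ℙ S(σ) ∇·(f ⊗ g)`: the products `fₖ gᵢ` are well defined, and `w ∈ E³` is the Leray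
projection of the smoothed divergence. -/
def IsNonlinear (ι : E →L[ℝ] Distr) (σ : ℝ) (f g w : Fin 3 → E) : Prop :=
  ∃ m : Fin 3 → Fin 3 → Distr,
    (∀ k i, IsProduct (ι (f k)) (ι (g i)) (m k i)) ∧ IsOseen ι σ m w

variable {σ : ℝ} {f f' g g' w w' : Fin 3 → E}

theorem IsNonlinear.unique (h : IsRegular ι j) [CompleteSpace E] (hk : HasScalingDegree ι k)
    (hk3 : -3 < k) (H : IsNonlinear ι σ f g w) (H' : IsNonlinear ι σ f g w') : w = w' := by
  obtain ⟨m, hm, hw⟩ := H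
  obtain ⟨m', hm', hw'⟩ := H'
  have e : m = m' := funext fun k => funext fun i => (hm k i).unique (hm' k i)
  subst e
  exact leray_unique h hk hk3 hw hw'

theorem heat_divMat_add (m m' : Fin 3 → Fin 3 → Distr) (i : Fin 3) :
    heat σ (divMat (fun k i => m k i + m' k i) i) = heat σ (divMat m i) + heat σ (divMat m' i) := by
  simp only [divMat, map_add, Finset.sum_add_distrib]

theorem heat_divMat_smul (c : ℝ) (m : Fin 3 → Fin 3 → Distr) (i : Fin 3) :
    heat σ (divMat (fun k i => c • m k i) i) = c • heat σ (divMat m i) := by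
  simp only [divMat, map_smul, ← Finset.smul_sum]

theorem IsOseen.add {m m' : Fin 3 → Fin 3 → Distr} (H : IsOseen ι σ m w) (H' : IsOseen ι σ m' w') :
    IsOseen ι σ (fun k i => m k i + m' k i) (w + w') := by
  have := IsLeray.add H H'
  simpa only [IsOseen, heat_divMat_add, Pi.add_apply, map_add] using this

theorem IsOseen.smul {m : Fin 3 → Fin 3 → Distr} (H : IsOseen ι σ m w) (c : ℝ) :
    IsOseen ι σ (fun k i => c • m k i) (c • w) := by
  have := IsLeray.smul H c
  simpa only [IsOseen, heat_divMat_smul, Pi.smul_apply, map_smul] using this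

theorem IsNonlinear.add_left (h : IsRegular ι j) (H : IsNonlinear ι σ f g w)
    (H' : IsNonlinear ι σ f' g w') : IsNonlinear ι σ (f + f') g (w + w') := by
  obtain ⟨m, hm, hw⟩ := H
  obtain ⟨m', hm', hw'⟩ := H'
  exact ⟨_, fun k i => (hm k i).add h (hm' k i), hw.add hw'⟩

theorem IsNonlinear.add_right (h : IsRegular ι j) (H : IsNonlinear ι σ f g w)
    (H' : IsNonlinear ι σ f g' w') : IsNonlinear ι σ f (g + g') (w + w') := by
  obtain ⟨m, hm, hw⟩ := H
  obtain ⟨m', hm', hw'⟩ := H'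
  exact ⟨_, fun k i => ((hm k i).symm.add h (hm' k i).symm).symm, hw.add hw'⟩

theorem IsNonlinear.smul_left (H : IsNonlinear ι σ f g w) (c : ℝ) :
    IsNonlinear ι σ (c • f) g (c • w) := by
  obtain ⟨m, hm, hw⟩ := H
  refine ⟨_, fun k i => ?_, hw.smul c⟩
  rw [Pi.smul_apply, map_smul]
  exact (hm k i).smul c

theorem IsNonlinear.smul_right (H : IsNonlinear ι σ f g w) (c : ℝ) :
    IsNonlinear ι σ f (c • g) (c • w) := by
  obtain ⟨m, hm, hw⟩ := H
  refine ⟨_, fun k i => ?_, hw.smul c⟩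
  rw [Pi.smul_apply, map_smul]
  exact ((hm k i).symm.smul c).symm

theorem IsNonlinear.heat (h : IsRegular ι j) [CompleteSpace E] (H : IsNonlinear ι σ f g w)
    (hσ : 0 < σ) {δ : ℝ} (hδ : 0 < δ) :
    IsNonlinear ι (σ + δ) f g (vec (cv h (heatKernel δ)) w) := by
  obtain ⟨m, hm, hw⟩ := H
  refine ⟨m, hm, ?_⟩
  have := IsLeray.conv hw (heatKernel δ)
  simp only [IsOseen, vec_apply, ι_cv]
  convert this using 2 with i
  change _ = AbstractNS.heat δ _
  rw [heat_heat hδ hσ, add_comm]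

theorem IsNonlinear.dil (h : IsRegular ι j) [CompleteSpace E] (hk : HasScalingDegree ι k) {l : ℝ}
    (hl : 0 < l) (hσ : 0 < σ) (H : IsNonlinear ι (l ^ 2 * σ) f g w) :
    IsNonlinear ι σ (vec (AbstractNS.dil h hk l) f) (vec (AbstractNS.dil h hk l) g)
      (l • vec (AbstractNS.dil h hk l) w) := by
  obtain ⟨m, hm, hw⟩ := H
  refine ⟨fun k i => dilate l (m k i), fun k i => ?_, ?_⟩
  · simp only [vec_apply, ι_dil h hk hl]
    exact (hm k i).dilate hl
  · have := (IsLeray.dilate hw hl).smul l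
    simp only [IsOseen, Pi.smul_apply, map_smul, vec_apply, ι_dil h hk hl]
    convert this using 2 with i
    rw [divMat_dilate hl, map_smul, heat_dilate hl hσ]

theorem dil_dil_inv (h : IsRegular ι j) [CompleteSpace E] (hk : HasScalingDegree ι k) {l : ℝ}
    (hl : 0 < l) (f : Fin 3 → E) : vec (dil h hk l) (vec (dil h hk l⁻¹) f) = f :=
  funext fun i => h.inj <| by
    rw [vec_apply, vec_apply, ι_dil h hk hl, ι_dil h hk (inv_pos.2 hl),
      dilate_dilate hl (inv_pos.2 hl), mul_inv_cancel₀ hl.ne', dilate_one]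

theorem norm_vec_dil (h : IsRegular ι j) [CompleteSpace E] (hk : HasScalingDegree ι k) {l : ℝ}
    (hl : 0 < l) (f : Fin 3 → E) : ‖vec (dil h hk l) f‖ = l ^ k * ‖f‖ :=
  norm_vec_eq (by positivity) (fun f => norm_dil h hk hl f) f

/-- The estimate of adequacy, used at the single time `T₀ / 2`, gives all times by dilation: `f` and
`g` are dilated so that `σ` becomes `T₀ / 2`, and the result is dilated back. -/
theorem exists_nonlinear_bound (hE : IsAdequate ι j) (h : IsRegular ι j) [CompleteSpace E]
    {γ : ℝ} (hk : HasScalingDegree ι (2 * γ - 1)) :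
    ∃ c : ℝ, 0 < c ∧ ∀ σ, 0 < σ → ∀ f g : Fin 3 → E, ∃ w, IsNonlinear ι σ f g w ∧
      ‖w‖ ≤ c * σ ^ (-(1 - γ)) * ‖f‖ * ‖g‖ := by
  obtain ⟨T₀, ω, hT, hω, -, H⟩ := hE.estimate
  have hmem : T₀ / 2 ∈ Ioo 0 T₀ := ⟨by linarith, by linarith⟩
  set τ₀ := T₀ / 2
  have hτ₀ : 0 < τ₀ := hmem.1
  have hω0 := hω _ hmem
  refine ⟨ω τ₀ * τ₀ ^ (1 - γ), by positivity, fun σ hσ f g => ?_⟩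
  set l := √(τ₀ / σ) with hldef
  have hl : 0 < l := by positivity
  have hl2 : l ^ 2 * σ = τ₀ := by
    rw [hldef, Real.sq_sqrt (by positivity)]
    field_simp
  obtain ⟨m, hm, hw⟩ := H (vec (dil h hk l⁻¹) f) (vec (dil h hk l⁻¹) g)
  obtain ⟨w, hw, hb⟩ := hw _ hmem
  rw [← hl2] at hw
  have key := IsNonlinear.dil h hk hl hσ ⟨m, hm, hw⟩
  rw [dil_dil_inv h hk hl, dil_dil_inv h hk hl] at key
  refine ⟨_, key, ?_⟩
  rw [norm_vec_dil h hk (inv_pos.2 hl), norm_vec_dil h hk (inv_pos.2 hl)] at hb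
  rw [norm_smul, norm_vec_dil h hk hl, Real.norm_of_nonneg hl.le]
  have e1 : l * l ^ (2 * γ - 1) * (l⁻¹ ^ (2 * γ - 1) * l⁻¹ ^ (2 * γ - 1)) =
      τ₀ ^ (1 - γ) * σ ^ (-(1 - γ)) := by
    rw [Real.inv_rpow hl.le, ← Real.rpow_neg hl.le, ← Real.rpow_add hl]
    nth_rewrite 1 [← Real.rpow_one l]
    rw [← Real.rpow_add hl, ← Real.rpow_add hl, hldef, Real.sqrt_eq_rpow,
      ← Real.rpow_mul (by positivity), Real.div_rpow hτ₀.le hσ.le, Real.rpow_neg hσ.le,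
      div_eq_mul_inv]
    ring_nf
  calc l * (l ^ (2 * γ - 1) * ‖w‖)
      ≤ l * (l ^ (2 * γ - 1) * (ω τ₀ * (l⁻¹ ^ (2 * γ - 1) * ‖f‖) * (l⁻¹ ^ (2 * γ - 1) * ‖g‖))) := by
        gcongr
    _ = ω τ₀ * (l * l ^ (2 * γ - 1) * (l⁻¹ ^ (2 * γ - 1) * l⁻¹ ^ (2 * γ - 1))) * ‖f‖ * ‖g‖ := by
        ring
    _ = _ := by rw [e1]; ring

/-- The bilinear operators `B(σ)(f, g) = ℙ S(σ) ∇·(f ⊗ g)`. -/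
theorem exists_bilinearKernel (hE : IsAdequate ι j) (h : IsRegular ι j) [CompleteSpace E]
    {γ : ℝ} (hk : HasScalingDegree ι (2 * γ - 1)) (hγ : 0 < γ) :
    ∃ (c : ℝ) (B : ℝ → (Fin 3 → E) →L[ℝ] (Fin 3 → E) →L[ℝ] (Fin 3 → E)), 0 < c ∧
      IsBilinearKernel (fun t => vec (cv h (heatKernel t))) γ c B ∧
      (∀ σ, 0 < σ → ∀ f g, IsNonlinear ι σ f g (B σ f g)) ∧
      ∀ l σ, 0 < l → 0 < σ → ∀ f g,
        vec (dil h hk l) (B (l ^ 2 * σ) f g) =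
          l⁻¹ • B σ (vec (dil h hk l) f) (vec (dil h hk l) g) := by
  have hk3 : -3 < 2 * γ - 1 := by linarith
  obtain ⟨c, hc, H⟩ := exists_nonlinear_bound hE h hk
  have main (σ : ℝ) (hσ : 0 < σ) : ∃ B : (Fin 3 → E) →L[ℝ] (Fin 3 → E) →L[ℝ] (Fin 3 → E),
      ∀ f g, IsNonlinear ι σ f g (B f g) ∧ ‖B f g‖ ≤ c * σ ^ (-(1 - γ)) * ‖f‖ * ‖g‖ := by
    choose W hW hWb using H σ hσ
    have huniq {f g w w' : Fin 3 → E} (h1 : IsNonlinear ι σ f g w)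
        (h2 : IsNonlinear ι σ f g w') : w = w' := h1.unique h hk hk3 h2
    refine ⟨(LinearMap.mk₂ ℝ W
      (fun f f' g => huniq (hW _ _) ((hW f g).add_left h (hW f' g)))
      (fun a f g => huniq (hW _ _) ((hW f g).smul_left a))
      (fun f g g' => huniq (hW _ _) ((hW f g).add_right h (hW f g')))
      (fun a f g => huniq (hW _ _) ((hW f g).smul_right a))).mkContinuous₂
        (c * σ ^ (-(1 - γ))) hWb, fun f g => ⟨hW f g, hWb f g⟩⟩
  choose! B hB using main
  have hB1 (σ : ℝ) (hσ : 0 < σ) (f g : Fin 3 → E) := (hB σ hσ f g).1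
  refine ⟨c, B, hc, ⟨fun σ hσ f g => (hB σ hσ f g).2, fun σ δ hσ hδ f g => ?_⟩, hB1,
    fun l σ hl hσ f g => ?_⟩
  · exact ((hB1 σ hσ f g).heat h hσ hδ).unique h hk hk3 (hB1 _ (add_pos hσ hδ) f g)
  · have h1 := (hB1 (l ^ 2 * σ) (by positivity) f g).dil h hk hl hσ
    rw [← h1.unique h hk hk3 (hB1 σ hσ _ _), smul_smul, inv_mul_cancel₀ hl.ne', one_smul]

end Nonlinear

/-! ### The Besov-type norms -/

section Besov

variable {E : Type u} [NormedAddCommGroup E] [NormedSpace ℝ E] {ι : E →L[ℝ] Distr}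
  {j : Test →L[ℝ] E} {k : ℝ}

theorem extNorm_ι (h : IsRegular ι j) (f : E) : extNorm ι (ι f) = ‖f‖ₑ := by
  refine le_antisymm (iInf₂_le (f := fun (g : E) (_ : ι g = ι f) => ‖g‖ₑ) f rfl)
    (le_iInf₂ fun g hg => ?_)
  rw [h.inj hg]

theorem exists_of_extNorm_lt_top {f : Distr} (hf : extNorm ι f < ∞) : ∃ g : E, ι g = f := by
  by_contra! hne
  simp [extNorm, hne] at hf

theorem ofReal_mul_enorm {F : Type*} [NormedAddCommGroup F] {a : ℝ} (ha : 0 ≤ a) (f : F) :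
    ENNReal.ofReal a * ‖f‖ₑ = ENNReal.ofReal (a * ‖f‖) := by
  rw [ENNReal.ofReal_mul ha, ofReal_norm]

theorem beNorm_le (h : IsRegular ι j) [CompleteSpace E] {α M : ℝ} {f : Fin 3 → E}
    (hf : ∀ t, 0 < t → t ^ (α / 2) * ‖vec (cv h (heatKernel t)) f‖ ≤ M) :
    beNorm ι α (fun i => ι (f i)) ≤ ENNReal.ofReal M := by
  refine iSup_le fun i => iSup₂_le fun t ht => ?_
  rw [← ι_cv_heat h, extNorm_ι h, ofReal_mul_enorm (by positivity)]
  refine ENNReal.ofReal_le_ofReal (le_trans ?_ (hf t ht))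
  gcongr
  exact norm_le_pi_norm (vec (cv h (heatKernel t)) f) i

theorem mul_le_iff_le_mul_rpow_neg {t γ a R : ℝ} (ht : 0 < t) :
    t ^ γ * a ≤ R ↔ a ≤ R * t ^ (-γ) := by
  rw [Real.rpow_neg ht.le, ← div_eq_mul_inv, le_div_iff₀' (by positivity)]

/-- The heat orbit of an initial value in the Besov-type space lies in the space. -/
theorem exists_heat_orbit (h : IsRegular ι j) {α ε : ℝ} {u₀ : Fin 3 → Distr}
    (hu : beNorm ι α u₀ ≤ ENNReal.ofReal ε) (hε : 0 ≤ ε) :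
    ∃ y : ℝ → Fin 3 → E, (∀ t, 0 < t → ∀ i, ι (y t i) = heat t (u₀ i)) ∧
      ∀ t, 0 < t → ‖y t‖ ≤ ε * t ^ (-(α / 2)) := by
  have hb (i : Fin 3) (t : ℝ) (ht : 0 < t) :
      ENNReal.ofReal (t ^ (α / 2)) * extNorm ι (heat t (u₀ i)) ≤ ENNReal.ofReal ε :=
    ((le_iSup₂ (f := fun (t : ℝ) (_ : 0 < t) =>
      ENNReal.ofReal (t ^ (α / 2)) * extNorm ι (heat t (u₀ i))) t ht).trans
      (le_iSup (fun i => ⨆ (t : ℝ) (_ : 0 < t),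
        ENNReal.ofReal (t ^ (α / 2)) * extNorm ι (heat t (u₀ i))) i)).trans hu
  have hex (i : Fin 3) (t : ℝ) (ht : 0 < t) : ∃ g : E, ι g = heat t (u₀ i) := by
    refine exists_of_extNorm_lt_top (lt_top_iff_ne_top.2 fun htop => ?_)
    have := hb i t ht
    rw [htop, ENNReal.mul_top (by simpa using Real.rpow_pos_of_pos ht _)] at this
    exact absurd this (by simp)
  choose! y hy using hex
  refine ⟨fun t i => y i t, fun t ht i => hy i t ht, fun t ht => ?_⟩
  refine (pi_norm_le_iff_of_nonneg (by positivity)).2 fun i => ?_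
  have := hb i t ht
  rw [← hy i t ht, extNorm_ι h, ofReal_mul_enorm (by positivity),
    ENNReal.ofReal_le_ofReal_iff hε] at this
  exact (mul_le_iff_le_mul_rpow_neg ht).1 this

theorem le_of_iSup_enorm_le {F : Type*} [NormedAddCommGroup F] {V : ℝ → F} {β ε : ℝ} (hε : 0 ≤ ε)
    (hV : (⨆ (t : ℝ) (_ : 0 < t), ENNReal.ofReal (t ^ β) * ‖V t‖ₑ) ≤ ENNReal.ofReal ε)
    {t : ℝ} (ht : 0 < t) : ‖V t‖ ≤ ε * t ^ (-β) := by
  have := (le_iSup₂ (f := fun (t : ℝ) (_ : 0 < t) =>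
    ENNReal.ofReal (t ^ β) * ‖V t‖ₑ) t ht).trans hV
  rw [ofReal_mul_enorm (by positivity), ENNReal.ofReal_le_ofReal_iff hε] at this
  exact (mul_le_iff_le_mul_rpow_neg ht).1 this

end Besov

/-! ### Weak initial values -/

section Weak

variable {E : Type u} [NormedAddCommGroup E] [NormedSpace ℝ E] {ι : E →L[ℝ] Distr}
  {j : Test →L[ℝ] E} {k : ℝ}

theorem tendsto_heat_zero (f : Distr) (φ : Test) :
    Tendsto (fun t => heat t f φ) (𝓝[>] 0) (𝓝 (f φ)) := by
  have := ((map_continuous f).tendsto φ).comp (tendsto_convTest_heatKernel φ)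
  refine this.congr fun t => ?_
  rw [heat, conv_apply, reflectTest_heatKernel, Function.comp_apply]

/-- The Laplacian of a test function. -/
noncomputable def lapTest (φ : Test) : Test := ∑ i, pd i (pd i φ)

/-- Paired with a test function, an orbit of the heat semigroup solves the heat equation weakly. -/
theorem hasDerivAt_flow (h : IsRegular ι j) [CompleteSpace E] {g : ℝ → Fin 3 → E}
    (hg : ∀ σ δ, 0 < σ → 0 < δ → vec (cv h (heatKernel δ)) (g σ) = g (σ + δ)) (i : Fin 3)
    (φ : Test) {σ : ℝ} (hσ : 0 < σ) :
    HasDerivAt (fun s => ι (g s i) φ) (ι (g σ i) (lapTest φ)) σ := by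
  have hσ2 : 0 < σ / 2 := by positivity
  have e (s : ℝ) (hs : σ / 2 < s) : g s i = cv h (heatKernel (s - σ / 2)) (g (σ / 2) i) := by
    have := congrFun (hg (σ / 2) (s - σ / 2) hσ2 (by linarith)) i
    rw [add_sub_cancel, vec_apply] at this
    exact this.symm
  have h1 := hasDerivAt_cv_heat h (show 0 < σ - σ / 2 by linarith) (g (σ / 2) i)
  have h2 := (evalTest ι φ).hasFDerivAt.comp_hasDerivAt σ (h1.comp_sub_const σ (σ / 2))
  have e2 : evalTest ι φ (cv h (lapHeat (σ - σ / 2)) (g (σ / 2) i)) =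
      ι (g σ i) (lapTest φ) := by
    rw [e σ (by linarith), evalTest_apply, ι_cv, ι_cv, lapHeat, conv_sum, sum_apply, lapTest,
      map_sum]
    refine Finset.sum_congr rfl fun m _ => ?_
    rw [← partialD_conv_left, ← partialD_conv_left, partialD_apply, partialD_apply, neg_neg]
  rw [e2] at h2
  refine h2.congr_of_eventuallyEq ?_
  filter_upwards [lt_mem_nhds (show σ / 2 < σ by linarith)] with s hs
  rw [e s hs]
  rfl

/-- A Duhamel integral has weak initial value zero. -/
theorem IsFlow.tendsto_weak_zero (h : IsRegular ι j) [CompleteSpace E] {a β A : ℝ}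
    {κ : ℝ → ℝ → Fin 3 → E} (hκ : IsFlow (fun t => vec (cv h (heatKernel t))) a β A κ)
    (ha0 : 0 ≤ a) (ha : a < 1) (hβ0 : 0 ≤ β) (hβ : β < 1) (i : Fin 3) (φ : Test) :
    Tendsto (fun t => ι (duhamel κ t i) φ) (𝓝[>] 0) (𝓝 0) := by
  have hA := hκ.nonneg
  have hev (ψ : Test) (f : Fin 3 → E) : |ι (f i) ψ| ≤ ‖evalTest ι ψ‖ * ‖f‖ :=
    ((evalTest ι ψ).le_opNorm (f i)).trans (by gcongr; exact norm_le_pi_norm f i)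
  refine hκ.tendsto_duhamel_zero ha0 ha hβ0 hβ (evalTest ι φ ∘L ContinuousLinearMap.proj i)
    (C := ‖evalTest ι φ‖ * A + ‖evalTest ι (lapTest φ)‖ * A / (1 - a)) fun τ σ hτ hσ hσ1 => ?_
  have key := abs_le_of_hasDerivAt_singular (g := fun σ => ι (κ τ σ i) φ)
    (B := ‖evalTest ι φ‖ * A * τ ^ (-β)) (B' := ‖evalTest ι (lapTest φ)‖ * A * τ ^ (-β)) ha
    (fun σ hσ => hasDerivAt_flow h (fun σ δ hσ hδ => hκ.semigroup τ σ δ hτ hσ hδ) i φ hσ)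
    ?_ (fun σ hσ => ?_) hσ hσ1
  · refine key.trans (le_of_eq ?_)
    ring
  · have := hκ.bound τ 1 hτ one_pos
    rw [Real.one_rpow, one_mul] at this
    rw [mul_assoc]
    exact (hev _ _).trans (by gcongr)
  · refine (hev _ _).trans ?_
    calc _ ≤ ‖evalTest ι (lapTest φ)‖ * (A * (σ ^ (-a) * τ ^ (-β))) := by
          gcongr
          exact hκ.bound τ σ hτ hσ
      _ = _ := by ring

end Weak

/-! ### The self-similar force -/

section SelfSimilar

variable {E : Type u} [NormedAddCommGroup E] [NormedSpace ℝ E] {ι : E →L[ℝ] Distr}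
  {j : Test →L[ℝ] E} {γ : ℝ}

theorem vec_dil_dil {k : ℝ} (h : IsRegular ι j) [CompleteSpace E] (hk : HasScalingDegree ι k)
    {l m : ℝ} (hl : 0 < l) (hm : 0 < m) (f : Fin 3 → E) :
    vec (dil h hk l) (vec (dil h hk m) f) = vec (dil h hk (l * m)) f :=
  funext fun i => h.inj <| by
    rw [vec_apply, vec_apply, vec_apply, ι_dil h hk hl, ι_dil h hk hm, ι_dil h hk (mul_pos hl hm),
      dilate_dilate hl hm]

/-- The self-similar path `t ↦ t⁻¹ V(· / √t)`. -/
noncomputable def selfSimilarPath {k : ℝ} (h : IsRegular ι j) [CompleteSpace E]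
    (hk : HasScalingDegree ι k) (V : Fin 3 → Fin 3 → E) (t : ℝ) : Fin 3 → Fin 3 → E :=
  t⁻¹ • fun m => vec (dil h hk (√t)⁻¹) (V m)

theorem continuousOn_selfSimilarPath {k : ℝ} (h : IsRegular ι j) [CompleteSpace E]
    (hk : HasScalingDegree ι k) (V : Fin 3 → Fin 3 → E) :
    ContinuousOn (selfSimilarPath h hk V) (Ioi 0) := by
  have hinv : ContinuousOn (fun t : ℝ => t⁻¹) (Ioi 0) :=
    continuousOn_inv₀.mono fun t ht => ne_of_gt ht
  refine hinv.smul ?_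
  refine continuousOn_pi.2 fun m => continuousOn_pi.2 fun i => ?_
  refine (continuousOn_dil h hk (V m i)).comp (f := fun t => (√t)⁻¹) ?_ fun t ht => ?_
  · exact Real.continuous_sqrt.continuousOn.inv₀ fun t ht => (Real.sqrt_pos.2 ht).ne'
  · exact inv_pos.2 (Real.sqrt_pos.2 ht)

theorem norm_selfSimilarPath_le (h : IsRegular ι j) [CompleteSpace E]
    (hk : HasScalingDegree ι (2 * γ - 1)) {V : Fin 3 → Fin 3 → E} {ε : ℝ} (hV : ‖V‖ ≤ ε) {t : ℝ}
    (ht : 0 < t) : ‖selfSimilarPath h hk V t‖ ≤ ε * t ^ (-(1 / 2 + γ)) := by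
  have hs : 0 < (√t)⁻¹ := inv_pos.2 (Real.sqrt_pos.2 ht)
  have hε := (norm_nonneg _).trans hV
  have e : t ^ (-(1 / 2 + γ)) = t⁻¹ * (√t)⁻¹ ^ (2 * γ - 1) := by
    rw [Real.inv_rpow (by positivity), ← Real.rpow_neg (by positivity), Real.sqrt_eq_rpow,
      ← Real.rpow_mul ht.le, ← Real.rpow_neg_one, ← Real.rpow_add ht]
    ring_nf
  rw [selfSimilarPath, norm_smul, Real.norm_of_nonneg (by positivity), e, mul_left_comm]
  gcongr
  refine (pi_norm_le_iff_of_nonneg (by positivity)).2 fun m => ?_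
  rw [norm_vec_dil h hk hs, mul_comm]
  gcongr
  exact (norm_le_pi_norm V m).trans hV

theorem selfSimilarPath_scale {k : ℝ} (h : IsRegular ι j) [CompleteSpace E]
    (hk : HasScalingDegree ι k) (V : Fin 3 → Fin 3 → E) {l t : ℝ} (hl : 0 < l) (ht : 0 < t) :
    selfSimilarPath h hk V t =
      l ^ 2 • fun m => vec (dil h hk l) (selfSimilarPath h hk V (l ^ 2 * t) m) := by
  funext m
  have hs : 0 < (√(l ^ 2 * t))⁻¹ := inv_pos.2 (Real.sqrt_pos.2 (by positivity))
  have e : l * (√(l ^ 2 * t))⁻¹ = (√t)⁻¹ := by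
    rw [Real.sqrt_mul (by positivity), Real.sqrt_sq hl.le, mul_inv, mul_inv_cancel_left₀ hl.ne']
  simp only [selfSimilarPath, Pi.smul_apply, map_smul]
  rw [vec_dil_dil h hk hl hs, e, smul_smul, mul_inv, mul_inv_cancel_left₀ (by positivity)]

/-- A divergence-form force with the Navier-Stokes scaling is determined by its potential at
time `1`. -/
theorem divMat_selfSimilarPath {k : ℝ} (h : IsRegular ι j) [CompleteSpace E]
    (hk : HasScalingDegree ι k) {V : Fin 3 → Fin 3 → E} {F : ℝ → Fin 3 → Distr}
    (h1 : F 1 = divMat fun m i => ι (V m i))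
    (hF : ∀ (l t : ℝ) (i : Fin 3), 0 < l → 0 < t → F t i = l ^ 3 • dilate l (F (l ^ 2 * t) i))
    {t : ℝ} (ht : 0 < t) (i : Fin 3) :
    divMat (fun m i => ι (selfSimilarPath h hk V t m i)) i = F t i := by
  have hs : 0 < (√t)⁻¹ := inv_pos.2 (Real.sqrt_pos.2 ht)
  have e : (√t)⁻¹ ^ 2 * t = 1 := by
    rw [inv_pow, Real.sq_sqrt ht.le, inv_mul_cancel₀ ht.ne']
  have e' : t⁻¹ = (√t)⁻¹ ^ 2 := by rw [inv_pow, Real.sq_sqrt ht.le]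
  rw [hF _ t i hs ht, e, h1]
  simp only [selfSimilarPath, Pi.smul_apply, map_smul, vec_apply, ι_dil h hk hs]
  have := divMat_dilate hs (fun m i => ι (V m i)) i
  have h2 : divMat (fun m i => t⁻¹ • dilate (√t)⁻¹ (ι (V m i))) i =
      t⁻¹ • divMat (fun m i => dilate (√t)⁻¹ (ι (V m i))) i := by
    simp only [divMat, map_smul, ← Finset.smul_sum]
  rw [h2, this, smul_smul, e', pow_succ _ 2]

end SelfSimilar

/-! ### Mild solutions -/

section Mild

variable {E : Type u} [NormedAddCommGroup E] [NormedSpace ℝ E] {ι : E →L[ℝ] Distr}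
  {j : Test →L[ℝ] E} {α c R M : ℝ}
  {B : ℝ → (Fin 3 → E) →L[ℝ] (Fin 3 → E) →L[ℝ] (Fin 3 → E)} {T : (Fin 3 → E) →L[ℝ] (Fin 3 → E)}
  {a : Distr → Distr} {u₀ : Fin 3 → Distr} {y₀ : ℝ → Fin 3 → E} {W : ℝ → Fin 3 → Fin 3 → E}
  {F : ℝ → Fin 3 → Distr} {u : ℝ → Fin 3 → E}

/-- The linear part `S(t) u₀ + ∫₀ᵗ S(t-τ) ℙ ∇·W(τ) dτ` of the integral equation, where `y₀` is the
heat orbit of `u₀`. -/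
noncomputable def linearPart (h : IsRegular ι j) (y₀ : ℝ → Fin 3 → E)
    (W : ℝ → Fin 3 → Fin 3 → E) (t : ℝ) : Fin 3 → E :=
  y₀ t + duhamel (fun τ σ => forceOp h σ (W τ)) t

theorem isFlow_force (h : IsRegular ι j) [CompleteSpace E]
    (hk : HasScalingDegree ι (2 * (α / 2) - 1)) (hγ0 : 0 < α / 2)
    (hWc : ContinuousOn W (Ioi 0)) (hW : ∀ t, 0 < t → ‖W t‖ ≤ M * t ^ (-(1 / 2 + α / 2))) :
    IsFlow (fun t => vec (cv h (heatKernel t))) (1 / 2) (1 / 2 + α / 2) (forceConst * M)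
      (fun τ σ => forceOp h σ (W τ)) :=
  isFlow_linear (isSmoothing_heat h).vec
    (fun _ _ hσ hδ V => heat_forceOp h hk (by linarith) hσ hδ V)
    (fun _ hσ V => norm_forceOp_le h hσ V) forceConst_nonneg hWc hW

theorem heat_orbit_semigroup (h : IsRegular ι j) [CompleteSpace E]
    (hy : ∀ t, 0 < t → ∀ i, ι (y₀ t i) = heat t (u₀ i)) {s t : ℝ} (hs : 0 < s) (ht : 0 < t) :
    vec (cv h (heatKernel s)) (y₀ t) = y₀ (s + t) :=
  funext fun i => h.inj <| by
    rw [vec_apply, ι_cv_heat, hy t ht, hy _ (add_pos hs ht), heat_heat hs ht]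

theorem isBesovContinuous_linearPart (h : IsRegular ι j) [CompleteSpace E]
    (hk : HasScalingDegree ι (2 * (α / 2) - 1)) (hγ0 : 0 < α / 2) (hγ : α / 2 < 1 / 2)
    (hy : ∀ t, 0 < t → ∀ i, ι (y₀ t i) = heat t (u₀ i))
    (hyb : ∀ t, 0 < t → ‖y₀ t‖ ≤ M * t ^ (-(α / 2)))
    (hWc : ContinuousOn W (Ioi 0)) (hW : ∀ t, 0 < t → ‖W t‖ ≤ M * t ^ (-(1 / 2 + α / 2))) :
    IsBesovContinuous (fun t => vec (cv h (heatKernel t))) (α / 2) (linearPart h y₀ W) :=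
  (isBesovContinuous_orbit (isSmoothing_heat h).vec hγ0.le
    (fun _ _ hs ht => heat_orbit_semigroup h hy hs ht) hyb).add
    ((isFlow_force h hk hγ0 hWc hW).isBesovContinuous (isSmoothing_heat h).vec hγ0.le hγ.le
      (by norm_num) (by linarith) (by linarith))

theorem norm_linearPart_le (h : IsRegular ι j) [CompleteSpace E]
    (hk : HasScalingDegree ι (2 * (α / 2) - 1)) (hγ0 : 0 < α / 2) (hγ : α / 2 < 1 / 2)
    (hyb : ∀ t, 0 < t → ‖y₀ t‖ ≤ M * t ^ (-(α / 2)))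
    (hWc : ContinuousOn W (Ioi 0)) (hW : ∀ t, 0 < t → ‖W t‖ ≤ M * t ^ (-(1 / 2 + α / 2)))
    {t : ℝ} (ht : 0 < t) :
    ‖linearPart h y₀ W t‖ ≤
      (1 + forceConst * betaBound (1 / 2) (1 / 2 + α / 2)) * M * t ^ (-(α / 2)) := by
  have h1 := (isFlow_force h hk hγ0 hWc hW).norm_duhamel_le (by norm_num) (by norm_num)
    (by linarith) (by linarith) ht
  rw [show 1 - 1 / 2 - (1 / 2 + α / 2) = -(α / 2) by ring] at h1
  refine (norm_add_le _ _).trans ((add_le_add (hyb t ht) h1).trans (le_of_eq ?_))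
  ring

/-- The linear part inherits the scaling invariance of the data. -/
theorem linearPart_scale (h : IsRegular ι j) [CompleteSpace E]
    (hk : HasScalingDegree ι (2 * (α / 2) - 1)) (hγ0 : 0 < α / 2) (hγ : α / 2 < 1 / 2)
    (hy : ∀ t, 0 < t → ∀ i, ι (y₀ t i) = heat t (u₀ i))
    (hu₀ : ∀ (l : ℝ) (i : Fin 3), 0 < l → dilate l (u₀ i) = l⁻¹ • u₀ i)
    (hWc : ContinuousOn W (Ioi 0)) (hW : ∀ t, 0 < t → ‖W t‖ ≤ M * t ^ (-(1 / 2 + α / 2)))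
    (hWs : ∀ l t, 0 < l → 0 < t → W t = l ^ 2 • fun m => vec (dil h hk l) (W (l ^ 2 * t) m))
    {l t : ℝ} (hl : 0 < l) (ht : 0 < t) :
    linearPart h y₀ W t = l • vec (dil h hk l) (linearPart h y₀ W (l ^ 2 * t)) := by
  have hlt : 0 < l ^ 2 * t := by positivity
  have h1 : y₀ t = l • vec (dil h hk l) (y₀ (l ^ 2 * t)) := by
    funext i
    refine h.inj ?_
    rw [Pi.smul_apply, map_smul, vec_apply, ι_dil h hk hl, hy t ht, hy _ hlt, ← heat_dilate hl ht,
      hu₀ l i hl, map_smul, smul_smul, mul_inv_cancel₀ hl.ne', one_smul]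
  have h2 := duhamel_scale hl (vec (dil h hk l)) (k := fun τ σ => forceOp h σ (W τ))
    (k' := fun τ σ => forceOp h σ (W τ)) ht
    ((isFlow_force h hk hγ0 hWc hW).intervalIntegrable (by norm_num) (by norm_num) (by linarith)
      (by linarith) hlt) fun τ σ hτ hσ => by
        rw [dil_forceOp h hk (by linarith) hl hσ, smul_smul, hWs l τ hl hτ, map_smul]
        congr 1
        field_simp
  rw [linearPart, linearPart, h2, map_add, smul_add, ← h1]

/-- The integral equation in terms of the operators `B(σ)` and of the linear part. -/
theorem isMildSolution_iff (h : IsRegular ι j) [CompleteSpace E]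
    (hk : HasScalingDegree ι (2 * (α / 2) - 1)) (hγ0 : 0 < α / 2) (hγ : α / 2 < 1 / 2)
    (hBN : ∀ σ, 0 < σ → ∀ f g, IsNonlinear ι σ f g (B σ f g))
    (ha : ∀ (f : Fin 3 → E) i, a (ι (f i)) = ι (T f i))
    (hy : ∀ t, 0 < t → ∀ i, ι (y₀ t i) = heat t (u₀ i))
    (hWc : ContinuousOn W (Ioi 0)) (hW : ∀ t, 0 < t → ‖W t‖ ≤ M * t ^ (-(1 / 2 + α / 2)))
    (hWF : ∀ t, 0 < t → ∀ i, divMat (fun m i => ι (W t m i)) i = F t i) :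
    IsMildSolution ι a u₀ F u ↔ ∀ t, 0 < t →
      IntervalIntegrable (fun τ => B (t - τ) (T (u τ)) (u τ)) volume 0 t ∧
        u t = mildMap B T (linearPart h y₀ W) u t := by
  have hk3 : -3 < 2 * (α / 2) - 1 := by linarith
  have hN (τ σ : ℝ) (hσ : 0 < σ) : ∃ m : Fin 3 → Fin 3 → Distr,
      (∀ k i, IsProduct (a (ι (u τ k))) (ι (u τ i)) (m k i)) ∧
        IsOseen ι σ m (B σ (T (u τ)) (u τ)) := by
    obtain ⟨m, hm, hw⟩ := hBN σ hσ (T (u τ)) (u τ)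
    exact ⟨m, fun k i => by rw [ha]; exact hm k i, hw⟩
  have hG (τ σ : ℝ) (hτ : 0 < τ) (hσ : 0 < σ) :
      IsLeray (fun i => heat σ (F τ i)) (fun i => ι (forceOp h σ (W τ) i)) := by
    have := isLeray_forceOp h hk hk3 hσ (W τ)
    simpa only [hWF τ hτ] using this
  have heq (t : ℝ) (ht : 0 < t) : u t = mildMap B T (linearPart h y₀ W) u t ↔ ∀ i, ι (u t i) =
      heat t (u₀ i) - ι ((∫ τ in (0 : ℝ)..t, B (t - τ) (T (u τ)) (u τ)) i) +
        ι ((∫ τ in (0 : ℝ)..t, forceOp h (t - τ) (W τ)) i) := by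
    have e (i : Fin 3) : ι (mildMap B T (linearPart h y₀ W) u t i) =
        heat t (u₀ i) - ι ((∫ τ in (0 : ℝ)..t, B (t - τ) (T (u τ)) (u τ)) i) +
          ι ((∫ τ in (0 : ℝ)..t, forceOp h (t - τ) (W τ)) i) := by
      rw [mildMap, linearPart, duhamel, duhamel, Pi.sub_apply, Pi.add_apply, map_sub, map_add,
        hy t ht]
      abel
    simp only [← e]
    exact ⟨fun hu i => congrArg (fun f : Fin 3 → E => ι (f i)) hu,
      fun hu => funext fun i => h.inj (hu i)⟩
  have hGi (t : ℝ) (ht : 0 < t) :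
      IntervalIntegrable (fun τ => forceOp h (t - τ) (W τ)) volume 0 t :=
    (isFlow_force h hk hγ0 hWc hW).intervalIntegrable (by norm_num) (by norm_num) (by linarith)
      (by linarith) ht
  constructor
  · intro H t ht
    obtain ⟨N, G, hN', hG', hNi, hGi', hu⟩ := H t ht
    have eN (τ : ℝ) (hτ : τ ∈ Ioo 0 t) : N τ = B (t - τ) (T (u τ)) (u τ) := by
      obtain ⟨m, hm, hw⟩ := hN' τ hτ
      refine IsNonlinear.unique h hk hk3 ⟨m, fun k i => ?_, hw⟩
        (hBN (t - τ) (sub_pos.2 hτ.2) (T (u τ)) (u τ))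
      rw [← ha]
      exact hm k i
    have eG (τ : ℝ) (hτ : τ ∈ Ioo 0 t) : G τ = forceOp h (t - τ) (W τ) :=
      leray_unique h hk hk3 (hG' τ hτ) (hG τ _ hτ.1 (sub_pos.2 hτ.2))
    refine ⟨(intervalIntegrable_congr_Ioo ht.le eN).1 hNi, (heq t ht).2 ?_⟩
    rw [← integral_congr_Ioo ht.le eN, ← integral_congr_Ioo ht.le eG]
    exact hu
  · intro H t ht
    exact ⟨fun τ => B (t - τ) (T (u τ)) (u τ), fun τ => forceOp h (t - τ) (W τ),
      fun τ hτ => hN τ _ (sub_pos.2 hτ.2), fun τ hτ => hG τ _ hτ.1 (sub_pos.2 hτ.2),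
      (H t ht).1, hGi t ht, (heq t ht).1 (H t ht).2⟩

/-- Solutions of the integral equation with the natural decay belong to the solution class. -/
theorem memX_of_mild (h : IsRegular ι j) [CompleteSpace E]
    (hk : HasScalingDegree ι (2 * (α / 2) - 1)) (hγ0 : 0 < α / 2) (hγ : α / 2 < 1 / 2)
    (hc : 0 ≤ c) (hB : IsBilinearKernel (fun t => vec (cv h (heatKernel t))) (α / 2) c B)
    (hT : ∀ f, ‖T f‖ ≤ ‖f‖)
    (hy : ∀ t, 0 < t → ∀ i, ι (y₀ t i) = heat t (u₀ i))
    (hyb : ∀ t, 0 < t → ‖y₀ t‖ ≤ M * t ^ (-(α / 2)))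
    (hWc : ContinuousOn W (Ioi 0)) (hW : ∀ t, 0 < t → ‖W t‖ ≤ M * t ^ (-(1 / 2 + α / 2)))
    (huc : ContinuousOn u (Ioi 0)) (hu : ∀ t, 0 < t → ‖u t‖ ≤ R * t ^ (-(α / 2)))
    (hue : ∀ t, 0 < t → u t = mildMap B T (linearPart h y₀ W) u t) : MemX ι α u₀ u := by
  have hS := (isSmoothing_heat h).vec
  have hM : 0 ≤ M := by simpa using (norm_nonneg _).trans (hyb 1 one_pos)
  set kN : ℝ → ℝ → Fin 3 → E := fun τ σ => B σ (T (u τ)) (u τ) with hkN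
  set kF : ℝ → ℝ → Fin 3 → E := fun τ σ => forceOp h σ (W τ) with hkF
  have hN : IsFlow (fun t => vec (cv h (heatKernel t))) (1 - α / 2) (2 * (α / 2)) (c * R * R) kN :=
    isFlow_mild hS hB hc hT huc hu
  have hF : IsFlow (fun t => vec (cv h (heatKernel t))) (1 / 2) (1 / 2 + α / 2) (forceConst * M)
      kF := isFlow_force h hk hγ0 hWc hW
  have hue' (t : ℝ) (ht : 0 < t) : u t = y₀ t + duhamel kF t + -duhamel kN t := by
    rw [hue t ht, mildMap, linearPart, sub_eq_add_neg]
  have hcont : IsBesovContinuous (fun t => vec (cv h (heatKernel t))) (α / 2)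
      (fun t => linearPart h y₀ W t + -duhamel kN t) :=
    (isBesovContinuous_linearPart h hk hγ0 hγ hy hyb hWc hW).add
      (hN.isBesovContinuous hS hγ0.le (by linarith) (by linarith) (by linarith) (by linarith)).neg
  constructor
  · -- Each of the three terms is bounded in the Besov-type norm, uniformly in time.
    refine lt_of_le_of_lt (iSup₂_le fun t ht => beNorm_le h (M := M + forceConst * M *
      betaBound (1 / 2 - α / 2) (1 / 2 + α / 2) + c * R * R *
        betaBound (1 - α / 2 - α / 2) (2 * (α / 2))) fun s hs => ?_) ENNReal.ofReal_lt_top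
    have h1 := hF.norm_semigroup_duhamel_le hγ0.le hγ.le (by norm_num) (by linarith) (by linarith)
      (by ring) hs ht
    have h2 := hN.norm_semigroup_duhamel_le (γ := α / 2) hγ0.le (by linarith) (by linarith)
      (by linarith) (by linarith) (by ring) hs ht
    have h3 : s ^ (α / 2) * ‖vec (cv h (heatKernel s)) (y₀ t)‖ ≤ M := by
      rw [mul_le_iff_le_mul_rpow_neg hs, heat_orbit_semigroup h hy hs ht]
      refine (hyb _ (add_pos hs ht)).trans ?_
      gcongr M * ?_
      exact Real.rpow_le_rpow_of_nonpos hs (by linarith) (by linarith)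
    rw [hue' t ht, map_add, map_add, map_neg]
    have h0 : 0 ≤ s ^ (α / 2) := by positivity
    calc _ ≤ s ^ (α / 2) * (‖vec (cv h (heatKernel s)) (y₀ t)‖ +
          ‖vec (cv h (heatKernel s)) (duhamel kF t)‖ +
            ‖vec (cv h (heatKernel s)) (duhamel kN t)‖) := by
          gcongr
          refine (norm_add_le _ _).trans ?_
          rw [norm_neg]
          gcongr
          exact norm_add_le _ _
      _ ≤ _ := by
          rw [mul_add, mul_add]
          exact add_le_add (add_le_add h3 h1) h2
  · intro s hs
    refine ENNReal.tendsto_nhds_zero.2 fun ε hε => ?_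
    obtain ⟨r, hr0, hr⟩ := ENNReal.lt_iff_exists_nnreal_btwn.1 hε
    have hr0 : (0 : ℝ) < r := by exact_mod_cast hr0
    filter_upwards [hcont.weighted s hs r hr0, lt_mem_nhds hs] with t h1 ht
    have := beNorm_le (α := α) h (f := u t - u s) (M := r) fun σ hσ => by
      have h2 := h1 σ hσ
      rw [hue' t ht, hue' s hs]
      exact h2
    simp only [Pi.sub_apply, map_sub] at this
    refine this.trans ?_
    rw [ENNReal.ofReal_coe_nnreal]
    exact hr.le
  · intro i φ
    have h1 := hF.tendsto_weak_zero h (by norm_num) (by norm_num) (by linarith) (by linarith) i φ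
    have h2 := hN.tendsto_weak_zero h (by linarith) (by linarith) (by linarith) (by linarith) i φ
    have h3 := ((tendsto_heat_zero (u₀ i) φ).add h1).sub h2
    rw [add_zero, sub_zero] at h3
    refine h3.congr' ?_
    filter_upwards [self_mem_nhdsWithin] with t ht
    rw [hue' t ht, Pi.add_apply, Pi.add_apply, Pi.neg_apply, map_add, map_add, map_neg, hy t ht,
      add_apply, add_apply, neg_apply, sub_eq_add_neg]
  · refine lt_of_le_of_lt (iSup₂_le fun t ht => ?_) (ENNReal.ofReal_lt_top (r := R))
    rw [ofReal_mul_enorm (by positivity)]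
    exact ENNReal.ofReal_le_ofReal ((mul_le_iff_le_mul_rpow_neg ht).2 (hu t ht))

/-- Small solutions of the integral equation are the unique small mild solutions. -/
theorem isUniqueSmall_of_mild (h : IsRegular ι j) [CompleteSpace E]
    (hk : HasScalingDegree ι (2 * (α / 2) - 1)) (hγ0 : 0 < α / 2) (hγ : α / 2 < 1 / 2)
    (hc : 0 ≤ c) (hB : IsBilinearKernel (fun t => vec (cv h (heatKernel t))) (α / 2) c B)
    (hBN : ∀ σ, 0 < σ → ∀ f g, IsNonlinear ι σ f g (B σ f g))
    (hT : ∀ f, ‖T f‖ ≤ ‖f‖) (ha : ∀ (f : Fin 3 → E) i, a (ι (f i)) = ι (T f i))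
    (hy : ∀ t, 0 < t → ∀ i, ι (y₀ t i) = heat t (u₀ i))
    (hyb : ∀ t, 0 < t → ‖y₀ t‖ ≤ M * t ^ (-(α / 2)))
    (hWc : ContinuousOn W (Ioi 0)) (hW : ∀ t, 0 < t → ‖W t‖ ≤ M * t ^ (-(1 / 2 + α / 2)))
    (hWF : ∀ t, 0 < t → ∀ i, divMat (fun m i => ι (W t m i)) i = F t i)
    (hR : 4 * c * betaBound (1 - α / 2) (2 * (α / 2)) * R ≤ 1)
    (huc : ContinuousOn u (Ioi 0)) (hu : ∀ t, 0 < t → ‖u t‖ ≤ R * t ^ (-(α / 2)))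
    (hue : ∀ t, 0 < t → u t = mildMap B T (linearPart h y₀ W) u t) :
    IsUniqueSmall ι α u₀ (IsMildSolution ι a u₀ F) R u := by
  have hui (t : ℝ) (ht : 0 < t) :=
    intervalIntegrable_mild (isSmoothing_heat h).vec hB hc hγ0 hγ hT huc hu ht
  refine ⟨⟨memX_of_mild h hk hγ0 hγ hc hB hT hy hyb hWc hW huc hu hue,
    (isMildSolution_iff h hk hγ0 hγ hBN ha hy hWc hW hWF).2 fun t ht => ⟨hui t ht, hue t ht⟩,
    fun t ht => (mul_le_iff_le_mul_rpow_neg ht).2 (hu t ht)⟩, fun w _ hw hwR t ht => ?_⟩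
  have hw' := (isMildSolution_iff h hk hγ0 hγ hBN ha hy hWc hW hWF).1 hw
  exact mild_unique hB hc hγ0 hγ hT hR (fun t ht => (mul_le_iff_le_mul_rpow_neg ht).1 (hwR t ht)) hu
    (fun t ht => (hw' t ht).1) hui (fun t ht => (hw' t ht).2) hue ht

end Mild

/-! ### Mollification of self-similar functions -/

section Mollify

variable {E : Type u} [NormedAddCommGroup E] [NormedSpace ℝ E] {ι : E →L[ℝ] Distr}
  {j : Test →L[ℝ] E} {γ : ℝ}

/-- At large times mollification changes a self-similar function little, because in self-similar
variables it is a mollification at scale `t^{-1/2}`. -/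
theorem tendsto_mollify_self_similar (h : IsRegular ι j) [CompleteSpace E]
    (hk : HasScalingDegree ι (2 * γ - 1)) {κ : Test} (hκ : ∫ x, κ x = 1) {u : ℝ → Fin 3 → E}
    {U : Fin 3 → E}
    (hu : ∀ t, 0 < t → u t = t ^ (-(1 / 2) : ℝ) • vec (dil h hk (t ^ (-(1 / 2) : ℝ))) U) :
    Tendsto (fun t => t ^ γ * ‖u t - vec (cv h κ) (u t)‖) atTop (𝓝 0) := by
  have hl : Tendsto (fun t : ℝ => t ^ (-(1 / 2) : ℝ)) atTop (𝓝[>] 0) :=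
    tendsto_nhdsWithin_of_tendsto_nhds_of_eventually_within _
      (tendsto_rpow_neg_atTop (by norm_num)) (by
        filter_upwards [eventually_gt_atTop 0] with t ht using Real.rpow_pos_of_pos ht _)
  have h1 : Tendsto (fun ε => vec (cv h (rescaled κ ε)) U) (𝓝[>] 0) (𝓝 U) :=
    tendsto_pi_nhds.2 fun i => tendsto_cv_rescaled h hκ (U i)
  have h2 := ((tendsto_const_nhds (x := U)).sub (h1.comp hl)).norm
  rw [sub_self, norm_zero] at h2
  refine h2.congr' ?_
  filter_upwards [eventually_gt_atTop 0] with t ht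
  set l := t ^ (-(1 / 2) : ℝ) with hldef
  have hl0 : 0 < l := Real.rpow_pos_of_pos ht _
  have e : u t - vec (cv h κ) (u t) =
      l • vec (dil h hk l) (U - vec (cv h (rescaled κ l)) U) := by
    rw [hu t ht, map_smul, ← smul_sub, map_sub]
    congr 2
    funext i
    refine h.inj ?_
    rw [vec_apply, vec_apply, vec_apply, vec_apply, ι_dil h hk hl0, ι_cv, ι_cv, ι_dil h hk hl0,
      dilate_conv hl0]
  have e2 : t ^ γ * (l * l ^ (2 * γ - 1)) = 1 := by
    nth_rewrite 1 [← Real.rpow_one l]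
    rw [← Real.rpow_add hl0, hldef, ← Real.rpow_mul ht.le, ← Real.rpow_add ht]
    rw [show γ + -(1 / 2) * (1 + (2 * γ - 1)) = 0 by ring, Real.rpow_zero]
  rw [e, norm_smul, norm_vec_dil h hk hl0, Real.norm_of_nonneg hl0.le, ← mul_assoc l,
    ← mul_assoc, e2, one_mul, Function.comp_apply]

theorem l1_eq_one_of_isMollifier {ω : Test} (hω : IsMollifier ω) : l1 ω = 1 := by
  simp only [l1, Real.norm_of_nonneg (hω.nonneg _), hω.integral_eq_one]

end Mollify

end AbstractNS

theorem mainTheorem9 {E : Type*} [NormedAddCommGroup E] [NormedSpace ℝ E] [CompleteSpace E]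
    (p : ℝ) (hp : 3 < p)
    (ι : E →L[ℝ] AbstractNS.Distr) (j : AbstractNS.Test →L[ℝ] E)
    (hE : AbstractNS.IsAdequate ι j)
    (hscal : AbstractNS.HasScalingDegree ι (-(3 / p)))
    (hdense : DenseRange j) :
    ∃ C ε₀ : ℝ, 1 ≤ C ∧ 0 < ε₀ ∧ ∀ ε : ℝ, 0 < ε → ε ≤ ε₀ →
      ∀ (ω : AbstractNS.Test), AbstractNS.IsMollifier ω →
      ∀ (u₀ : Fin 3 → AbstractNS.Distr) (V : ℝ → Fin 3 → Fin 3 → E)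
        (F : ℝ → Fin 3 → AbstractNS.Distr),
        AbstractNS.beNorm ι (1 - 3 / p) u₀ +
            (⨆ (t : ℝ) (_ : 0 < t), ENNReal.ofReal (t ^ (1 - 3 / (2 * p))) * ‖V t‖ₑ)
          < ENNReal.ofReal ε →
        (∀ t : ℝ, 0 < t → F t = AbstractNS.divMat (fun k i => ι (V t k i))) →
        (∀ (l : ℝ) (i : Fin 3), 0 < l → AbstractNS.dilate l (u₀ i) = l⁻¹ • u₀ i) →
        (∀ (l t : ℝ) (i : Fin 3), 0 < l → 0 < t →
          F t i = l ^ 3 • AbstractNS.dilate l (F (l ^ 2 * t) i)) →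
        ∃ (u v : ℝ → Fin 3 → E),
          AbstractNS.IsUniqueSmall ι (1 - 3 / p) u₀
            (AbstractNS.IsNSSolution ι u₀ F) (2 * C * ε) u ∧
          AbstractNS.IsUniqueSmall ι (1 - 3 / p) u₀
            (AbstractNS.IsMollifiedSolution ι ω u₀ F) (2 * C * ε) v ∧
          (∃ U : Fin 3 → E, ∀ (t : ℝ) (i : Fin 3), 0 < t →
            ι (u t i) =
              t ^ (-(1 / 2) : ℝ) • AbstractNS.dilate (t ^ (-(1 / 2) : ℝ)) (ι (U i))) ∧
          Tendsto (fun t : ℝ => t ^ ((1 - 3 / p) / 2) * ‖u t - v t‖) atTop (𝓝 0) := by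
  set α := 1 - 3 / p with hα
  have hp0 : 0 < p := by linarith
  have h3p : 3 / p < 1 := (div_lt_one hp0).2 hp
  have h3p0 : 0 < 3 / p := by positivity
  have hγ0 : 0 < α / 2 := by rw [hα]; linarith
  have hγ : α / 2 < 1 / 2 := by rw [hα]; linarith
  have h : AbstractNS.IsRegular ι j := ⟨hE.base, hdense⟩
  have hk : AbstractNS.HasScalingDegree ι (2 * (α / 2) - 1) := by
    rwa [show 2 * (α / 2) - 1 = -(3 / p) by rw [hα]; ring]
  obtain ⟨c, B, hc, hB, hBN, hDB⟩ := AbstractNS.exists_bilinearKernel hE h hk hγ0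
  have hS := (AbstractNS.isSmoothing_heat h).vec
  set K := AbstractNS.betaBound (1 - α / 2) (2 * (α / 2))
  have hK : 0 < K := AbstractNS.betaBound_pos (by linarith) (by linarith)
  set C := 1 + AbstractNS.forceConst * AbstractNS.betaBound (1 / 2) (1 / 2 + α / 2)
  have hC : 1 ≤ C := le_add_of_nonneg_right <| mul_nonneg AbstractNS.forceConst_nonneg
    (AbstractNS.betaBound_pos (by norm_num) (by linarith)).le
  have hC0 : 0 < C := by linarith
  refine ⟨C, 1 / (8 * c * K * C), hC, by positivity, ?_⟩
  intro ε hε hε₀ ω hω u₀ V F hsmall hFV hu₀ hF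
  have hR : 4 * c * K * (2 * C * ε) ≤ 1 := by
    rw [le_div_iff₀ (by positivity)] at hε₀
    linarith
  -- The data: the heat orbit of `u₀` and the self-similar potential of the force.
  obtain ⟨y₀, hy, hyb⟩ :=
    AbstractNS.exists_heat_orbit h ((le_self_add.trans hsmall.le)) hε.le
  have hV : ‖V 1‖ ≤ ε := by
    simpa using AbstractNS.le_of_iSup_enorm_le hε.le (le_add_self.trans hsmall.le) one_pos
  set W := AbstractNS.selfSimilarPath h hk (V 1)
  have hWc : ContinuousOn W (Ioi 0) := AbstractNS.continuousOn_selfSimilarPath h hk (V 1)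
  have hW (t : ℝ) (ht : 0 < t) : ‖W t‖ ≤ ε * t ^ (-(1 / 2 + α / 2)) :=
    AbstractNS.norm_selfSimilarPath_le h hk hV ht
  have hWF (t : ℝ) (ht : 0 < t) (i : Fin 3) :
      AbstractNS.divMat (fun m i => ι (W t m i)) i = F t i :=
    AbstractNS.divMat_selfSimilarPath h hk (hFV 1 one_pos) hF ht i
  have hyc := (AbstractNS.isBesovContinuous_linearPart h hk hγ0 hγ hy hyb hWc hW).norm
  have hyR (t : ℝ) (ht : 0 < t) :
      ‖AbstractNS.linearPart h y₀ W t‖ ≤ 2 * C * ε / 2 * t ^ (-(α / 2)) := by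
    refine (AbstractNS.norm_linearPart_le h hk hγ0 hγ hyb hWc hW ht).trans (le_of_eq ?_)
    ring
  -- The two solutions.
  have hid : ∀ f : Fin 3 → E, ‖ContinuousLinearMap.id ℝ (Fin 3 → E) f‖ ≤ ‖f‖ := fun f => le_rfl
  have hT (f : Fin 3 → E) : ‖AbstractNS.vec (AbstractNS.cv h ω) f‖ ≤ ‖f‖ := by
    have := AbstractNS.norm_vec_le (AbstractNS.l1_nonneg ω) (AbstractNS.norm_cv_le h ω) f
    rwa [AbstractNS.l1_eq_one_of_isMollifier hω, one_mul] at this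
  obtain ⟨u, huc, hu, hue⟩ := AbstractNS.exists_mild hS hB hc.le hγ0 hγ hid (by positivity) hR
    hyc hyR
  obtain ⟨v, hvc, hv, hve⟩ := AbstractNS.exists_mild hS hB hc.le hγ0 hγ hT (by positivity) hR
    hyc hyR
  have hself (t : ℝ) (ht : 0 < t) : u t = t ^ (-(1 / 2) : ℝ) •
      AbstractNS.vec (AbstractNS.dil h hk (t ^ (-(1 / 2) : ℝ))) (u 1) := by
    have hl : 0 < t ^ (-(1 / 2) : ℝ) := Real.rpow_pos_of_pos ht _
    have e : (t ^ (-(1 / 2) : ℝ)) ^ 2 * t = 1 := by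
      rw [← Real.rpow_natCast, ← Real.rpow_mul ht.le]
      nth_rewrite 2 [← Real.rpow_one t]
      rw [← Real.rpow_add ht]
      norm_num
    have := AbstractNS.mild_self_similar hS hB hc.le hγ0 hγ hR
      (D := fun l => AbstractNS.vec (AbstractNS.dil h hk l))
      (fun l hl f => by rw [AbstractNS.norm_vec_dil h hk hl, neg_sub]) hDB
      (fun l t hl ht => AbstractNS.linearPart_scale h hk hγ0 hγ hy hu₀ hWc hW
        (fun l t hl ht => AbstractNS.selfSimilarPath_scale h hk (V 1) hl ht) hl ht)
      huc hu hue hl ht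
    rwa [e] at this
  refine ⟨u, v, ?_, ?_, ⟨u 1, fun t i ht => ?_⟩, ?_⟩
  · exact AbstractNS.isUniqueSmall_of_mild h hk hγ0 hγ hc.le hB hBN hid (fun f i => rfl) hy hyb hWc
      hW hWF hR huc hu hue
  · exact AbstractNS.isUniqueSmall_of_mild h hk hγ0 hγ hc.le hB hBN hT
      (fun f i => (AbstractNS.ι_cv h ω (f i)).symm) hy hyb hWc hW hWF hR hvc hv hve
  · nth_rewrite 1 [hself t ht]
    rw [Pi.smul_apply, map_smul, AbstractNS.vec_apply,
      AbstractNS.ι_dil h hk (Real.rpow_pos_of_pos ht _)]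
  · exact AbstractNS.mild_asymptotic hS hB hc.le hγ0 hγ hR hT huc hu hue hvc hv hve
      (AbstractNS.tendsto_mollify_self_similar h hk hω.integral_eq_one hself)
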